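/- Let $\Gamma$ be a smooth $2D$-dimensional manifold without boundary (Hausdorff, second countable) and let $J\subseteq\mathbb R$ be an open interval containing $0$. For a vector field $\chi$ write $d_\chi=d+i_\chi$ and $L_\chi=d\,i_\chi+i_\chi d$ on (inhomogeneous) differential forms. A *triple* $(S(\lambda),\chi(\lambda),\psi)$, $\lambda\in J$, consists of the following data: 1. $S(\lambda)=H(\lambda)+\omega(\lambda)$, where $H(\lambda)$ is a function and $\omega(\lambda)$ a closed $2$-form on $\Gamma$, both smooth jointly in $\lambda$ and the point, and $\omega(0)$ is nondegenerate ($\omega(\lambda)$ may be degenerate for $\lambda\neq0$); 2. smooth vector fields $\chi(\lambda)$ with $d_{\chi(\lambda)}S(\lambda)=0$; 3. a smooth $1$-form $\psi$ with $\frac{dS}{d\lambda}=d_{\chi(\lambda)}\psi$. In local coordinates $\phi^\mu$, a form becomes a function of $\phi^\mu$ and Grassmann variables $\psi^\mu$ by substituting $\psi^\mu$ for $d\phi^\mu$. Let $$Z_\lambda=\int d\phi^\mu\,d\psi^\mu\,e^{S(\lambda)}$$ be the integral over $\Gamma$, oriented by $\omega(0)^D$, of the Berezin integral (the coefficient of $\psi^1\cdots\psi^{2D}$)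 of $e^{S(\lambda)}$, computed by cutting $\Gamma$ into countably many pieces, each lying in a coordinate chart. **(a)** Let $(S(\lambda),\chi(\lambda),\psi)$ be a triple. If $\Gamma$ is compact, then $Z_\lambda$ converges absolutely for every $\lambda\in J$, does not depend on the charts used to compute it, and is independent of $\lambda$. For general $\Gamma$, the same independence of $\lambda$ and of the charts holds provided that $Z_\lambda$ converges absolutely for all $\lambda\in J$ and there are no boundary terms at infinity, i.e. there are smooth compactly supported functions $0\le\rho_n\le1$ on $\Gamma$ with $\rho_n\to1$ pointwise such that $\int d\phi^\mu\,d\psi^\mu\,(d\rho_n)\,\psi\,e^{S(\lambda)}\to0$ locally uniformly in $\lambda\in J$. **(b)** (BRST localization.) Let $\omega$ be a symplectic form, $H$ a smooth function and $\chi$ a smooth vector field with $d_\chi(H+\omega)=0$, let $\psi$ be a smooth $1$-form with $L_\chi\psi=0$, and let $\beta\neq0$ be real. Then $(-\beta(H+\omega)+\lambda d_\chi\psi,\ \chi,\ \psi)$ is a triple. Conversely, every triple with $\chi(\lambda)=\chi$ for all $\lambda$ satisfies $L_\chi\psi=0$ and $S(\lambda)=S(0)+\lambda d_\chi\psi$.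 **(c)** (Canonical transformations.) Let $\omega$ be a symplectic form, $H,F$ smooth functions, and let the Hamiltonian vector field $u$ of $F$, defined by $d_u(F+\omega)=0$, have a smooth global flow $\Phi_\lambda$. Then $(\Phi_{-\lambda}^*(H+\omega),\chi(\lambda),dF)$ is a triple for some $\chi(\lambda)$. Conversely, let $(S(\lambda),\chi(\lambda),dF)$ be a triple with $F$ a smooth function. Then $\omega(\lambda)=\omega(0)$ for all $\lambda$, and the Hamiltonian vector field $u$ of $F$ with respect to $\omega(0)$ (which exists and is smooth) satisfies $\frac{dS}{d\lambda}=-L_uS(\lambda)$. If moreover $u$ has a smooth global flow $\Phi_\lambda$, then $\Phi_\lambda^*\omega(0)=\omega(0)$ and $\Phi_\lambda^*S(\lambda)=S(0)$ for all $\lambda\in J$. -/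

import Mathlib

open Set Filter Topology MeasureTheory
open scoped Manifold ContDiff Nat

noncomputable section

namespace LocalizationPrinciple

/-- The model space `ℝ^{2D}` of a `2D`-dimensional phase space. -/
abbrev Model (D : ℕ) : Type := EuclideanSpace ℝ (Fin (2 * D))

/-! ### Differential forms on a manifold

`TangentSpace 𝓘(ℝ, Model D) x` is by definition `Model D`, so that a `k`-form assigns to a point `x`
an alternating map on the tangent space at `x`. -/

/-- Differential `k`-forms on `Γ` (not necessarily smooth). -/
abbrev Form (D : ℕ) (Γ : Type*) (k : ℕ) : Type _ := Γ → (Model D) [⋀^Fin k]→L[ℝ] ℝ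

/-- Inhomogeneous differential forms on `Γ`, by degree. -/
abbrev PolyForm (D : ℕ) (Γ : Type*) : Type _ := (k : ℕ) → Form D Γ k

/-- A homogeneous form as an inhomogeneous one. -/
def ofForm {D : ℕ} {Γ : Type*} (k : ℕ) (α : Form D Γ k) : PolyForm D Γ := Pi.single k α

/-- A function on `Γ` as a form of degree `0`. -/
def ofFun {D : ℕ} {Γ : Type*} (f : Γ → ℝ) : PolyForm D Γ :=
  ofForm 0 fun x ↦ ContinuousAlternatingMap.constOfIsEmpty ℝ (Model D) (Fin 0) (f x)

section Calculus

variable {D : ℕ} {Γ : Type*} [TopologicalSpace Γ] [ChartedSpace (Model D) Γ]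

/-- Pullback of a `k`-form along a map `Γ → Γ`. -/
def pullback (f : Γ → Γ) (P : PolyForm D Γ) : PolyForm D Γ := fun k x ↦
  (P k (f x)).compContinuousLinearMap (mfderiv 𝓘(ℝ, Model D) 𝓘(ℝ, Model D) f x)

/-- The expression of a `k`-form in the coordinates of a chart `e`, that is, its pullback
along `e.symm`. It is meaningful on `e.target`. -/
def Form.inChart {k : ℕ} (α : Form D Γ k) (e : OpenPartialHomeomorph Γ (Model D)) (y : Model D) :
    (Model D) [⋀^Fin k]→L[ℝ] ℝ :=
  (α (e.symm y)).compContinuousLinearMap (mfderiv 𝓘(ℝ, Model D) 𝓘(ℝ, Model D) e.symm y)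

/-- A `k`-form is smooth if its coordinate expressions are. -/
def IsSmoothForm {k : ℕ} (α : Form D Γ k) : Prop :=
  ∀ e ∈ atlas (Model D) Γ, ContDiffOn ℝ ∞ (α.inChart e) e.target

/-- A family of `k`-forms that is smooth jointly in the parameter and the point. -/
def IsSmoothFormFamily {k : ℕ} (J : Set ℝ) (α : ℝ → Form D Γ k) : Prop :=
  ∀ e ∈ atlas (Model D) Γ,
    ContDiffOn ℝ ∞ (fun p : ℝ × Model D ↦ (α p.1).inChart e p.2) (J ×ˢ e.target)

/-- The exterior derivative of a `k`-form, computed at `x` in the preferred chart at `x`. -/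
def Form.d {k : ℕ} (α : Form D Γ k) : Form D Γ (k + 1) := fun x ↦
  (extDeriv (α.inChart (chartAt (Model D) x)) (chartAt (Model D) x x)).compContinuousLinearMap
    (mfderiv 𝓘(ℝ, Model D) 𝓘(ℝ, Model D) (chartAt (Model D) x) x)

/-- The exterior derivative of an inhomogeneous form. -/
def PolyForm.d (P : PolyForm D Γ) : PolyForm D Γ
  | 0 => 0
  | k + 1 => (P k).d

/-- The differential of a function, as a `1`-form. -/
def dFun (F : Γ → ℝ) : Form D Γ 1 := (ofFun F : PolyForm D Γ).d 1

/-- Vector fields on `Γ` (not necessarily smooth). -/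
abbrev VField (D : ℕ) (Γ : Type*) [TopologicalSpace Γ] [ChartedSpace (Model D) Γ] : Type _ :=
  (x : Γ) → TangentSpace 𝓘(ℝ, Model D) x

/-- Smoothness of a vector field. -/
def IsSmoothVField [IsManifold 𝓘(ℝ, Model D) ∞ Γ] (χ : VField D Γ) : Prop :=
  ContMDiff 𝓘(ℝ, Model D) 𝓘(ℝ, Model D).tangent ∞
    (fun x ↦ (⟨x, χ x⟩ : TangentBundle 𝓘(ℝ, Model D) Γ))

/-- The contraction `i_χ`, which inserts `χ` into the first slot. -/
def contract (χ : VField D Γ) (P : PolyForm D Γ) : PolyForm D Γ := fun k x ↦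
  (P (k + 1) x).curryLeft (χ x)

/-- The equivariant derivative `d_χ = d + i_χ`. -/
def equivDeriv (χ : VField D Γ) (P : PolyForm D Γ) : PolyForm D Γ := P.d + contract χ P

/-- The Lie derivative `L_χ = d i_χ + i_χ d`. -/
def lieDeriv (χ : VField D Γ) (P : PolyForm D Γ) : PolyForm D Γ :=
  (contract χ P).d + contract χ P.d

/-- Nondegeneracy of a `2`-form at every point. -/
def IsNondegenerate (Ω : Form D Γ 2) : Prop :=
  ∀ (x : Γ) (v : Model D), (∀ w : Model D, Ω x ![v, w] = 0) → v = 0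

/-- A symplectic form: a smooth closed nondegenerate `2`-form. -/
structure IsSymplectic (Ω : Form D Γ 2) : Prop where
  smooth : IsSmoothForm Ω
  closed : Ω.d = 0
  nondegenerate : IsNondegenerate Ω

/-- The global flow of a vector field `u`, smooth jointly in time and initial point. -/
structure IsSmoothFlow (u : VField D Γ) (Φ : ℝ → Γ → Γ) : Prop where
  smooth : ContMDiff (𝓘(ℝ, ℝ).prod 𝓘(ℝ, Model D)) 𝓘(ℝ, Model D) ∞
    (fun p : ℝ × Γ ↦ Φ p.1 p.2)
  zero : ∀ x, Φ 0 x = x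
  integral : ∀ x, IsMIntegralCurve (I := 𝓘(ℝ, Model D)) (fun t ↦ Φ t x) u

/-! ### Triples -/

/-- `S(t) = H(t) + ω(t)`, `t ∈ J`, is a smooth one-parameter family of Hamiltonian structures,
except that the closed form `ω(t)` is only required to be nondegenerate at `t = 0`. -/
def IsHamiltonianFamily (J : Set ℝ) (S : ℝ → PolyForm D Γ) : Prop :=
  ∃ (H : ℝ → Γ → ℝ) (Ω : ℝ → Form D Γ 2),
    (∀ t ∈ J, S t = ofFun (H t) + ofForm 2 (Ω t)) ∧
    ContMDiffOn (𝓘(ℝ, ℝ).prod 𝓘(ℝ, Model D)) 𝓘(ℝ, ℝ) ∞ (fun p : ℝ × Γ ↦ H p.1 p.2)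
      (J ×ˢ univ) ∧
    IsSmoothFormFamily J Ω ∧
    (∀ t ∈ J, (Ω t).d = 0) ∧
    IsNondegenerate (Ω 0)

/-- `dS/dt = S'` at time `t`, pointwise and in every degree. -/
def HasParamDerivAt (S : ℝ → PolyForm D Γ) (S' : PolyForm D Γ) (t : ℝ) : Prop :=
  ∀ (k : ℕ) (x : Γ), HasDerivAt (fun s ↦ S s k x) (S' k x) t

/-- Triples `(S(t), χ(t), ψ)`, with parameter `t` in `J`. -/
structure IsTriple [IsManifold 𝓘(ℝ, Model D) ∞ Γ] (J : Set ℝ) (S : ℝ → PolyForm D Γ)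
    (χ : ℝ → VField D Γ) (ψ : Form D Γ 1) : Prop where
  hamiltonian : IsHamiltonianFamily J S
  smooth_field : ∀ t ∈ J, IsSmoothVField (χ t)
  invariant : ∀ t ∈ J, equivDeriv (χ t) (S t) = 0
  smooth_form : IsSmoothForm ψ
  deformation : ∀ t ∈ J, HasParamDerivAt S (equivDeriv (χ t) (ofForm 1 ψ)) t

end Calculus

/-! ### Grassmann variables and the Berezin integral -/

/-- The Grassmann algebra on the generators `ψ^0, …, ψ^{2D-1}`. -/
abbrev Grassmann (D : ℕ) : Type := ExteriorAlgebra ℝ (Fin (2 * D) → ℝ)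

/-- The generator `ψ^μ`. -/
def gen {D : ℕ} (μ : Fin (2 * D)) : Grassmann D := ExteriorAlgebra.ι ℝ (Pi.single μ 1)

/-- The Berezin integral `∫ dψ`: the coefficient of `ψ^0 ψ^1 ⋯ ψ^{2D-1}`. -/
def berezin (D : ℕ) : Grassmann D →ₗ[ℝ] ℝ :=
  ExteriorAlgebra.liftAlternating (Pi.single (2 * D) Matrix.detRowAlternating)

/-- The exponential in the Grassmann algebra. An element is the sum of a number (its body) and a
nilpotent element, whose `(2D+1)`-st power vanishes, so that its exponential series is finite. -/
def gexp {D : ℕ} (s : Grassmann D) : Grassmann D :=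
  Real.exp (ExteriorAlgebra.algebraMapInv s) •
    ∑ j ∈ Finset.range (2 * D + 1),
      ((j ! : ℝ)⁻¹) • (s - algebraMap ℝ (Grassmann D) (ExteriorAlgebra.algebraMapInv s)) ^ j

/-- An alternating form as a polynomial in the Grassmann variables:
`(1/k!) η_{μ₁…μ_k} ψ^{μ₁} ⋯ ψ^{μ_k}`. -/
def toGrassmann {D k : ℕ} (η : (Model D) [⋀^Fin k]→L[ℝ] ℝ) : Grassmann D :=
  ((k ! : ℝ)⁻¹) • ∑ μ : Fin k → Fin (2 * D),
    η (fun i ↦ EuclideanSpace.single (μ i) (1 : ℝ)) • (List.ofFn fun i ↦ gen (μ i)).prod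

section Integral

variable {D : ℕ} {Γ : Type*} [TopologicalSpace Γ] [ChartedSpace (Model D) Γ]

/-- The function of the coordinates `φ^μ` of a chart `e` and of the Grassmann variables `ψ^μ` that
arises from a differential form by substituting `ψ^μ` for `dφ^μ`. -/
def PolyForm.super (P : PolyForm D Γ) (e : OpenPartialHomeomorph Γ (Model D)) (y : Model D) :
    Grassmann D :=
  ∑ k ∈ Finset.range (2 * D + 1), toGrassmann ((P k).inChart e y)

/-- A countable system of smooth coordinate charts that covers `Γ`. -/
structure ChartCover (D : ℕ) (Γ : Type*) [TopologicalSpace Γ] [ChartedSpace (Model D) Γ] where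
  chart : ℕ → OpenPartialHomeomorph Γ (Model D)
  mem_maximalAtlas : ∀ i, chart i ∈ IsManifold.maximalAtlas 𝓘(ℝ, Model D) ∞ Γ
  cover : ∀ x, ∃ i, x ∈ (chart i).source

/-- Such a system exists on every (nonempty) second countable manifold. -/
theorem ChartCover.nonempty [Nonempty Γ] [SecondCountableTopology Γ]
    [IsManifold 𝓘(ℝ, Model D) ∞ Γ] : Nonempty (ChartCover D Γ) := by
  obtain ⟨s, hs, hu⟩ := TopologicalSpace.countable_cover_nhds
    (fun x : Γ ↦ (chartAt (Model D) x).open_source.mem_nhds (mem_chart_source (Model D) x))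
  have hne : s.Nonempty := by
    by_contra h
    rw [Set.not_nonempty_iff_eq_empty] at h
    subst h
    have hx : Classical.arbitrary Γ ∈ ⋃ y ∈ (∅ : Set Γ), (chartAt (Model D) y).source :=
      hu ▸ mem_univ _
    simp at hx
  obtain ⟨f, hf⟩ := hs.exists_eq_range hne
  refine ⟨⟨fun i ↦ chartAt (Model D) (f i),
    fun i ↦ IsManifold.chart_mem_maximalAtlas _, fun x ↦ ?_⟩⟩
  have hx : x ∈ ⋃ y ∈ s, (chartAt (Model D) y).source := hu ▸ mem_univ x
  simp only [hf, mem_iUnion, mem_range] at hx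
  obtain ⟨_, ⟨i, rfl⟩, h⟩ := hx
  exact ⟨i, h⟩

/-- The `i`-th cell, in the coordinates of the `i`-th chart: the points of `Γ` in the domain of the
`i`-th chart but of no earlier one. The cells partition `Γ`. -/
def ChartCover.cell (c : ChartCover D Γ) (i : ℕ) : Set (Model D) :=
  {y ∈ (c.chart i).target | ∀ j < i, (c.chart i).symm y ∉ (c.chart j).source}

/-- The orientation of the coordinates of `e` at `y` with respect to the volume form `ω^D`. -/
def orientationSign (Ω : Form D Γ 2) (e : OpenPartialHomeomorph Γ (Model D)) (y : Model D) : ℝ :=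
  Real.sign (berezin D (PolyForm.super (ofForm 2 Ω) e y ^ D))

/-- The coefficient that is integrated in `∫ dφ dψ F`: the Berezin integral over `ψ`, in
coordinates that are oriented by `ω^D`. Here `F` gives, for every chart, a function of `φ` and `ψ`. -/
def superDensity (Ω : Form D Γ 2)
    (F : OpenPartialHomeomorph Γ (Model D) → Model D → Grassmann D)
    (e : OpenPartialHomeomorph Γ (Model D)) (y : Model D) : ℝ :=
  orientationSign Ω e y * berezin D (F e y)

/-- Absolute convergence of `∫ dφ dψ F`. -/
def SuperIntegrable (Ω : Form D Γ 2) (c : ChartCover D Γ)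
    (F : OpenPartialHomeomorph Γ (Model D) → Model D → Grassmann D) : Prop :=
  (∀ i, IntegrableOn (superDensity Ω F (c.chart i)) (c.cell i)) ∧
    Summable fun i ↦ ∫ y in c.cell i, |superDensity Ω F (c.chart i) y|

/-- The superspace integral `∫ dφ dψ F` over `Γ` oriented by `ω^D`. -/
def superIntegral (Ω : Form D Γ 2) (c : ChartCover D Γ)
    (F : OpenPartialHomeomorph Γ (Model D) → Model D → Grassmann D) : ℝ :=
  ∑' i, ∫ y in c.cell i, superDensity Ω F (c.chart i) y

/-- The superspace function `e^S`. -/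
def expAction (S : PolyForm D Γ) (e : OpenPartialHomeomorph Γ (Model D)) (y : Model D) :
    Grassmann D := gexp (S.super e y)

/-- The partition function `Z_t = ∫ dφ dψ e^{S(t)}` converges. The phase space is oriented by the
symplectic form `ω(0)`, the degree `2` part of `S(0)`. -/
def HasPartitionFunction (c : ChartCover D Γ) (S : ℝ → PolyForm D Γ) (t : ℝ) : Prop :=
  SuperIntegrable (S 0 2) c (expAction (S t))

/-- The partition function `Z_t = ∫ dφ dψ e^{S(t)}`. -/
def partitionFunction (c : ChartCover D Γ) (S : ℝ → PolyForm D Γ) (t : ℝ) : ℝ :=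
  superIntegral (S 0 2) c (expAction (S t))

/-- There are no boundary terms at infinity: for some sequence of smooth compactly supported
cutoffs `0 ≤ ρ_n ≤ 1` with `ρ_n → 1`, the flux `∫ dφ dψ (dρ_n) ψ e^{S(t)}` tends to `0`, locally
uniformly in `t`. On a compact phase space `ρ_n = 1` will do. -/
def NoBoundaryTerms (c : ChartCover D Γ) (J : Set ℝ) (S : ℝ → PolyForm D Γ)
    (ψ : Form D Γ 1) : Prop :=
  ∃ ρ : ℕ → Γ → ℝ,
    (∀ n, ContMDiff 𝓘(ℝ, Model D) 𝓘(ℝ, ℝ) ∞ (ρ n)) ∧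
    (∀ n, HasCompactSupport (ρ n)) ∧
    (∀ n x, ρ n x ∈ Icc (0 : ℝ) 1) ∧
    (∀ x, Tendsto (fun n ↦ ρ n x) atTop (𝓝 1)) ∧
    TendstoLocallyUniformlyOn
      (fun n t ↦ superIntegral (S 0 2) c fun e y ↦
        (ofFun (ρ n) : PolyForm D Γ).d.super e y * (ofForm 1 ψ).super e y * expAction (S t) e y)
      (fun _ ↦ 0) atTop J

end Integral

end LocalizationPrinciple

end

noncomputable section

namespace LocalizationPrinciple

set_option linter.unusedSectionVars false

/-! ### Alternating forms in coordinates -/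

section Alternating

variable {D k : ℕ}

/-! The heart of (a) is Stokes' theorem in superspace. In a chart, the Berezin integrals of ψ^μ ψ
e^S form a current whose divergence is the Berezin integral of (d_χψ) e^S. Indeed Σ ψ^μ ∂_μ is the
exterior derivative, dω = 0 removes one term, and the term with dH is traded for i_χψ, because i_χω
= -dH and a contraction has no component of top degree (`sum_fderiv_current`, `berezin_contr`).
Since dS/dλ = d_χψ, differentiating ∫ ρ e^S for a compactly supported cutoff ρ and integrating by
parts leaves minus the flux ∫ dρ ψ e^S (`IsTriple.hasDerivAt_integral`). The mean value inequality,
the uniform decay of the flux on the segment from 0 to λ, and dominated convergence as ρ_n → 1 then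
give independence of λ. On a compact manifold ρ = 1 has no flux.

To globalize, ω(0)^D serves as the reference volume; it vanishes nowhere (`berezin_pow_ne_zero`),
whereas ω(λ) may degenerate. The Berezin coefficient of a superspace function and the coefficient of
ω(0)^D both acquire the Jacobian determinant under a change of chart (`berezin_map`), so their
quotient is a function on Γ. The orientation sign turns the coefficient of ω(0)^D into its absolute
value, the density of the Liouville measure. The sum over cells is thus an ordinary integral against
a measure that does not depend on the cover (`liouville_eq`, `IsTensorial.superIntegral_eq`).

Part (b) is the identity d_χ² = L_χ on one-forms. It gives d_χ S = 0 for the affine family;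
conversely, a fixed χ makes dS/dλ constant, so S is affine, and applying d_χ at some λ ≠ 0 yields
L_χψ = 0.

For (c), ψ = dF makes d_χψ the function dF(χ), so ω is constant. By antisymmetry of ω, dF(χ) =
-dH(u) (`interior_d_antisymm`), which is the transport equation of H along u. The flow of u
preserves ω because the pullback of ω to time × space is closed and its contraction with ∂_t is
exact (`hasDerivAt_pullback_of_closed`). Both directions follow by differentiating H along the flow.
-/

/-- The standard basis vectors of the model space. -/
abbrev stdVec (μ : Fin (2 * D)) : Model D := EuclideanSpace.single μ (1 : ℝ)

theorem sum_smul_stdVec (v : Model D) : ∑ μ, v μ • stdVec μ = v := by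
  ext i
  simp [stdVec, Pi.single_apply]

theorem alternating_apply_eq_sum (η : (Model D) [⋀^Fin k]→L[ℝ] ℝ) (w : Fin k → Model D) :
    η w = ∑ μ : Fin k → Fin (2 * D), (∏ i, w i (μ i)) * η (fun i ↦ stdVec (μ i)) := by
  have h : w = fun i ↦ ∑ μ, w i μ • stdVec μ := funext fun i ↦ (sum_smul_stdVec (w i)).symm
  conv_lhs => rw [h]
  have := η.toMultilinearMap.map_sum (fun i μ ↦ w i μ • stdVec μ)
  refine this.trans (Finset.sum_congr rfl fun μ _ ↦ ?_)
  exact η.toMultilinearMap.map_smul_univ (fun i ↦ w i (μ i)) (fun i ↦ stdVec (μ i))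

theorem alternating_ext_stdVec {η θ : (Model D) [⋀^Fin k]→L[ℝ] ℝ}
    (h : ∀ μ : Fin k → Fin (2 * D), η (fun i ↦ stdVec (μ i)) = θ (fun i ↦ stdVec (μ i))) :
    η = θ := by
  ext w
  rw [alternating_apply_eq_sum η, alternating_apply_eq_sum θ]
  simp only [h]

/-- The components of an alternating form. -/
def components (D k : ℕ) :
    ((Model D) [⋀^Fin k]→L[ℝ] ℝ) →ₗ[ℝ] ((Fin k → Fin (2 * D)) → ℝ) where
  toFun η μ := η (fun i ↦ stdVec (μ i))
  map_add' _ _ := rfl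
  map_smul' _ _ := rfl

theorem components_injective : Function.Injective (components D k) := fun _ _ h ↦
  alternating_ext_stdVec fun μ ↦ congrFun h μ

instance : FiniteDimensional ℝ ((Model D) [⋀^Fin k]→L[ℝ] ℝ) :=
  FiniteDimensional.of_injective (components D k) components_injective

/-- A linear left inverse on a finite-dimensional space is continuous, so smoothness and derivatives
of form-valued maps can be tested on basis vectors. -/
theorem exists_ofComponents (D k : ℕ) :
    ∃ L : ((Fin k → Fin (2 * D)) → ℝ) →L[ℝ] ((Model D) [⋀^Fin k]→L[ℝ] ℝ),
      ∀ η, L (components D k η) = η := by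
  obtain ⟨g, hg⟩ := LinearMap.exists_leftInverse_of_injective (components D k)
    (LinearMap.ker_eq_bot.2 components_injective)
  exact ⟨LinearMap.toContinuousLinearMap g, fun η ↦ LinearMap.congr_fun hg η⟩

variable {X : Type*} [NormedAddCommGroup X] [NormedSpace ℝ X] {s : Set X} {n : WithTop ℕ∞}

theorem contDiffOn_alternating {f : X → (Model D) [⋀^Fin k]→L[ℝ] ℝ}
    (h : ∀ μ : Fin k → Fin (2 * D), ContDiffOn ℝ n (fun x ↦ f x (fun i ↦ stdVec (μ i))) s) :
    ContDiffOn ℝ n f s := by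
  obtain ⟨L, hL⟩ := exists_ofComponents D k
  have : ContDiffOn ℝ n (fun x ↦ L (components D k (f x))) s :=
    L.contDiff.comp_contDiffOn (contDiffOn_pi.2 h)
  simpa only [hL] using this

theorem hasDerivAt_alternating {f : ℝ → (Model D) [⋀^Fin k]→L[ℝ] ℝ}
    {f' : (Model D) [⋀^Fin k]→L[ℝ] ℝ} {t : ℝ}
    (h : ∀ w, HasDerivAt (fun x ↦ f x w) (f' w) t) : HasDerivAt f f' t := by
  obtain ⟨L, hL⟩ := exists_ofComponents D k
  have : HasDerivAt (fun x ↦ L (components D k (f x))) (L (components D k f')) t :=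
    L.hasFDerivAt.comp_hasDerivAt t (hasDerivAt_pi.2 fun μ ↦ h _)
  simpa only [hL] using this

theorem _root_.HasDerivAt.alternating_apply {f : ℝ → (Model D) [⋀^Fin k]→L[ℝ] ℝ}
    {f' : (Model D) [⋀^Fin k]→L[ℝ] ℝ} {t : ℝ} (h : HasDerivAt f f' t) (w : Fin k → Model D) :
    HasDerivAt (fun x ↦ f x w) (f' w) t := by
  let L : ((Model D) [⋀^Fin k]→L[ℝ] ℝ) →ₗ[ℝ] ℝ :=
    { toFun := fun η ↦ η w, map_add' := fun _ _ ↦ rfl, map_smul' := fun _ _ ↦ rfl }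
  exact (LinearMap.toContinuousLinearMap L).hasFDerivAt.comp_hasDerivAt t h

theorem _root_.ContDiffOn.alternating_apply_const {f : X → (Model D) [⋀^Fin k]→L[ℝ] ℝ}
    (hf : ContDiffOn ℝ n f s) (w : Fin k → Model D) : ContDiffOn ℝ n (fun x ↦ f x w) s := by
  let L : ((Model D) [⋀^Fin k]→L[ℝ] ℝ) →ₗ[ℝ] ℝ :=
    { toFun := fun η ↦ η w, map_add' := fun _ _ ↦ rfl, map_smul' := fun _ _ ↦ rfl }
  exact (LinearMap.toContinuousLinearMap L).contDiff.comp_contDiffOn hf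

theorem _root_.ContDiffOn.model_coord {w : X → Model D} (hw : ContDiffOn ℝ n w s)
    (μ : Fin (2 * D)) : ContDiffOn ℝ n (fun x ↦ w x μ) s :=
  (EuclideanSpace.proj μ : Model D →L[ℝ] ℝ).contDiff.comp_contDiffOn hw

theorem _root_.ContDiffOn.alternating_apply {f : X → (Model D) [⋀^Fin k]→L[ℝ] ℝ}
    {w : X → Fin k → Model D} (hf : ContDiffOn ℝ n f s)
    (hw : ∀ i, ContDiffOn ℝ n (fun x ↦ w x i) s) : ContDiffOn ℝ n (fun x ↦ f x (w x)) s := by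
  simp only [fun x ↦ alternating_apply_eq_sum (f x) (w x)]
  refine ContDiffOn.sum fun μ _ ↦ ContDiffOn.mul ?_ (hf.alternating_apply_const _)
  exact contDiffOn_prod fun i _ ↦ (hw i).model_coord (μ i)

theorem _root_.ContDiffOn.alternating_comp {f : X → (Model D) [⋀^Fin k]→L[ℝ] ℝ}
    {A : X → Model D →L[ℝ] Model D} (hf : ContDiffOn ℝ n f s) (hA : ContDiffOn ℝ n A s) :
    ContDiffOn ℝ n (fun x ↦ (f x).compContinuousLinearMap (A x)) s := by
  refine contDiffOn_alternating fun μ ↦ ?_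
  exact hf.alternating_apply fun i ↦ hA.clm_apply contDiffOn_const

theorem _root_.ContDiffOn.alternating_curryLeft {f : X → (Model D) [⋀^Fin (k + 1)]→L[ℝ] ℝ}
    {v : X → Model D} (hf : ContDiffOn ℝ n f s) (hv : ContDiffOn ℝ n v s) :
    ContDiffOn ℝ n (fun x ↦ (f x).curryLeft (v x)) s := by
  refine contDiffOn_alternating fun μ ↦ ?_
  refine hf.alternating_apply (w := fun x ↦ Matrix.vecCons (v x) fun i ↦ stdVec (μ i)) fun i ↦ ?_
  refine Fin.cases ?_ (fun j ↦ ?_) i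
  · simpa using hv
  · simpa using contDiffOn_const

end Alternating

theorem minSmoothness_two_le : minSmoothness ℝ 2 ≤ ∞ := by
  rw [minSmoothness_of_isRCLikeNormedField]
  exact WithTop.coe_le_coe.2 (le_top : (2 : ℕ∞) ≤ ⊤)

/-! ### Coordinate expressions -/

section Charts

variable {D : ℕ} {Γ : Type*} [TopologicalSpace Γ] [ChartedSpace (Model D) Γ]
  {e e' : OpenPartialHomeomorph Γ (Model D)} {x : Γ} {y : Model D} {k : ℕ}

/-- The tangent map of the inverse of a chart. -/
def tangentSymm (e : OpenPartialHomeomorph Γ (Model D)) (y : Model D) : Model D →L[ℝ] Model D :=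
  mfderiv 𝓘(ℝ, Model D) 𝓘(ℝ, Model D) e.symm y

/-- The tangent map of a chart. -/
def tangentChart (e : OpenPartialHomeomorph Γ (Model D)) (x : Γ) : Model D →L[ℝ] Model D :=
  mfderiv 𝓘(ℝ, Model D) 𝓘(ℝ, Model D) e x

theorem inChart_apply (α : Form D Γ k) (e : OpenPartialHomeomorph Γ (Model D)) (y : Model D)
    (v : Fin k → Model D) :
    α.inChart e y v = α (e.symm y) (fun i ↦ tangentSymm e y (v i)) := rfl

theorem mdifferentiable_of_mem_maximalAtlas
    (he : e ∈ IsManifold.maximalAtlas 𝓘(ℝ, Model D) ∞ Γ) :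
    e.MDifferentiable 𝓘(ℝ, Model D) 𝓘(ℝ, Model D) := by
  have h1 := IsManifold.maximalAtlas_subset_of_le (I := 𝓘(ℝ, Model D)) (M := Γ)
    (m := 1) (n := ∞) (by simp) he
  exact ⟨fun x hx ↦ (mdifferentiableAt_of_mem_maximalAtlas h1 hx).mdifferentiableWithinAt,
    fun y hy ↦ (mdifferentiableAt_symm_of_mem_maximalAtlas h1 hy).mdifferentiableWithinAt⟩

theorem tangentChart_tangentSymm (he : e ∈ IsManifold.maximalAtlas 𝓘(ℝ, Model D) ∞ Γ)
    (hy : y ∈ e.target) (v : Model D) : tangentChart e (e.symm y) (tangentSymm e y v) = v :=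
  DFunLike.congr_fun ((mdifferentiable_of_mem_maximalAtlas he).comp_symm_deriv hy) v

theorem tangentSymm_tangentChart (he : e ∈ IsManifold.maximalAtlas 𝓘(ℝ, Model D) ∞ Γ)
    (hx : x ∈ e.source) (v : Model D) : tangentSymm e (e x) (tangentChart e x v) = v :=
  DFunLike.congr_fun ((mdifferentiable_of_mem_maximalAtlas he).symm_comp_deriv hx) v

theorem tangentSymm_tangentChart' (he : e ∈ IsManifold.maximalAtlas 𝓘(ℝ, Model D) ∞ Γ)
    (hy : y ∈ e.target) (v : Model D) : tangentSymm e y (tangentChart e (e.symm y) v) = v := by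
  have := tangentSymm_tangentChart he (e.map_target hy) v
  rwa [e.right_inv hy] at this

/-- The change of coordinates from one chart to another. -/
def transition (e e' : OpenPartialHomeomorph Γ (Model D)) : Model D → Model D := e' ∘ e.symm

/-- The domain of the change of coordinates from one chart to another. -/
def transitionDomain (e e' : OpenPartialHomeomorph Γ (Model D)) : Set (Model D) :=
  (e.symm.trans e').source

theorem mem_transitionDomain :
    y ∈ transitionDomain e e' ↔ y ∈ e.target ∧ e.symm y ∈ e'.source := by
  simp [transitionDomain]

theorem isOpen_transitionDomain : IsOpen (transitionDomain e e') := (e.symm.trans e').open_source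

theorem contDiffOn_transition (he : e ∈ IsManifold.maximalAtlas 𝓘(ℝ, Model D) ∞ Γ)
    (he' : e' ∈ IsManifold.maximalAtlas 𝓘(ℝ, Model D) ∞ Γ) :
    ContDiffOn ℝ ∞ (transition e e') (transitionDomain e e') := by
  rw [← contMDiffOn_iff_contDiffOn]
  exact (contMDiffOn_of_mem_maximalAtlas he').comp
    ((contMDiffOn_symm_of_mem_maximalAtlas he).mono fun y hy ↦ (mem_transitionDomain.1 hy).1)
    fun y hy ↦ (mem_transitionDomain.1 hy).2

theorem contDiffAt_transition (he : e ∈ IsManifold.maximalAtlas 𝓘(ℝ, Model D) ∞ Γ)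
    (he' : e' ∈ IsManifold.maximalAtlas 𝓘(ℝ, Model D) ∞ Γ) (hy : y ∈ transitionDomain e e') :
    ContDiffAt ℝ ∞ (transition e e') y :=
  (contDiffOn_transition he he').contDiffAt (isOpen_transitionDomain.mem_nhds hy)

theorem transition_mem_target (hy : y ∈ transitionDomain e e') :
    transition e e' y ∈ e'.target := e'.map_source (mem_transitionDomain.1 hy).2

theorem symm_transition (hy : y ∈ transitionDomain e e') :
    e'.symm (transition e e' y) = e.symm y := e'.left_inv (mem_transitionDomain.1 hy).2

theorem fderiv_transition (he : e ∈ IsManifold.maximalAtlas 𝓘(ℝ, Model D) ∞ Γ)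
    (he' : e' ∈ IsManifold.maximalAtlas 𝓘(ℝ, Model D) ∞ Γ) (hy : y ∈ transitionDomain e e')
    (v : Model D) :
    fderiv ℝ (transition e e') y v = tangentChart e' (e.symm y) (tangentSymm e y v) := by
  rw [mem_transitionDomain] at hy
  have := mfderiv_comp (I := 𝓘(ℝ, Model D)) (I' := 𝓘(ℝ, Model D)) (I'' := 𝓘(ℝ, Model D)) y
    ((mdifferentiable_of_mem_maximalAtlas he').mdifferentiableAt hy.2)
    ((mdifferentiable_of_mem_maximalAtlas he).mdifferentiableAt_symm hy.1)
  rw [mfderiv_eq_fderiv] at this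
  exact DFunLike.congr_fun this v

theorem tangentSymm_fderiv_transition (he : e ∈ IsManifold.maximalAtlas 𝓘(ℝ, Model D) ∞ Γ)
    (he' : e' ∈ IsManifold.maximalAtlas 𝓘(ℝ, Model D) ∞ Γ) (hy : y ∈ transitionDomain e e')
    (v : Model D) :
    tangentSymm e' (transition e e' y) (fderiv ℝ (transition e e') y v) = tangentSymm e y v := by
  rw [fderiv_transition he he' hy]
  exact tangentSymm_tangentChart he' (mem_transitionDomain.1 hy).2 _

theorem inChart_transition (α : Form D Γ k)
    (he : e ∈ IsManifold.maximalAtlas 𝓘(ℝ, Model D) ∞ Γ)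
    (he' : e' ∈ IsManifold.maximalAtlas 𝓘(ℝ, Model D) ∞ Γ) (hy : y ∈ transitionDomain e e') :
    α.inChart e y = (α.inChart e' (transition e e' y)).compContinuousLinearMap
      (fderiv ℝ (transition e e') y) := by
  ext v
  rw [ContinuousAlternatingMap.compContinuousLinearMap_apply, inChart_apply, inChart_apply,
    symm_transition hy]
  congr 1
  ext1 i
  exact (tangentSymm_fderiv_transition he he' hy (v i)).symm

theorem form_apply_eq_inChart (α : Form D Γ k)
    (he : e ∈ IsManifold.maximalAtlas 𝓘(ℝ, Model D) ∞ Γ) (hx : x ∈ e.source)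
    (v : Fin k → Model D) :
    α x v = α.inChart e (e x) (fun i ↦ tangentChart e x (v i)) := by
  rw [inChart_apply, e.left_inv hx]
  simp only [tangentSymm_tangentChart he hx]

theorem form_ext_inChart {α β : Form D Γ k}
    (he : e ∈ IsManifold.maximalAtlas 𝓘(ℝ, Model D) ∞ Γ) (hx : x ∈ e.source)
    (h : α.inChart e (e x) = β.inChart e (e x)) : α x = β x := by
  ext v
  rw [form_apply_eq_inChart α he hx, form_apply_eq_inChart β he hx, h]

theorem inChart_add (α β : Form D Γ k) (e : OpenPartialHomeomorph Γ (Model D)) :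
    (α + β).inChart e = α.inChart e + β.inChart e := rfl

theorem inChart_smul (c : ℝ) (α : Form D Γ k) (e : OpenPartialHomeomorph Γ (Model D)) :
    (c • α).inChart e = c • α.inChart e := rfl

theorem inChart_zero (e : OpenPartialHomeomorph Γ (Model D)) :
    (0 : Form D Γ k).inChart e = 0 := rfl

theorem inChart_neg (α : Form D Γ k) (e : OpenPartialHomeomorph Γ (Model D)) :
    (-α).inChart e = -α.inChart e := rfl

variable [IsManifold 𝓘(ℝ, Model D) ∞ Γ]

theorem chartAt_mem_maximalAtlas (x : Γ) :
    chartAt (Model D) x ∈ IsManifold.maximalAtlas 𝓘(ℝ, Model D) ∞ Γ :=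
  IsManifold.chart_mem_maximalAtlas x

/-- Near a given point, the expression in `e` is the pullback, by a smooth transition map, of the
expression in the preferred chart there. Smoothness therefore spreads from the preferred charts to
the whole maximal atlas. -/
theorem contDiffOn_inChart_of_chartAt {α : Form D Γ k}
    (hα : ∀ x : Γ, ContDiffOn ℝ ∞ (α.inChart (chartAt (Model D) x)) (chartAt (Model D) x).target)
    (he : e ∈ IsManifold.maximalAtlas 𝓘(ℝ, Model D) ∞ Γ) :
    ContDiffOn ℝ ∞ (α.inChart e) e.target := by
  intro y hy
  set e' := chartAt (Model D) (e.symm y)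
  have he' := chartAt_mem_maximalAtlas (D := D) (e.symm y)
  have hy' : y ∈ transitionDomain e e' := mem_transitionDomain.2 ⟨hy, mem_chart_source _ _⟩
  have h1 : ContDiffOn ℝ ∞ (fun z ↦ (α.inChart e' (transition e e' z)).compContinuousLinearMap
      (fderiv ℝ (transition e e') z)) (transitionDomain e e') := by
    refine ContDiffOn.alternating_comp ?_ ?_
    · exact (hα (e.symm y)).comp (contDiffOn_transition he he')
        fun z hz ↦ transition_mem_target hz
    · exact (contDiffOn_transition he he').fderiv_of_isOpen isOpen_transitionDomain (by simp)
  have h2 : ContDiffOn ℝ ∞ (α.inChart e) (transitionDomain e e') :=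
    h1.congr fun z hz ↦ inChart_transition α he he' hz
  exact (h2.contDiffAt (isOpen_transitionDomain.mem_nhds hy')).contDiffWithinAt

theorem isSmoothForm_of_chartAt {α : Form D Γ k}
    (hα : ∀ x : Γ, ContDiffOn ℝ ∞ (α.inChart (chartAt (Model D) x)) (chartAt (Model D) x).target) :
    IsSmoothForm α := fun _ he ↦
  contDiffOn_inChart_of_chartAt hα (IsManifold.subset_maximalAtlas he)

theorem IsSmoothForm.contDiffOn {α : Form D Γ k} (hα : IsSmoothForm α)
    (he : e ∈ IsManifold.maximalAtlas 𝓘(ℝ, Model D) ∞ Γ) :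
    ContDiffOn ℝ ∞ (α.inChart e) e.target :=
  contDiffOn_inChart_of_chartAt (fun _ ↦ hα _ (chart_mem_atlas _ _)) he

theorem IsSmoothForm.contDiffAt {α : Form D Γ k} (hα : IsSmoothForm α)
    (he : e ∈ IsManifold.maximalAtlas 𝓘(ℝ, Model D) ∞ Γ) (hy : y ∈ e.target) :
    ContDiffAt ℝ ∞ (α.inChart e) y :=
  (hα.contDiffOn he).contDiffAt (e.open_target.mem_nhds hy)

theorem IsSmoothForm.differentiableAt {α : Form D Γ k} (hα : IsSmoothForm α)
    (he : e ∈ IsManifold.maximalAtlas 𝓘(ℝ, Model D) ∞ Γ) (hy : y ∈ e.target) :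
    DifferentiableAt ℝ (α.inChart e) y :=
  (hα.contDiffAt he hy).differentiableAt (by simp)

/-- The exterior derivative can be computed in any chart. -/
theorem IsSmoothForm.inChart_d {α : Form D Γ k} (hα : IsSmoothForm α)
    (he : e ∈ IsManifold.maximalAtlas 𝓘(ℝ, Model D) ∞ Γ) (hy : y ∈ e.target) :
    α.d.inChart e y = extDeriv (α.inChart e) y := by
  -- `Form.d` is computed in the preferred chart of the point itself, so this is the chart to
  -- compare with; the exterior derivative commutes with pullback by the transition map.
  set e' := chartAt (Model D) (e.symm y)
  have he' := chartAt_mem_maximalAtlas (D := D) (e.symm y)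
  have hy' : y ∈ transitionDomain e e' := mem_transitionDomain.2 ⟨hy, mem_chart_source _ _⟩
  have h1 : α.inChart e =ᶠ[𝓝 y] fun z ↦
      (α.inChart e' (transition e e' z)).compContinuousLinearMap
        (fderiv ℝ (transition e e') z) := by
    filter_upwards [isOpen_transitionDomain.mem_nhds hy'] with z hz
    exact inChart_transition α he he' hz
  rw [h1.extDeriv_eq, extDeriv_pullback (hα.differentiableAt he' (transition_mem_target hy'))
    (contDiffAt_transition he he' hy') minSmoothness_two_le]
  ext v
  rw [ContinuousAlternatingMap.compContinuousLinearMap_apply, inChart_apply]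
  change extDeriv _ _ (fun i ↦ tangentChart e' (e.symm y) (tangentSymm e y (v i))) = _
  congr 1
  ext1 i
  exact (fderiv_transition he he' hy' (v i)).symm

theorem _root_.ContDiffOn.extDeriv {s : Set (Model D)} (hs : IsOpen s)
    {f : Model D → (Model D) [⋀^Fin k]→L[ℝ] ℝ} (hf : ContDiffOn ℝ ∞ f s) :
    ContDiffOn ℝ ∞ (extDeriv f) s :=
  (ContinuousAlternatingMap.alternatizeUncurryFinCLM ℝ (Model D) ℝ (n := k)).contDiff.comp_contDiffOn
    (hf.fderiv_of_isOpen hs (by simp))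

theorem IsSmoothForm.d {α : Form D Γ k} (hα : IsSmoothForm α) : IsSmoothForm α.d := fun e he ↦
  ((hα e he).extDeriv e.open_target).congr fun _ hy ↦
    hα.inChart_d (IsManifold.subset_maximalAtlas he) hy

theorem IsSmoothForm.add {α β : Form D Γ k} (hα : IsSmoothForm α) (hβ : IsSmoothForm β) :
    IsSmoothForm (α + β) := fun e he ↦ (hα e he).add (hβ e he)

theorem IsSmoothForm.const_smul {α : Form D Γ k} (hα : IsSmoothForm α) (c : ℝ) :
    IsSmoothForm (c • α) := fun e he ↦ (hα e he).const_smul c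

theorem IsSmoothForm.neg {α : Form D Γ k} (hα : IsSmoothForm α) : IsSmoothForm (-α) :=
  fun e he ↦ (hα e he).neg

theorem isSmoothForm_zero : IsSmoothForm (0 : Form D Γ k) := fun _ _ ↦
  contDiffOn_const (c := (0 : (Model D) [⋀^Fin k]→L[ℝ] ℝ))

theorem d_add {α β : Form D Γ k} (hα : IsSmoothForm α) (hβ : IsSmoothForm β) :
    (α + β).d = α.d + β.d := by
  ext1 x
  have he := chartAt_mem_maximalAtlas (D := D) x
  have hy := mem_chart_target (Model D) x
  simp only [Form.d, inChart_add, Pi.add_apply,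
    extDeriv_add (hα.differentiableAt he hy) (hβ.differentiableAt he hy)]
  rfl

theorem d_smul (c : ℝ) (α : Form D Γ k) : (c • α).d = c • α.d := by
  ext1 x
  simp only [Form.d, inChart_smul, Pi.smul_apply, extDeriv_smul]
  rfl

theorem d_zero : (0 : Form D Γ k).d = 0 := by
  have := d_smul (0 : ℝ) (0 : Form D Γ k)
  rwa [zero_smul, zero_smul] at this

theorem d_neg (α : Form D Γ k) : (-α).d = -α.d := by
  have := d_smul (-1) α
  rwa [show (-1 : ℝ) • α = -α from neg_one_smul ℝ α,
    show (-1 : ℝ) • α.d = -α.d from neg_one_smul ℝ α.d] at this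

theorem IsSmoothForm.d_d {α : Form D Γ k} (hα : IsSmoothForm α) : α.d.d = 0 := by
  ext1 x
  have he := chartAt_mem_maximalAtlas (D := D) x
  have hx := mem_chart_source (Model D) x
  have hy := mem_chart_target (Model D) x
  refine form_ext_inChart he hx ?_
  rw [hα.d.inChart_d he hy]
  -- The outer derivative needs the chart formula for the inner one on a neighbourhood, where the
  -- preferred chart of nearby points may be a different one.
  have h : α.d.inChart (chartAt (Model D) x) =ᶠ[𝓝 (chartAt (Model D) x x)]
      extDeriv (α.inChart (chartAt (Model D) x)) := by
    filter_upwards [(chartAt (Model D) x).open_target.mem_nhds hy] with z hz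
    exact hα.inChart_d he hz
  rw [h.extDeriv_eq, extDeriv_extDeriv_apply (hα.contDiffAt he hy) minSmoothness_two_le]
  rfl

end Charts

/-! ### Functions, vector fields and inhomogeneous forms -/

section Fields

variable {D : ℕ} {Γ : Type*} [TopologicalSpace Γ] [ChartedSpace (Model D) Γ]
  {e e' : OpenPartialHomeomorph Γ (Model D)} {x : Γ} {y : Model D} {k : ℕ}

/-- A function as a `0`-form. -/
def constForm (D : ℕ) {Γ : Type*} (f : Γ → ℝ) : Form D Γ 0 := fun x ↦
  ContinuousAlternatingMap.constOfIsEmpty ℝ (Model D) (Fin 0) (f x)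

theorem ofFun_eq (f : Γ → ℝ) : (ofFun f : PolyForm D Γ) = ofForm 0 (constForm D f) := rfl

theorem dFun_eq (f : Γ → ℝ) : (dFun f : Form D Γ 1) = (constForm D f).d := by
  change (Pi.single (M := fun k ↦ Form D Γ k) 0 (constForm D f) 0).d = _
  rw [Pi.single_eq_same]

theorem constForm_apply (f : Γ → ℝ) (x : Γ) (v : Fin 0 → Model D) :
    constForm D f x v = f x := rfl

theorem eq_constForm (α : Form D Γ 0) : α = constForm D (fun x ↦ α x ![]) := by
  ext x v
  rw [constForm_apply]
  congr 1
  exact Subsingleton.elim _ _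

theorem inChart_constForm (f : Γ → ℝ) (e : OpenPartialHomeomorph Γ (Model D)) :
    (constForm D f).inChart e = fun y ↦
      ContinuousAlternatingMap.constOfIsEmpty ℝ (Model D) (Fin 0) (f (e.symm y)) := rfl

/-- Contraction of a homogeneous form with a vector field. -/
def interior (χ : VField D Γ) (α : Form D Γ (k + 1)) : Form D Γ k := fun x ↦
  (α x).curryLeft (χ x)

/-- The components of a vector field in a chart. -/
def VField.inChart (χ : VField D Γ) (e : OpenPartialHomeomorph Γ (Model D)) (y : Model D) :
    Model D := tangentChart e (e.symm y) (χ (e.symm y))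

theorem inChart_interior (χ : VField D Γ) (α : Form D Γ (k + 1))
    (he : e ∈ IsManifold.maximalAtlas 𝓘(ℝ, Model D) ∞ Γ) (hy : y ∈ e.target) :
    (interior χ α).inChart e y = (α.inChart e y).curryLeft (χ.inChart e y) := by
  ext v
  rw [inChart_apply]
  change α (e.symm y) (Matrix.vecCons _ _) = α.inChart e y (Matrix.vecCons _ _)
  rw [inChart_apply]
  congr 1
  ext1 i
  refine Fin.cases ?_ (fun j ↦ ?_) i
  · exact (tangentSymm_tangentChart' he hy _).symm
  · rfl

theorem contract_ofForm_succ (χ : VField D Γ) (α : Form D Γ (k + 1)) :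
    contract χ (ofForm (k + 1) α) = ofForm k (interior χ α) := by
  funext j
  change interior χ (ofForm (k + 1) α (j + 1)) = _
  rcases eq_or_ne j k with rfl | h
  · simp only [ofForm, Pi.single_eq_same]
  · simp only [ofForm]
    rw [Pi.single_eq_of_ne h, Pi.single_eq_of_ne (by simpa using h)]
    rfl

theorem contract_ofForm_zero (χ : VField D Γ) (α : Form D Γ 0) :
    contract χ (ofForm 0 α) = 0 := by
  funext j
  change interior χ (ofForm 0 α (j + 1)) = _
  simp only [ofForm]
  rw [Pi.single_eq_of_ne (by simp)]
  rfl

theorem contract_add (χ : VField D Γ) (P Q : PolyForm D Γ) :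
    contract χ (P + Q) = contract χ P + contract χ Q := rfl

theorem contract_smul (χ : VField D Γ) (c : ℝ) (P : PolyForm D Γ) :
    contract χ (c • P) = c • contract χ P := rfl

theorem ofForm_add (k : ℕ) (α β : Form D Γ k) : ofForm k (α + β) = ofForm k α + ofForm k β :=
  Pi.single_add (f := fun k ↦ Form D Γ k) k α β

theorem ofForm_zero (k : ℕ) : ofForm k (0 : Form D Γ k) = 0 :=
  Pi.single_zero (M := fun k ↦ Form D Γ k) k

theorem ofForm_smul (k : ℕ) (c : ℝ) (α : Form D Γ k) : ofForm k (c • α) = c • ofForm k α :=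
  Pi.single_smul (f := fun k ↦ Form D Γ k) k c α

theorem ofForm_neg (k : ℕ) (α : Form D Γ k) : ofForm k (-α) = -ofForm k α :=
  Pi.single_neg (f := fun k ↦ Form D Γ k) k α

theorem ofForm_same (k : ℕ) (α : Form D Γ k) : ofForm k α k = α :=
  Pi.single_eq_same (M := fun k ↦ Form D Γ k) k α

theorem ofForm_ne {j k : ℕ} (h : j ≠ k) (α : Form D Γ k) : ofForm k α j = 0 :=
  Pi.single_eq_of_ne (M := fun k ↦ Form D Γ k) h α

variable [IsManifold 𝓘(ℝ, Model D) ∞ Γ]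

theorem polyForm_d_ofForm (k : ℕ) (α : Form D Γ k) :
    (ofForm k α).d = ofForm (k + 1) α.d := by
  funext j
  rcases j with _ | j
  · exact (ofForm_ne (by simp) _).symm
  · change (ofForm k α j).d = _
    rcases eq_or_ne j k with rfl | h
    · rw [ofForm_same, ofForm_same]
    · rw [ofForm_ne h, ofForm_ne (by simpa using h), d_zero]

/-- The forms of every degree are smooth. -/
def IsSmoothPolyForm (P : PolyForm D Γ) : Prop := ∀ k, IsSmoothForm (P k)

theorem IsSmoothForm.ofForm {α : Form D Γ k} (hα : IsSmoothForm α) :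
    IsSmoothPolyForm (ofForm k α) := by
  intro j
  rcases eq_or_ne j k with rfl | h
  · rwa [ofForm_same]
  · rw [ofForm_ne h]; exact isSmoothForm_zero

theorem polyForm_d_add {P Q : PolyForm D Γ} (hP : IsSmoothPolyForm P) (hQ : IsSmoothPolyForm Q) :
    (P + Q).d = P.d + Q.d := by
  funext j
  rcases j with _ | j
  · exact (add_zero _).symm
  · exact d_add (hP j) (hQ j)

theorem polyForm_d_smul (c : ℝ) (P : PolyForm D Γ) : (c • P).d = c • P.d := by
  funext j
  rcases j with _ | j
  · exact (smul_zero c).symm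
  · exact d_smul c (P j)

theorem contMDiff_iff_isSmoothForm {f : Γ → ℝ} :
    ContMDiff 𝓘(ℝ, Model D) 𝓘(ℝ, ℝ) ∞ f ↔ IsSmoothForm (constForm D f) := by
  constructor
  · intro hf
    refine fun e he ↦ contDiffOn_alternating fun μ ↦ ?_
    rw [← contMDiffOn_iff_contDiffOn]
    exact hf.comp_contMDiffOn
      (contMDiffOn_symm_of_mem_maximalAtlas (IsManifold.subset_maximalAtlas he))
  · intro hf x
    have h1 := ((hf _ (chart_mem_atlas (Model D) x)).alternating_apply_const ![])
    rw [← contMDiffOn_iff_contDiffOn] at h1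
    have h2 := h1.comp (contMDiffOn_of_mem_maximalAtlas (chartAt_mem_maximalAtlas (D := D) x))
      (fun z hz ↦ (chartAt (Model D) x).map_source hz)
    refine (h2.congr fun z hz ↦ ?_).contMDiffAt
      ((chartAt (Model D) x).open_source.mem_nhds (mem_chart_source _ x))
    exact congrArg f ((chartAt (Model D) x).left_inv hz).symm

theorem trivializationAt_tangent_apply (χ : VField D Γ) {x₀ : Γ}
    (hx : x ∈ (chartAt (Model D) x₀).source) :
    (trivializationAt (Model D) (TangentSpace 𝓘(ℝ, Model D)) x₀
      (⟨x, χ x⟩ : TangentBundle 𝓘(ℝ, Model D) Γ)).2 = tangentChart (chartAt (Model D) x₀) x (χ x) := by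
  have : IsManifold 𝓘(ℝ, Model D) 1 Γ := IsManifold.of_le (n := ∞) (by simp)
  have h := TangentBundle.continuousLinearMapAt_trivializationAt (I := 𝓘(ℝ, Model D)) hx
  have h' := DFunLike.congr_fun h (χ x)
  rw [Bundle.Trivialization.continuousLinearMapAt_apply,
    Bundle.Trivialization.linearMapAt_apply, if_pos (by simpa using hx)] at h'
  exact h'

/-- Over the domain of a preferred chart, the fibre coordinate of the tangent bundle trivialization
is the tangent map of that chart, so bundle smoothness amounts to smooth components. -/
theorem isSmoothVField_iff {χ : VField D Γ} :
    IsSmoothVField χ ↔ ∀ x : Γ,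
      ContDiffOn ℝ ∞ (χ.inChart (chartAt (Model D) x)) (chartAt (Model D) x).target := by
  have key : ∀ x₀ : Γ, ContMDiffOn 𝓘(ℝ, Model D) 𝓘(ℝ, Model D).tangent ∞
      (fun x ↦ (⟨x, χ x⟩ : TangentBundle 𝓘(ℝ, Model D) Γ)) (chartAt (Model D) x₀).source ↔
      ContMDiffOn 𝓘(ℝ, Model D) 𝓘(ℝ, Model D) ∞
        (fun x ↦ tangentChart (chartAt (Model D) x₀) x (χ x)) (chartAt (Model D) x₀).source := by
    intro x₀
    refine ((trivializationAt (Model D) (TangentSpace 𝓘(ℝ, Model D)) x₀).contMDiffOn_section_iff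
      (chartAt (Model D) x₀).open_source (by simp)).trans ?_
    exact contMDiffOn_congr fun x hx ↦ trivializationAt_tangent_apply χ hx
  constructor
  · intro h x
    rw [← contMDiffOn_iff_contDiffOn]
    exact ((key x).1 h.contMDiffOn).comp
      (contMDiffOn_symm_of_mem_maximalAtlas (chartAt_mem_maximalAtlas (D := D) x))
      fun y hy ↦ (chartAt (Model D) x).map_target hy
  · intro h x
    refine ((key x).2 ?_).contMDiffAt
      ((chartAt (Model D) x).open_source.mem_nhds (mem_chart_source _ x))
    have h1 := h x
    rw [← contMDiffOn_iff_contDiffOn] at h1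
    refine (h1.comp (contMDiffOn_of_mem_maximalAtlas (chartAt_mem_maximalAtlas (D := D) x))
      (fun z hz ↦ (chartAt (Model D) x).map_source hz)).congr fun z hz ↦ ?_
    simp only [Function.comp_apply, VField.inChart]
    rw [(chartAt (Model D) x).left_inv hz]

theorem IsSmoothVField.interior {χ : VField D Γ} (hχ : IsSmoothVField χ) {α : Form D Γ (k + 1)}
    (hα : IsSmoothForm α) : IsSmoothForm (interior χ α) := by
  refine isSmoothForm_of_chartAt fun x ↦ ?_
  exact ((hα _ (chart_mem_atlas (Model D) x)).alternating_curryLeft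
    (isSmoothVField_iff.1 hχ x)).congr fun y hy ↦
      inChart_interior χ α (chartAt_mem_maximalAtlas x) hy

theorem equivDeriv_ofFun_add_ofForm {H : Γ → ℝ} {Ω : Form D Γ 2} (χ : VField D Γ)
    (hH : IsSmoothForm (constForm D H)) (hΩ : IsSmoothForm Ω) :
    equivDeriv χ (ofFun H + ofForm 2 Ω) =
      ofForm 1 ((constForm D H).d + interior χ Ω) + ofForm 3 Ω.d := by
  rw [equivDeriv, ofFun_eq, polyForm_d_add hH.ofForm hΩ.ofForm, contract_add,
    contract_ofForm_zero, contract_ofForm_succ, polyForm_d_ofForm, polyForm_d_ofForm, ofForm_add]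
  abel

/-- Only degrees 1 and 3 occur: the first gives Hamilton's equation, the second closedness. -/
theorem equivDeriv_eq_zero_iff {H : Γ → ℝ} {Ω : Form D Γ 2} {χ : VField D Γ}
    (hH : IsSmoothForm (constForm D H)) (hΩ : IsSmoothForm Ω) :
    equivDeriv χ (ofFun H + ofForm 2 Ω) = 0 ↔
      interior χ Ω = -(constForm D H).d ∧ Ω.d = 0 := by
  rw [equivDeriv_ofFun_add_ofForm χ hH hΩ]
  constructor
  · intro h
    have h1 := congrFun h 1
    have h3 := congrFun h 3
    simp only [Pi.add_apply, ofForm_same, ofForm_ne (show 1 ≠ 3 by simp),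
      ofForm_ne (show 3 ≠ 1 by simp), add_zero, zero_add] at h1 h3
    exact ⟨eq_neg_of_add_eq_zero_right h1, h3⟩
  · rintro ⟨h1, h3⟩
    rw [h1, h3, add_neg_cancel, ofForm_zero, ofForm_zero, add_zero]

theorem equivDeriv_ofForm_one (χ : VField D Γ) (ψ : Form D Γ 1) :
    equivDeriv χ (ofForm 1 ψ) = ofForm 0 (interior χ ψ) + ofForm 2 ψ.d := by
  rw [equivDeriv, contract_ofForm_succ, polyForm_d_ofForm, add_comm]

theorem lieDeriv_ofForm_one (χ : VField D Γ) (ψ : Form D Γ 1) :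
    lieDeriv χ (ofForm 1 ψ) = ofForm 1 ((interior χ ψ).d + interior χ ψ.d) := by
  rw [lieDeriv, contract_ofForm_succ, polyForm_d_ofForm, polyForm_d_ofForm, contract_ofForm_succ,
    ofForm_add]

theorem equivDeriv_add {P Q : PolyForm D Γ} (χ : VField D Γ) (hP : IsSmoothPolyForm P)
    (hQ : IsSmoothPolyForm Q) : equivDeriv χ (P + Q) = equivDeriv χ P + equivDeriv χ Q := by
  rw [equivDeriv, polyForm_d_add hP hQ, contract_add, equivDeriv, equivDeriv]
  abel

theorem equivDeriv_smul (χ : VField D Γ) (c : ℝ) (P : PolyForm D Γ) :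
    equivDeriv χ (c • P) = c • equivDeriv χ P := by
  rw [equivDeriv, polyForm_d_smul, contract_smul, equivDeriv, smul_add]

theorem IsSmoothPolyForm.add {P Q : PolyForm D Γ} (hP : IsSmoothPolyForm P)
    (hQ : IsSmoothPolyForm Q) : IsSmoothPolyForm (P + Q) := fun k ↦ (hP k).add (hQ k)

theorem IsSmoothPolyForm.const_smul {P : PolyForm D Γ} (hP : IsSmoothPolyForm P) (c : ℝ) :
    IsSmoothPolyForm (c • P) := fun k ↦ (hP k).const_smul c

/-- `d_χ² = L_χ` on smooth `1`-forms. -/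
theorem equivDeriv_equivDeriv_ofForm_one {χ : VField D Γ} (hχ : IsSmoothVField χ) {ψ : Form D Γ 1}
    (hψ : IsSmoothForm ψ) :
    equivDeriv χ (equivDeriv χ (ofForm 1 ψ)) = lieDeriv χ (ofForm 1 ψ) := by
  rw [equivDeriv_ofForm_one, equivDeriv_add χ (hχ.interior hψ).ofForm hψ.d.ofForm,
    lieDeriv_ofForm_one, equivDeriv, equivDeriv, contract_ofForm_zero, contract_ofForm_succ,
    polyForm_d_ofForm, polyForm_d_ofForm, hψ.d_d, ofForm_zero, ofForm_add]
  abel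

theorem isSmoothPolyForm_equivDeriv_ofForm_one {χ : VField D Γ} (hχ : IsSmoothVField χ)
    {ψ : Form D Γ 1} (hψ : IsSmoothForm ψ) : IsSmoothPolyForm (equivDeriv χ (ofForm 1 ψ)) := by
  rw [equivDeriv_ofForm_one]
  exact (hχ.interior hψ).ofForm.add hψ.d.ofForm

end Fields

/-! ### Hamiltonian vector fields -/

section Hamiltonian

variable {D : ℕ}

/-- A linear form as a vector, by means of the standard inner product. -/
def formVec (D : ℕ) : ((Model D) [⋀^Fin 1]→L[ℝ] ℝ) →L[ℝ] Model D :=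
  LinearMap.toContinuousLinearMap
    { toFun := fun a ↦ ∑ ν, a ![stdVec ν] • stdVec ν
      map_add' := fun a b ↦ by
        simp only [ContinuousAlternatingMap.add_apply, add_smul, Finset.sum_add_distrib]
      map_smul' := fun c a ↦ by
        simp only [ContinuousAlternatingMap.smul_apply, smul_assoc, Finset.smul_sum,
          RingHom.id_apply] }

theorem formVec_apply (a : (Model D) [⋀^Fin 1]→L[ℝ] ℝ) (μ : Fin (2 * D)) :
    formVec D a μ = a ![stdVec μ] := by
  change (∑ ν, a ![stdVec ν] • stdVec ν : Model D) μ = _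
  simp [stdVec, Pi.single_apply]

theorem formVec_injective : Function.Injective (formVec D) := by
  intro a b h
  refine alternating_ext_stdVec fun μ ↦ ?_
  have h1 := congrArg (fun v : Model D ↦ v (μ 0)) h
  simp only [formVec_apply] at h1
  have h2 : (fun i ↦ stdVec (μ i)) = ![stdVec (D := D) (μ 0)] := by
    ext1 i; rw [Fin.fin_one_eq_zero i]; rfl
  rw [h2, h1]

/-- The endomorphism of the model space given by a `2`-form and the standard inner product. -/
def formMap (η : (Model D) [⋀^Fin 2]→L[ℝ] ℝ) : Model D →L[ℝ] Model D :=
  (formVec D).comp η.curryLeft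

/-- Nondegeneracy of an alternating `2`-form. -/
def Nondegenerate (η : (Model D) [⋀^Fin 2]→L[ℝ] ℝ) : Prop :=
  ∀ v : Model D, (∀ w : Model D, η ![v, w] = 0) → v = 0

theorem Nondegenerate.curryLeft_injective {η : (Model D) [⋀^Fin 2]→L[ℝ] ℝ}
    (h : Nondegenerate η) : Function.Injective η.curryLeft := by
  rw [injective_iff_map_eq_zero]
  intro v hv
  refine h v fun w ↦ ?_
  exact DFunLike.congr_fun hv ![w]

theorem Nondegenerate.exists_equiv {η : (Model D) [⋀^Fin 2]→L[ℝ] ℝ}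
    (h : Nondegenerate η) : ∃ f : Model D ≃L[ℝ] Model D, (f : Model D →L[ℝ] Model D) = formMap η := by
  have hinj : Function.Injective (formMap η).toLinearMap :=
    formVec_injective.comp h.curryLeft_injective
  refine ⟨(LinearEquiv.ofInjectiveEndo _ hinj).toContinuousLinearEquiv, ?_⟩
  ext1 v
  rfl

theorem Nondegenerate.curryLeft_inverse {η : (Model D) [⋀^Fin 2]→L[ℝ] ℝ} (h : Nondegenerate η)
    (a : (Model D) [⋀^Fin 1]→L[ℝ] ℝ) : η.curryLeft ((formMap η).inverse (formVec D a)) = a := by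
  obtain ⟨f, hf⟩ := h.exists_equiv
  refine formVec_injective ?_
  change formMap η _ = _
  rw [← hf, ContinuousLinearMap.inverse_equiv]
  exact f.apply_symm_apply _

variable {Γ : Type*} [TopologicalSpace Γ] [ChartedSpace (Model D) Γ]
  {e : OpenPartialHomeomorph Γ (Model D)} {x : Γ} {y : Model D}

theorem IsNondegenerate.inChart {Ω : Form D Γ 2} (h : IsNondegenerate Ω)
    (he : e ∈ IsManifold.maximalAtlas 𝓘(ℝ, Model D) ∞ Γ) (hy : y ∈ e.target) :
    Nondegenerate (Ω.inChart e y) := by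
  intro v hv
  have h1 := h (e.symm y) (tangentSymm e y v) fun w ↦ by
    have := hv (tangentChart e (e.symm y) w)
    rw [inChart_apply] at this
    convert this using 2
    ext1 i
    fin_cases i
    · rfl
    · exact (tangentSymm_tangentChart' he hy w).symm
  rw [← tangentChart_tangentSymm he hy v, h1, map_zero]

variable [IsManifold 𝓘(ℝ, Model D) ∞ Γ]

/-- Pointwise, v ↦ Ω(v, ·) is inverted. After covectors are identified with vectors, this is
inversion of an endomorphism in each chart, which is smooth at invertible operators, so `u` is
smooth. -/
theorem exists_interior_eq {Ω : Form D Γ 2} (hΩ : IsSmoothForm Ω) (hnd : IsNondegenerate Ω)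
    {α : Form D Γ 1} (hα : IsSmoothForm α) :
    ∃ u : VField D Γ, IsSmoothVField u ∧ interior u Ω = α := by
  let u : VField D Γ := fun x ↦ (formMap (Ω x)).inverse (formVec D (α x))
  have hu : interior u Ω = α := funext fun x ↦ Nondegenerate.curryLeft_inverse (hnd x) (α x)
  refine ⟨u, isSmoothVField_iff.2 fun x ↦ ?_, hu⟩
  set e := chartAt (Model D) x
  have he := chartAt_mem_maximalAtlas (D := D) x
  have h1 : ∀ y ∈ e.target, u.inChart e y =
      (formMap (Ω.inChart e y)).inverse (formVec D (α.inChart e y)) := by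
    intro y hy
    refine (hnd.inChart he hy).curryLeft_injective ?_
    rw [(hnd.inChart he hy).curryLeft_inverse, ← inChart_interior u Ω he hy, hu]
  refine ContDiffOn.congr ?_ h1
  have h2 : ContDiffOn ℝ ∞ (fun y ↦ formMap (Ω.inChart e y)) e.target :=
    contDiffOn_clm_apply.2 fun v ↦ (formVec D).contDiff.comp_contDiffOn
      ((hΩ.contDiffOn he).alternating_curryLeft contDiffOn_const)
  have h3 : ContDiffOn ℝ ∞ (fun y ↦ (formMap (Ω.inChart e y)).inverse) e.target := by
    intro y hy
    obtain ⟨f, hf⟩ := (hnd.inChart he hy).exists_equiv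
    have h4 := contDiffAt_map_inverse (n := ∞) f
    rw [hf] at h4
    exact h4.comp_contDiffWithinAt y (h2 y hy)
  exact h3.clm_apply ((formVec D).contDiff.comp_contDiffOn (hα.contDiffOn he))

end Hamiltonian

/-! ### Differentials of functions and flows -/

section Flow

variable {D : ℕ} {Γ : Type*} [TopologicalSpace Γ] [ChartedSpace (Model D) Γ]
  [IsManifold 𝓘(ℝ, Model D) ∞ Γ]
  {e e' : OpenPartialHomeomorph Γ (Model D)} {x : Γ} {y : Model D}

theorem inChart_d_constForm {f : Γ → ℝ} (hf : IsSmoothForm (constForm D f))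
    (he : e ∈ IsManifold.maximalAtlas 𝓘(ℝ, Model D) ∞ Γ) (hy : y ∈ e.target)
    (v : Fin 1 → Model D) :
    (constForm D f).d.inChart e y v = fderiv ℝ (f ∘ e.symm) y (v 0) := by
  rw [hf.inChart_d he hy, inChart_constForm, extDeriv_constOfIsEmpty]
  rfl

theorem d_constForm_apply {f : Γ → ℝ} (hf : IsSmoothForm (constForm D f)) (v : Model D) :
    (constForm D f).d x ![v] = mfderiv 𝓘(ℝ, Model D) 𝓘(ℝ, ℝ) f x v := by
  set e := chartAt (Model D) x
  have he := chartAt_mem_maximalAtlas (D := D) x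
  have hx : x ∈ e.source := mem_chart_source _ x
  rw [form_apply_eq_inChart _ he hx, inChart_d_constForm hf he (e.map_source hx)]
  have h1 : MDifferentiableAt 𝓘(ℝ, Model D) 𝓘(ℝ, ℝ) f (e.symm (e x)) :=
    (contMDiff_iff_isSmoothForm.2 hf).mdifferentiable (by simp) _
  have h2 := mfderiv_comp (e x) h1
    ((mdifferentiable_of_mem_maximalAtlas he).mdifferentiableAt_symm (e.map_source hx))
  rw [mfderiv_eq_fderiv] at h2
  rw [h2]
  change mfderiv 𝓘(ℝ, Model D) 𝓘(ℝ, ℝ) f (e.symm (e x)) (tangentSymm e (e x) (tangentChart e x v)) = _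
  rw [tangentSymm_tangentChart he hx, e.left_inv hx]

theorem IsMIntegralCurve.hasDerivAt_comp {u : VField D Γ} {γ : ℝ → Γ}
    (hγ : IsMIntegralCurve (I := 𝓘(ℝ, Model D)) γ u) {f : Γ → ℝ}
    (hf : IsSmoothForm (constForm D f)) (t : ℝ) :
    HasDerivAt (fun s ↦ f (γ s)) ((constForm D f).d (γ t) ![u (γ t)]) t := by
  have h1 : MDifferentiableAt 𝓘(ℝ, Model D) 𝓘(ℝ, ℝ) f (γ t) :=
    (contMDiff_iff_isSmoothForm.2 hf).mdifferentiable (by simp) _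
  let df : Model D →L[ℝ] ℝ := mfderiv 𝓘(ℝ, Model D) 𝓘(ℝ, ℝ) f (γ t)
  let L : ℝ →L[ℝ] ℝ := df.comp ((1 : ℝ →L[ℝ] ℝ).smulRight (u (γ t) : Model D))
  have h2 : HasFDerivAt (fun s ↦ f (γ s)) L t := (h1.hasMFDerivAt.comp t (hγ t)).hasFDerivAt
  have h3 : L 1 = (constForm D f).d (γ t) ![u (γ t)] := by
    refine Eq.trans ?_ (d_constForm_apply hf (u (γ t) : Model D)).symm
    exact congrArg df (one_smul ℝ (u (γ t) : Model D))
  exact h3 ▸ h2.hasDerivAt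

theorem IsMIntegralCurve.hasDerivAt_chart {u : VField D Γ} {γ : ℝ → Γ}
    (hγ : IsMIntegralCurve (I := 𝓘(ℝ, Model D)) γ u) {t : ℝ}
    (he : e ∈ IsManifold.maximalAtlas 𝓘(ℝ, Model D) ∞ Γ) (ht : γ t ∈ e.source) :
    HasDerivAt (fun s ↦ e (γ s)) (tangentChart e (γ t) (u (γ t))) t := by
  have h1 := (mdifferentiable_of_mem_maximalAtlas he).mdifferentiableAt ht
  let L : ℝ →L[ℝ] Model D := (tangentChart e (γ t)).comp
    ((1 : ℝ →L[ℝ] ℝ).smulRight (u (γ t) : Model D))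
  have h2 : HasFDerivAt (fun s ↦ e (γ s)) L t := (h1.hasMFDerivAt.comp t (hγ t)).hasFDerivAt
  have h3 : L 1 = tangentChart e (γ t) (u (γ t)) :=
    congrArg (tangentChart e (γ t)) (one_smul ℝ (u (γ t) : Model D))
  exact h3 ▸ h2.hasDerivAt

/-- A substitute for Cartan's formula: pull the closed form back to β = g^*σ on time × space. Then
dβ = 0, while `hT` says that the contraction of β with ∂_t is -d(F ∘ g). Evaluating dβ on (∂_t, a,
b) isolates the time derivative of β(a, b). -/
theorem hasDerivAt_pullback_of_closed {σ : Model D → (Model D) [⋀^Fin 2]→L[ℝ] ℝ} {F : Model D → ℝ}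
    {g : ℝ × Model D → Model D} {p : ℝ × Model D} (hσ : DifferentiableAt ℝ σ (g p))
    (hcl : extDeriv σ (g p) = 0) (hg : ContDiffAt ℝ ∞ g p) (hF : ContDiffAt ℝ ∞ F (g p))
    (hT : ∀ᶠ q in 𝓝 p, ∀ w, σ (g q) ![fderiv ℝ g q (1, 0), fderiv ℝ g q w] =
      -fderiv ℝ (F ∘ g) q w) (a b : Model D) :
    HasDerivAt (fun t ↦ σ (g (t, p.2)) ![fderiv ℝ g (t, p.2) (0, a), fderiv ℝ g (t, p.2) (0, b)])
      0 p.1 := by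
  set β : ℝ × Model D → (ℝ × Model D) [⋀^Fin 2]→L[ℝ] ℝ := fun q ↦
    (σ (g q)).compContinuousLinearMap (fderiv ℝ g q) with hβ
  have hβapp : ∀ q v w, β q ![v, w] = σ (g q) ![fderiv ℝ g q v, fderiv ℝ g q w] := by
    intro q v w
    rw [hβ, ContinuousAlternatingMap.compContinuousLinearMap_apply]
    congr 1
    ext1 i
    fin_cases i <;> rfl
  have hβd : DifferentiableAt ℝ β p := by
    refine DifferentiableAt.continuousAlternatingMapCompContinuousLinearMap ?_ ?_
    · exact hσ.comp p (hg.differentiableAt (by simp))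
    · exact (hg.fderiv_right (m := ∞) (by simp)).differentiableAt (by simp)
  have hdβ : extDeriv β p = 0 := by
    rw [hβ, extDeriv_pullback hσ hg minSmoothness_two_le, hcl]
    rfl
  have hβv : ∀ v : Fin 2 → ℝ × Model D, DifferentiableAt ℝ (fun q ↦ β q v) p := fun v ↦
    hβd.continuousAlternatingMap_apply_const v
  have hG : ContDiffAt ℝ ∞ (F ∘ g) p := hF.comp p hg
  have hsymm := hG.isSymmSndFDerivAt minSmoothness_two_le
  have hG1 : DifferentiableAt ℝ (fderiv ℝ (F ∘ g)) p :=
    (hG.fderiv_right (m := ∞) (by simp)).differentiableAt (by simp)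
  have hTd : ∀ v w, fderiv ℝ (fun q ↦ β q ![(1, 0), w]) p v =
      -fderiv ℝ (fderiv ℝ (F ∘ g)) p v w := by
    intro v w
    have h1 : (fun q ↦ β q ![(1, 0), w]) =ᶠ[𝓝 p] fun q ↦ -fderiv ℝ (F ∘ g) q w := by
      filter_upwards [hT] with q hq
      rw [hβapp, hq]
    rw [h1.fderiv_eq, fderiv_fun_neg, fderiv_clm_apply hG1 (differentiableAt_const w)]
    simp
  have hsum := DFunLike.congr_fun hdβ ![((1 : ℝ), (0 : Model D)), (0, a), (0, b)]
  rw [extDeriv_apply hβd, Fin.sum_univ_three] at hsum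
  have r0 : Fin.removeNth 0 ![((1 : ℝ), (0 : Model D)), (0, a), (0, b)] = ![(0, a), (0, b)] := by
    ext1 i; fin_cases i <;> rfl
  have r1 : Fin.removeNth 1 ![((1 : ℝ), (0 : Model D)), (0, a), (0, b)] = ![(1, 0), (0, b)] := by
    ext1 i; fin_cases i <;> rfl
  have r2 : Fin.removeNth 2 ![((1 : ℝ), (0 : Model D)), (0, a), (0, b)] = ![(1, 0), (0, a)] := by
    ext1 i; fin_cases i <;> rfl
  rw [r0, r1, r2, hTd, hTd] at hsum
  simp only [Matrix.cons_val_zero, Matrix.cons_val_one, Matrix.cons_val_two] at hsum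
  have hsymm' := hsymm.eq ((0 : ℝ), a) (0, b)
  -- Besides ∂_t β(a, b), the expansion of dβ contains the second derivatives of F ∘ g in the orders
  -- (a, b) and (b, a) with opposite signs; they cancel by symmetry.
  have hzero : fderiv ℝ (fun q ↦ β q ![(0, a), (0, b)]) p (1, 0) = 0 := by
    have h2 : ((0 : (ℝ × Model D) [⋀^Fin 3]→L[ℝ] ℝ)) ![((1 : ℝ), (0 : Model D)), (0, a), (0, b)] = 0 :=
      rfl
    rw [h2] at hsum
    simp at hsum
    linarith
  have hcurve : HasDerivAt (fun t : ℝ ↦ (t, p.2)) ((1 : ℝ), (0 : Model D)) p.1 :=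
    (hasDerivAt_id p.1).prodMk (hasDerivAt_const _ _)
  have h3 := (hβv ![(0, a), (0, b)]).hasFDerivAt.comp_hasDerivAt (f := fun t : ℝ ↦ (t, p.2)) p.1 hcurve
  rw [hzero] at h3
  refine h3.congr_of_eventuallyEq (Eventually.of_forall fun t ↦ ?_)
  exact (hβapp _ _ _).symm

end Flow

/-! ### Flows in coordinates and invariance of the symplectic form -/

section FlowInvariance

variable {D : ℕ} {Γ : Type*} [TopologicalSpace Γ] [ChartedSpace (Model D) Γ]
  [IsManifold 𝓘(ℝ, Model D) ∞ Γ]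
  {e e' : OpenPartialHomeomorph Γ (Model D)} {x : Γ} {y : Model D}

theorem contMDiffOn_prod_symm (he : e ∈ IsManifold.maximalAtlas 𝓘(ℝ, Model D) ∞ Γ) :
    ContMDiffOn 𝓘(ℝ, ℝ × Model D) (𝓘(ℝ, ℝ).prod 𝓘(ℝ, Model D)) ∞
      (fun p : ℝ × Model D ↦ (p.1, e.symm p.2)) (univ ×ˢ e.target) := by
  refine ContMDiffOn.prodMk contDiff_fst.contMDiff.contMDiffOn ?_
  exact (contMDiffOn_symm_of_mem_maximalAtlas he).comp contDiff_snd.contMDiff.contMDiffOn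
    fun p hp ↦ hp.2

theorem contDiffOn_family {J : Set ℝ} {H : ℝ → Γ → ℝ}
    (hH : ContMDiffOn (𝓘(ℝ, ℝ).prod 𝓘(ℝ, Model D)) 𝓘(ℝ, ℝ) ∞ (fun p : ℝ × Γ ↦ H p.1 p.2)
      (J ×ˢ univ)) (he : e ∈ IsManifold.maximalAtlas 𝓘(ℝ, Model D) ∞ Γ) :
    ContDiffOn ℝ ∞ (fun p : ℝ × Model D ↦ H p.1 (e.symm p.2)) (J ×ˢ e.target) := by
  rw [← contMDiffOn_iff_contDiffOn]
  exact hH.comp ((contMDiffOn_prod_symm he).mono (prod_mono (subset_univ _) le_rfl))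
    fun p hp ↦ ⟨hp.1, mem_univ _⟩

theorem isSmoothForm_of_family {J : Set ℝ} {H : ℝ → Γ → ℝ}
    (hH : ContMDiffOn (𝓘(ℝ, ℝ).prod 𝓘(ℝ, Model D)) 𝓘(ℝ, ℝ) ∞ (fun p : ℝ × Γ ↦ H p.1 p.2)
      (J ×ˢ univ)) {t : ℝ} (ht : t ∈ J) : IsSmoothForm (constForm D (H t)) := by
  refine fun e he ↦ contDiffOn_alternating fun μ ↦ ?_
  exact (contDiffOn_family hH (IsManifold.subset_maximalAtlas he)).comp
    (contDiff_prodMk_right t).contDiffOn fun y hy ↦ ⟨ht, hy⟩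

theorem IsSmoothFormFamily.isSmoothForm {k : ℕ} {J : Set ℝ} {α : ℝ → Form D Γ k}
    (h : IsSmoothFormFamily J α) {t : ℝ} (ht : t ∈ J) : IsSmoothForm (α t) := fun e he ↦
  (h e he).comp (contDiff_prodMk_right t).contDiffOn fun _ hy ↦ ⟨ht, hy⟩

variable {u : VField D Γ} {Φ : ℝ → Γ → Γ}

/-- The tangent map of a map of the manifold to itself. -/
def tangentSelf (f : Γ → Γ) (x : Γ) : Model D →L[ℝ] Model D :=
  mfderiv 𝓘(ℝ, Model D) 𝓘(ℝ, Model D) f x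

theorem IsSmoothFlow.mdifferentiableAt (hΦ : IsSmoothFlow u Φ) (t : ℝ) (x : Γ) :
    MDifferentiableAt 𝓘(ℝ, Model D) 𝓘(ℝ, Model D) (Φ t) x := by
  have h : ContMDiff 𝓘(ℝ, Model D) 𝓘(ℝ, Model D) ∞ (Φ t) :=
    hΦ.smooth.comp (contMDiff_const.prodMk contMDiff_id)
  exact h.mdifferentiable (by simp) x

/-- The flow in coordinates. -/
def flowInChart (Φ : ℝ → Γ → Γ) (e e' : OpenPartialHomeomorph Γ (Model D))
    (p : ℝ × Model D) : Model D := e' (Φ p.1 (e.symm p.2))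

/-- The domain of the flow in coordinates. -/
def flowDomain (Φ : ℝ → Γ → Γ) (e e' : OpenPartialHomeomorph Γ (Model D)) :
    Set (ℝ × Model D) := {p | p.2 ∈ e.target ∧ Φ p.1 (e.symm p.2) ∈ e'.source}

theorem IsSmoothFlow.isOpen_flowDomain (hΦ : IsSmoothFlow u Φ) : IsOpen (flowDomain Φ e e') := by
  have h1 : ContinuousOn (fun p : ℝ × Model D ↦ Φ p.1 (e.symm p.2)) (univ ×ˢ e.target) := by
    refine hΦ.smooth.continuous.comp_continuousOn (continuousOn_fst.prodMk ?_)
    exact e.continuousOn_symm.comp continuousOn_snd fun p hp ↦ hp.2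
  have h2 := h1.isOpen_inter_preimage (isOpen_univ.prod e.open_target) e'.open_source
  convert h2 using 1
  ext p
  simp [flowDomain]

theorem IsSmoothFlow.contDiffOn_flowInChart (hΦ : IsSmoothFlow u Φ)
    (he : e ∈ IsManifold.maximalAtlas 𝓘(ℝ, Model D) ∞ Γ)
    (he' : e' ∈ IsManifold.maximalAtlas 𝓘(ℝ, Model D) ∞ Γ) :
    ContDiffOn ℝ ∞ (flowInChart Φ e e') (flowDomain Φ e e') := by
  rw [← contMDiffOn_iff_contDiffOn]
  exact (contMDiffOn_of_mem_maximalAtlas he').comp (hΦ.smooth.comp_contMDiffOn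
    ((contMDiffOn_prod_symm he).mono fun p hp ↦ ⟨mem_univ _, hp.1⟩)) fun p hp ↦ hp.2

theorem IsSmoothFlow.contDiffAt_flowInChart (hΦ : IsSmoothFlow u Φ)
    (he : e ∈ IsManifold.maximalAtlas 𝓘(ℝ, Model D) ∞ Γ)
    (he' : e' ∈ IsManifold.maximalAtlas 𝓘(ℝ, Model D) ∞ Γ) {p : ℝ × Model D}
    (hp : p ∈ flowDomain Φ e e') : ContDiffAt ℝ ∞ (flowInChart Φ e e') p :=
  (hΦ.contDiffOn_flowInChart he he').contDiffAt (hΦ.isOpen_flowDomain.mem_nhds hp)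

theorem IsSmoothFlow.fderiv_flowInChart_time (hΦ : IsSmoothFlow u Φ)
    (he : e ∈ IsManifold.maximalAtlas 𝓘(ℝ, Model D) ∞ Γ)
    (he' : e' ∈ IsManifold.maximalAtlas 𝓘(ℝ, Model D) ∞ Γ) {p : ℝ × Model D}
    (hp : p ∈ flowDomain Φ e e') :
    fderiv ℝ (flowInChart Φ e e') p (1, 0) = u.inChart e' (flowInChart Φ e e' p) := by
  have h1 := ((hΦ.contDiffAt_flowInChart he he' hp).differentiableAt (by simp)).hasFDerivAt
  have hcurve : HasDerivAt (fun t : ℝ ↦ (t, p.2)) ((1 : ℝ), (0 : Model D)) p.1 :=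
    (hasDerivAt_id p.1).prodMk (hasDerivAt_const _ _)
  have h2 := h1.comp_hasDerivAt (f := fun t : ℝ ↦ (t, p.2)) p.1 hcurve
  have h3 := IsMIntegralCurve.hasDerivAt_chart (hΦ.integral (e.symm p.2)) (t := p.1) he' hp.2
  rw [h2.unique h3, VField.inChart, flowInChart, e'.left_inv hp.2]

theorem IsSmoothFlow.fderiv_flowInChart_space (hΦ : IsSmoothFlow u Φ)
    (he : e ∈ IsManifold.maximalAtlas 𝓘(ℝ, Model D) ∞ Γ)
    (he' : e' ∈ IsManifold.maximalAtlas 𝓘(ℝ, Model D) ∞ Γ) {p : ℝ × Model D}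
    (hp : p ∈ flowDomain Φ e e') (v : Model D) :
    fderiv ℝ (flowInChart Φ e e') p (0, v) = tangentChart e' (Φ p.1 (e.symm p.2))
      (tangentSelf (Φ p.1) (e.symm p.2) (tangentSymm e p.2 v)) := by
  have h1 := ((hΦ.contDiffAt_flowInChart he he' hp).differentiableAt (by simp)).hasFDerivAt
  have hcurve : HasFDerivAt (fun z : Model D ↦ (p.1, z)) (ContinuousLinearMap.inr ℝ ℝ (Model D)) p.2 :=
    hasFDerivAt_prodMk_right _ _
  have h2 := h1.comp (f := fun z : Model D ↦ (p.1, z)) p.2 hcurve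
  have h3 := mfderiv_comp (I := 𝓘(ℝ, Model D)) (I' := 𝓘(ℝ, Model D)) (I'' := 𝓘(ℝ, Model D)) p.2
    (hΦ.mdifferentiableAt p.1 (e.symm p.2))
    ((mdifferentiable_of_mem_maximalAtlas he).mdifferentiableAt_symm hp.1)
  have h4 := mfderiv_comp (I := 𝓘(ℝ, Model D)) (I' := 𝓘(ℝ, Model D)) (I'' := 𝓘(ℝ, Model D))
    (f := Φ p.1 ∘ e.symm) p.2 ((mdifferentiable_of_mem_maximalAtlas he').mdifferentiableAt hp.2)
    ((hΦ.mdifferentiableAt p.1 (e.symm p.2)).comp p.2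
      ((mdifferentiable_of_mem_maximalAtlas he).mdifferentiableAt_symm hp.1))
  rw [mfderiv_eq_fderiv, h3] at h4
  have h5 : fderiv ℝ (e' ∘ Φ p.1 ∘ e.symm) p.2 = _ := h2.fderiv
  rw [h5] at h4
  exact DFunLike.congr_fun h4 v

/-- The flow of a Hamiltonian vector field preserves the symplectic form. -/
theorem IsSmoothFlow.pullback_eq {Ω : Form D Γ 2} {F : Γ → ℝ} (hΦ : IsSmoothFlow u Φ)
    (hΩ : IsSmoothForm Ω) (hcl : Ω.d = 0) (hF : IsSmoothForm (constForm D F))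
    (hu : interior u Ω = -(constForm D F).d) (t : ℝ) (x : Γ) :
    (Ω (Φ t x)).compContinuousLinearMap (tangentSelf (Φ t) x) = Ω x := by
  -- A vanishing derivative is a local statement, so the chart around `Φ s x` may change with `s`.
  -- Constancy in time then reduces everything to time 0, where the flow is the identity.
  have key : ∀ v w : Model D, ∀ s : ℝ, HasDerivAt (fun s ↦
      (Ω (Φ s x)).compContinuousLinearMap (tangentSelf (Φ s) x) ![v, w])
      0 s := by
    intro v w s
    obtain ⟨e, he, hx⟩ : ∃ e ∈ IsManifold.maximalAtlas 𝓘(ℝ, Model D) ∞ Γ, x ∈ e.source :=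
      ⟨_, chartAt_mem_maximalAtlas x, mem_chart_source _ x⟩
    obtain ⟨e', he', hx'⟩ : ∃ e ∈ IsManifold.maximalAtlas 𝓘(ℝ, Model D) ∞ Γ, Φ s x ∈ e.source :=
      ⟨_, chartAt_mem_maximalAtlas (Φ s x), mem_chart_source _ _⟩
    have hp : ∀ r, Φ r x ∈ e'.source → (r, e x) ∈ flowDomain Φ e e' := fun r hr ↦
      ⟨e.map_source hx, by simpa only [e.left_inv hx] using hr⟩
    have hp0 := hp s hx'
    have htgt : ∀ q ∈ flowDomain Φ e e', flowInChart Φ e e' q ∈ e'.target := fun q hq ↦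
      e'.map_source hq.2
    have h1 := hasDerivAt_pullback_of_closed (σ := Ω.inChart e') (F := F ∘ e'.symm)
      (g := flowInChart Φ e e') (p := (s, e x)) (hΩ.differentiableAt he' (htgt _ hp0))
      (by rw [← hΩ.inChart_d he' (htgt _ hp0), hcl]; rfl)
      (hΦ.contDiffAt_flowInChart he he' hp0)
      (((hF.contDiffOn he').alternating_apply_const ![]).contDiffAt
        (e'.open_target.mem_nhds (htgt _ hp0)))
      (by
        filter_upwards [hΦ.isOpen_flowDomain.mem_nhds hp0] with q hq w
        rw [hΦ.fderiv_flowInChart_time he he' hq]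
        have h2 := DFunLike.congr_fun (inChart_interior u Ω he' (htgt q hq))
          ![fderiv ℝ (flowInChart Φ e e') q w]
        rw [hu, inChart_neg] at h2
        refine h2.symm.trans ?_
        change -((constForm D F).d.inChart e' (flowInChart Φ e e' q) _) = _
        rw [inChart_d_constForm hF he' (htgt q hq)]
        have h3 : DifferentiableAt ℝ (F ∘ e'.symm) (flowInChart Φ e e' q) :=
          (((hF.contDiffOn he').alternating_apply_const ![]).contDiffAt
            (e'.open_target.mem_nhds (htgt _ hq))).differentiableAt (by simp)
        rw [fderiv_comp q h3 ((hΦ.contDiffAt_flowInChart he he' hq).differentiableAt (by simp))]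
        rfl)
      (tangentChart e x v) (tangentChart e x w)
    refine h1.congr_of_eventuallyEq ?_
    have hcont : ContinuousAt (fun r ↦ Φ r x) s :=
      (hΦ.smooth.continuous.comp (continuous_id.prodMk continuous_const)).continuousAt
    filter_upwards [hcont (e'.open_source.mem_nhds hx')] with r hr
    rw [hΦ.fderiv_flowInChart_space he he' (hp r hr), hΦ.fderiv_flowInChart_space he he' (hp r hr)]
    simp only [flowInChart, e.left_inv hx, tangentSymm_tangentChart he hx]
    rw [ContinuousAlternatingMap.compContinuousLinearMap_apply,
      form_apply_eq_inChart Ω he' hr]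
    congr 1
    ext1 i
    fin_cases i <;> rfl
  have hconst : ∀ v w : Model D,
      (Ω (Φ t x)).compContinuousLinearMap (tangentSelf (Φ t) x) ![v, w] =
        Ω x ![v, w] := by
    intro v w
    have h1 := is_const_of_deriv_eq_zero (fun s ↦ (key v w s).differentiableAt)
      (fun s ↦ (key v w s).deriv) t 0
    rw [h1]
    have h0 : Φ 0 = id := funext hΦ.zero
    have h2 : tangentSelf (D := D) (id : Γ → Γ) x = ContinuousLinearMap.id ℝ (Model D) := mfderiv_id
    rw [h0, h2]
    rfl
  ext v
  have hv : v = ![v 0, v 1] := by ext1 i; fin_cases i <;> rfl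
  rw [hv]
  exact hconst _ _

end FlowInvariance

/-! ### BRST localization and canonical transformations -/

section Triples

variable {D : ℕ} {Γ : Type*} [TopologicalSpace Γ] [ChartedSpace (Model D) Γ]
  [IsManifold 𝓘(ℝ, Model D) ∞ Γ] {J : Set ℝ}

theorem hasParamDerivAt_affine (P Q : PolyForm D Γ) (t : ℝ) :
    HasParamDerivAt (fun s ↦ P + s • Q) Q t := by
  intro k x
  have h := ((hasDerivAt_id t).smul_const (Q k x)).const_add (P k x)
  rw [one_smul] at h
  exact h

theorem isTriple_brst {H : Γ → ℝ} {Ω : Form D Γ 2} {χ : VField D Γ} {ψ : Form D Γ 1} {β : ℝ}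
    (hH : ContMDiff 𝓘(ℝ, Model D) 𝓘(ℝ, ℝ) ∞ H) (hΩ : IsSymplectic Ω) (hχ : IsSmoothVField χ)
    (hinv : equivDeriv χ (ofFun H + ofForm 2 Ω) = 0) (hψ : IsSmoothForm ψ)
    (hL : lieDeriv χ (ofForm 1 ψ) = 0) (hβ : β ≠ 0) :
    IsTriple J (fun t ↦ (-β) • (ofFun H + ofForm 2 Ω) + t • equivDeriv χ (ofForm 1 ψ))
      (fun _ ↦ χ) ψ := by
  have hH' : IsSmoothForm (constForm D H) := contMDiff_iff_isSmoothForm.1 hH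
  have hsmooth : IsSmoothPolyForm (ofFun H + ofForm 2 Ω) := hH'.ofForm.add hΩ.smooth.ofForm
  have hg : ContMDiff 𝓘(ℝ, Model D) 𝓘(ℝ, ℝ) ∞ (fun x ↦ interior χ ψ x ![]) := by
    rw [contMDiff_iff_isSmoothForm (D := D), ← eq_constForm]
    exact hχ.interior hψ
  refine ⟨⟨fun t x ↦ -β * H x + t * interior χ ψ x ![], fun t ↦ (-β) • Ω + t • ψ.d,
    fun t _ ↦ ?_, ?_, ?_, fun t _ ↦ ?_, ?_⟩, fun _ _ ↦ hχ, fun t _ ↦ ?_, hψ, fun t _ ↦ ?_⟩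
  · have h1 : constForm D (fun x ↦ -β * H x + t * interior χ ψ x ![]) =
        (-β) • constForm D H + t • interior χ ψ := by
      conv_rhs => rw [eq_constForm (interior χ ψ)]
      rfl
    beta_reduce
    rw [ofFun_eq, ofFun_eq, h1, equivDeriv_ofForm_one, ofForm_add, ofForm_add, ofForm_smul,
      ofForm_smul, ofForm_smul, ofForm_smul, smul_add, smul_add]
    abel
  · exact ((contMDiff_const.mul (hH.comp contMDiff_snd)).add
      (contMDiff_fst.mul (hg.comp contMDiff_snd))).contMDiffOn
  · intro e he
    have h1 := (hΩ.smooth e he).comp contDiff_snd.contDiffOn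
      (fun (p : ℝ × Model D) (hp : p ∈ J ×ˢ e.target) ↦ hp.2)
    have h2 := (hψ.d e he).comp contDiff_snd.contDiffOn
      (fun (p : ℝ × Model D) (hp : p ∈ J ×ˢ e.target) ↦ hp.2)
    exact (h1.const_smul (-β)).add (contDiff_fst.contDiffOn.smul h2)
  · rw [d_add (hΩ.smooth.const_smul _) (hψ.d.const_smul _), d_smul, d_smul, hΩ.closed, hψ.d_d,
      smul_zero, smul_zero, add_zero]
  -- At parameter 0 the two-form is -β Ω; this is where β ≠ 0 enters.
  · intro x v hv
    refine hΩ.nondegenerate x v fun w ↦ ?_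
    have h1 : -β * Ω x ![v, w] + 0 * ψ.d x ![v, w] = 0 := hv w
    simpa [hβ] using h1
  · rw [equivDeriv_add χ (hsmooth.const_smul _)
      ((isSmoothPolyForm_equivDeriv_ofForm_one hχ hψ).const_smul _), equivDeriv_smul,
      equivDeriv_smul, hinv, equivDeriv_equivDeriv_ofForm_one hχ hψ, hL, smul_zero, smul_zero,
      add_zero]
  · exact hasParamDerivAt_affine _ _ _

theorem eqOn_of_hasDerivAt_zero {E : Type*} [NormedAddCommGroup E] [NormedSpace ℝ E]
    (hJ : IsOpen J) (hJ' : J.OrdConnected) {f : ℝ → E} (hf : ∀ t ∈ J, HasDerivAt f 0 t) {s t : ℝ}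
    (hs : s ∈ J) (ht : t ∈ J) : f s = f t :=
  hJ.is_const_of_deriv_eq_zero hJ'.isPreconnected
    (fun r hr ↦ (hf r hr).differentiableAt.differentiableWithinAt)
    (fun r hr ↦ (hf r hr).deriv) hs ht

theorem IsHamiltonianFamily.isSmoothPolyForm {S : ℝ → PolyForm D Γ}
    (h : IsHamiltonianFamily J S) {t : ℝ} (ht : t ∈ J) : IsSmoothPolyForm (S t) := by
  obtain ⟨H, Ω, hS, hH, hΩ, -, -⟩ := h
  rw [hS t ht]
  exact (isSmoothForm_of_family hH ht).ofForm.add (hΩ.isSmoothForm ht).ofForm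

theorem IsTriple.eq_affine (hJ : IsOpen J) (hJ' : J.OrdConnected) (h0 : (0 : ℝ) ∈ J)
    {S : ℝ → PolyForm D Γ} {χ : VField D Γ} {ψ : Form D Γ 1} (h : IsTriple J S (fun _ ↦ χ) ψ)
    {t : ℝ} (ht : t ∈ J) : S t = S 0 + t • equivDeriv χ (ofForm 1 ψ) := by
  funext k x
  set Q := equivDeriv χ (ofForm 1 ψ)
  have h1 : ∀ s ∈ J, HasDerivAt (fun s ↦ S s k x - s • Q k x) 0 s := by
    intro s hs
    have h2 := (h.deformation s hs k x).sub ((hasDerivAt_id s).smul_const (Q k x))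
    rw [one_smul, sub_self] at h2
    exact h2
  have h3 := eqOn_of_hasDerivAt_zero hJ hJ' h1 ht h0
  simp only [zero_smul, sub_zero] at h3
  exact sub_eq_iff_eq_add.1 h3

/-- Applying d_χ to the affine formula leaves t L_χψ = 0, and openness of `J` supplies some t ≠ 0.
-/
theorem IsTriple.lieDeriv_eq_zero (hJ : IsOpen J) (hJ' : J.OrdConnected) (h0 : (0 : ℝ) ∈ J)
    {S : ℝ → PolyForm D Γ} {χ : VField D Γ} {ψ : Form D Γ 1} (h : IsTriple J S (fun _ ↦ χ) ψ) :
    lieDeriv χ (ofForm 1 ψ) = 0 := by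
  obtain ⟨t, ht, ht0⟩ : ∃ t ∈ J, t ≠ 0 := by
    obtain ⟨ε, hε, hb⟩ := Metric.isOpen_iff.1 hJ 0 h0
    refine ⟨ε / 2, hb ?_, by positivity⟩
    rw [Metric.mem_ball, Real.dist_eq, sub_zero, abs_of_pos (by positivity)]
    linarith
  have hχ := h.smooth_field 0 h0
  have h1 := h.invariant t ht
  rw [h.eq_affine hJ hJ' h0 ht, equivDeriv_add χ (h.hamiltonian.isSmoothPolyForm h0)
    ((isSmoothPolyForm_equivDeriv_ofForm_one hχ h.smooth_form).const_smul _),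
    h.invariant 0 h0, zero_add, equivDeriv_smul,
    equivDeriv_equivDeriv_ofForm_one hχ h.smooth_form] at h1
  exact (smul_eq_zero.1 h1).resolve_left ht0

theorem twoForm_swap (η : (Model D) [⋀^Fin 2]→L[ℝ] ℝ) (v w : Model D) :
    η ![w, v] = -η ![v, w] := by
  have h := η.map_swap ![v, w] (show (0 : Fin 2) ≠ 1 by simp)
  have h' : ![v, w] ∘ Equiv.swap (0 : Fin 2) 1 = ![w, v] := by
    ext1 i; fin_cases i <;> rfl
  rw [h'] at h
  exact h

/-- Both sides are the Poisson bracket: α(χ) = -Ω(u, χ) and β(u) = -Ω(χ, u). In (c) it is used with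
α = dF and β = dH. -/
theorem interior_d_antisymm {Ω : Form D Γ 2} {α β : Form D Γ 1} {u χ : VField D Γ}
    (hu : interior u Ω = -α) (hχ : interior χ Ω = -β) : interior χ α = -interior u β := by
  have key : ∀ {v : VField D Γ} {γ : Form D Γ 1}, interior v Ω = -γ → ∀ (x : Γ) (w : Model D),
      γ x ![w] = -Ω x ![v x, w] := by
    intro v γ h x w
    have h1 := DFunLike.congr_fun (congrFun h x) ![w]
    have h2 : Ω x ![v x, w] = -γ x ![w] := h1
    rw [h2, neg_neg]
  ext x v
  have e1 : ∀ (γ : Form D Γ 1) (w : VField D Γ), interior w γ x v = γ x ![w x] := by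
    intro γ w
    change γ x (Matrix.vecCons (w x) v) = _
    congr 2
    exact Subsingleton.elim _ _
  change interior χ α x v = -(interior u β x v)
  rw [e1, e1]
  have ha := key hu x (χ x)
  have hb := key hχ x (u x)
  have hc := twoForm_swap (Ω x) (u x) (χ x)
  linarith

theorem pullback_ofFun_add_ofForm (f : Γ → Γ) (H : Γ → ℝ) (Ω : Form D Γ 2) :
    pullback f (ofFun H + ofForm 2 Ω) = ofFun (H ∘ f) +
      ofForm 2 (fun x ↦ (Ω (f x)).compContinuousLinearMap (tangentSelf f x)) := by
  funext k
  rw [ofFun_eq, ofFun_eq]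
  rcases eq_or_ne k 0 with rfl | h0
  · simp only [Pi.add_apply, ofForm_same, ofForm_ne (show 0 ≠ 2 by simp), add_zero]
    funext x
    simp only [pullback, Pi.add_apply, ofForm_same, ofForm_ne (show 0 ≠ 2 by simp),
      Pi.zero_apply, add_zero]
    rfl
  rcases eq_or_ne k 2 with rfl | h2
  · funext x
    simp only [pullback, Pi.add_apply, ofForm_same, ofForm_ne h0, Pi.zero_apply, zero_add]
    rfl
  · funext x
    simp only [pullback, Pi.add_apply, ofForm_ne h0, ofForm_ne h2, Pi.zero_apply, zero_add]
    rfl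

variable [T2Space Γ]

/-- As functions of `s`, both sides are integral curves of `u` with the same value at s = 0.
Uniqueness of integral curves uses that Γ is Hausdorff. -/
theorem IsSmoothFlow.map_add {u : VField D Γ} {Φ : ℝ → Γ → Γ} (hΦ : IsSmoothFlow u Φ)
    (hu : IsSmoothVField u) (s t : ℝ) (x : Γ) : Φ (s + t) x = Φ s (Φ t x) := by
  have : IsManifold 𝓘(ℝ, Model D) 1 Γ := IsManifold.of_le (n := ∞) (by simp)
  have h1 : IsMIntegralCurve (I := 𝓘(ℝ, Model D)) (fun s ↦ Φ (s + t) x) u :=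
    IsMIntegralCurve.comp_add (hΦ.integral x) t
  have h2 := isMIntegralCurve_Ioo_eq_of_contMDiff_boundaryless (t₀ := 0)
    (ContMDiff.of_le hu (by simp)) h1 (hΦ.integral (Φ t x)) (by simp [hΦ.zero])
  exact congrFun h2 s

/-- The flow preserves Ω, so only H ∘ Φ_{-t} varies, and χ(t) is taken to be its Hamiltonian vector
field. The deformation equation becomes the transport equation of H ∘ Φ_{-t} along `u`. -/
theorem exists_isTriple_flow {H F : Γ → ℝ} {Ω : Form D Γ 2} {u : VField D Γ} {Φ : ℝ → Γ → Γ}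
    (hH : ContMDiff 𝓘(ℝ, Model D) 𝓘(ℝ, ℝ) ∞ H) (hF : ContMDiff 𝓘(ℝ, Model D) 𝓘(ℝ, ℝ) ∞ F)
    (hΩ : IsSymplectic Ω) (hu : IsSmoothVField u)
    (hinv : equivDeriv u (ofFun F + ofForm 2 Ω) = 0) (hΦ : IsSmoothFlow u Φ) :
    ∃ χ : ℝ → VField D Γ,
      IsTriple J (fun t ↦ pullback (Φ (-t)) (ofFun H + ofForm 2 Ω)) χ (dFun F) := by
  have hF' : IsSmoothForm (constForm D F) := contMDiff_iff_isSmoothForm.1 hF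
  have huΩ := ((equivDeriv_eq_zero_iff hF' hΩ.smooth).1 hinv).1
  have hjoint : ContMDiff (𝓘(ℝ, ℝ).prod 𝓘(ℝ, Model D)) 𝓘(ℝ, ℝ) ∞
      (fun p : ℝ × Γ ↦ H (Φ (-p.1) p.2)) :=
    hH.comp (hΦ.smooth.comp (contMDiff_fst.neg.prodMk contMDiff_snd))
  have hHt : ∀ t, IsSmoothForm (constForm D (H ∘ Φ (-t))) := fun t ↦
    isSmoothForm_of_family (H := fun t ↦ H ∘ Φ (-t)) (J := univ) hjoint.contMDiffOn (mem_univ t)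
  have hS : ∀ t, pullback (Φ (-t)) (ofFun H + ofForm 2 Ω) =
      ofFun (H ∘ Φ (-t)) + ofForm 2 Ω := by
    intro t
    rw [pullback_ofFun_add_ofForm]
    congr 2
    exact funext fun x ↦ hΦ.pullback_eq hΩ.smooth hΩ.closed hF' huΩ (-t) x
  choose χ hχ hχΩ using fun t ↦ exists_interior_eq hΩ.smooth hΩ.nondegenerate
    (α := -(constForm D (H ∘ Φ (-t))).d) (hHt t).d.neg
  refine ⟨χ, ⟨fun t ↦ H ∘ Φ (-t), fun _ ↦ Ω, fun t _ ↦ hS t, hjoint.contMDiffOn, ?_,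
    fun _ _ ↦ hΩ.closed, hΩ.nondegenerate⟩, fun t _ ↦ hχ t, fun t _ ↦ ?_, ?_, fun t _ ↦ ?_⟩
  · intro e he
    exact (hΩ.smooth e he).comp contDiff_snd.contDiffOn fun p hp ↦ hp.2
  · rw [hS, equivDeriv_eq_zero_iff (hHt t) hΩ.smooth]
    exact ⟨hχΩ t, hΩ.closed⟩
  · rw [dFun_eq]; exact hF'.d
  · rw [dFun_eq, equivDeriv_ofForm_one, hF'.d_d, ofForm_zero, add_zero]
    simp only [hS]
    intro k x
    rcases eq_or_ne k 0 with rfl | hk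
    · simp only [ofFun_eq, Pi.add_apply, ofForm_same, ofForm_ne (show 0 ≠ 2 by simp),
        Pi.zero_apply, add_zero]
      rw [interior_d_antisymm huΩ (hχΩ t)]
      refine hasDerivAt_alternating fun w ↦ ?_
      -- By the group law, differentiating H ∘ Φ_{-t} along the flow at time 0 differentiates H ∘
      -- Φ_{-t+s} at s = 0. The reversal s ↦ t - s below turns this into the derivative of H ∘
      -- Φ_{-s} at s = t, with the minus sign required.
      have h1 := (IsMIntegralCurve.hasDerivAt_comp (hΦ.integral x) (hHt t) 0)
      simp only [Function.comp_apply, ← hΦ.map_add hu] at h1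
      rw [hΦ.zero] at h1
      have h2 : HasDerivAt (fun s : ℝ ↦ t - s) (-1) t := by
        simpa using (hasDerivAt_id t).const_sub t
      rw [← sub_self t] at h1
      have h3 := HasDerivAt.scomp (h := fun s : ℝ ↦ t - s) t h1 h2
      have h4 : ((fun s : ℝ ↦ H (Φ (-t + s) x)) ∘ fun s ↦ t - s) =
          fun s ↦ (constForm D (H ∘ Φ (-s)) x : (Model D) [⋀^Fin 0]→L[ℝ] ℝ) w := by
        funext s
        rw [constForm_apply, Function.comp_apply, Function.comp_apply]
        congr 2
        ring
      rw [h4] at h3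
      refine h3.congr_deriv ?_
      change _ = -(interior u (constForm D (H ∘ Φ (-t))).d x w)
      rw [neg_one_smul]
      congr 1
      change _ = (constForm D (H ∘ Φ (-t))).d x (Matrix.vecCons (u x) w)
      congr 2
      exact Subsingleton.elim _ _
    · rw [ofForm_ne hk]
      simp only [ofFun_eq, Pi.add_apply, ofForm_ne hk]
      exact hasDerivAt_const _ _

/-- In degree 2 both terms of Cartan's formula vanish, d(i_u Ω) since the contraction is closed and
i_u dΩ since Ω is. Only the derivative of `H` along `u` survives. -/
theorem lieDeriv_ofFun_add_ofForm {H : Γ → ℝ} {Ω : Form D Γ 2} (u : VField D Γ)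
    (hH : IsSmoothForm (constForm D H)) (hΩ : IsSmoothForm Ω) (hcl : Ω.d = 0) {α : Form D Γ 1}
    (hu : interior u Ω = α) (hα : α.d = 0) :
    lieDeriv u (ofFun H + ofForm 2 Ω) = ofForm 0 (interior u (constForm D H).d) := by
  rw [lieDeriv, contract_add, ofFun_eq, contract_ofForm_zero, contract_ofForm_succ, zero_add,
    polyForm_d_ofForm, polyForm_d_add hH.ofForm hΩ.ofForm, polyForm_d_ofForm, polyForm_d_ofForm,
    contract_add, contract_ofForm_succ, hcl, ofForm_zero, hu, hα, ofForm_zero, zero_add]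
  exact add_zero _

/-- The velocity of s ↦ (s, γ s) splits into a time part, giving the explicit derivative `a`, and a
space part, giving the differential of `H t`. Joint smoothness of the family is what makes the
splitting legitimate. -/
theorem hasDerivAt_family_along_curve (hJ : IsOpen J) {H : ℝ → Γ → ℝ}
    (hH : ContMDiffOn (𝓘(ℝ, ℝ).prod 𝓘(ℝ, Model D)) 𝓘(ℝ, ℝ) ∞ (fun p : ℝ × Γ ↦ H p.1 p.2)
      (J ×ˢ univ)) {u : VField D Γ} {γ : ℝ → Γ}
    (hγ : IsMIntegralCurve (I := 𝓘(ℝ, Model D)) γ u) {t : ℝ} (ht : t ∈ J) {a : ℝ}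
    (ha : HasDerivAt (fun s ↦ H s (γ t)) a t) :
    HasDerivAt (fun s ↦ H s (γ s)) (a + (constForm D (H t)).d (γ t) ![u (γ t)]) t := by
  obtain ⟨e, he, hx⟩ : ∃ e ∈ IsManifold.maximalAtlas 𝓘(ℝ, Model D) ∞ Γ, γ t ∈ e.source :=
    ⟨_, chartAt_mem_maximalAtlas (γ t), mem_chart_source _ _⟩
  have hg := ((contDiffOn_family hH he).contDiffAt (x := (t, e (γ t)))
    ((hJ.prod e.open_target).mem_nhds ⟨ht, e.map_source hx⟩)).differentiableAt (by simp)
  have hc : HasDerivAt (fun s ↦ (s, e (γ s))) (1, tangentChart e (γ t) (u (γ t))) t :=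
    (hasDerivAt_id t).prodMk (IsMIntegralCurve.hasDerivAt_chart hγ he hx)
  have h1 := hg.hasFDerivAt.comp_hasDerivAt (f := fun s ↦ (s, e (γ s))) t hc
  have hsrc : ∀ᶠ s in 𝓝 t, γ s ∈ e.source :=
    hγ.continuous.continuousAt (e.open_source.mem_nhds hx)
  have h2 : HasDerivAt (fun s ↦ H s (γ s)) _ t := h1.congr_of_eventuallyEq (by
    filter_upwards [hsrc] with s hs
    simp only [Function.comp_apply, e.left_inv hs])
  refine h2.congr_deriv ?_
  have h3 : ((1 : ℝ), tangentChart e (γ t) (u (γ t))) =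
      ((1 : ℝ), (0 : Model D)) + ((0 : ℝ), tangentChart e (γ t) (u (γ t))) := by simp
  rw [h3, _root_.map_add]
  congr 1
  · have hc1 : HasDerivAt (fun s : ℝ ↦ (s, e (γ t))) ((1 : ℝ), (0 : Model D)) t :=
      (hasDerivAt_id t).prodMk (hasDerivAt_const _ _)
    have h4 := hg.hasFDerivAt.comp_hasDerivAt (f := fun s : ℝ ↦ (s, e (γ t))) t hc1
    refine h4.unique (ha.congr_of_eventuallyEq (Eventually.of_forall fun s ↦ ?_))
    simp only [Function.comp_apply, e.left_inv hx]
  · have hc2 : HasFDerivAt (fun z : Model D ↦ (t, z)) (ContinuousLinearMap.inr ℝ ℝ (Model D))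
      (e (γ t)) := hasFDerivAt_prodMk_right _ _
    have h5 := hg.hasFDerivAt.comp (f := fun z : Model D ↦ (t, z)) (e (γ t)) hc2
    have h6 := inChart_d_constForm (isSmoothForm_of_family hH ht) he (e.map_source hx)
      ![tangentChart e (γ t) (u (γ t))]
    have h7 : fderiv ℝ (H t ∘ e.symm) (e (γ t)) = _ := h5.fderiv
    rw [h7] at h6
    rw [form_apply_eq_inChart _ he hx]
    refine Eq.trans h6.symm ?_
    congr 1
    ext1 i
    rw [Fin.fin_one_eq_zero i]
    rfl

theorem ofFun_zero : (ofFun (0 : Γ → ℝ) : PolyForm D Γ) = 0 := by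
  rw [ofFun_eq, show constForm D (0 : Γ → ℝ) = 0 from rfl, ofForm_zero]

theorem IsTriple.exists_canonical (hJ : IsOpen J) (hJ' : J.OrdConnected) (h0 : (0 : ℝ) ∈ J)
    {S : ℝ → PolyForm D Γ} {χ : ℝ → VField D Γ} {F : Γ → ℝ}
    (hF : ContMDiff 𝓘(ℝ, Model D) 𝓘(ℝ, ℝ) ∞ F) (h : IsTriple J S χ (dFun F)) :
    ∃ u : VField D Γ, IsSmoothVField u ∧
      equivDeriv u (ofFun F + ofForm 2 (S 0 2)) = 0 ∧
      (∀ t ∈ J, S t 2 = S 0 2) ∧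
      (∀ t ∈ J, HasParamDerivAt S (-lieDeriv u (S t)) t) ∧
      ∀ Φ : ℝ → Γ → Γ, IsSmoothFlow u Φ → ∀ t ∈ J,
        pullback (Φ t) (ofForm 2 (S 0 2)) = ofForm 2 (S 0 2) ∧
        pullback (Φ t) (S t) = S 0 := by
  obtain ⟨H, Ω, hS, hH, hΩ, hcl, hnd⟩ := h.hamiltonian
  have hF' : IsSmoothForm (constForm D F) := contMDiff_iff_isSmoothForm.1 hF
  have hHt := fun t ht ↦ isSmoothForm_of_family (D := D) hH (t := t) ht
  have hS2 : ∀ t ∈ J, S t 2 = Ω t := by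
    intro t ht
    rw [hS t ht, ofFun_eq, Pi.add_apply, ofForm_same, ofForm_ne (by simp), zero_add]
  have hS0 : ∀ t ∈ J, ∀ x, S t 0 x = constForm D (H t) x := by
    intro t ht x
    rw [hS t ht, ofFun_eq, Pi.add_apply, ofForm_same, ofForm_ne (by simp), add_zero]
  have hdef : ∀ t, equivDeriv (χ t) (ofForm 1 (dFun F)) =
      ofForm 0 (interior (χ t) (constForm D F).d) := by
    intro t
    rw [dFun_eq, equivDeriv_ofForm_one, hF'.d_d, ofForm_zero, add_zero]
  -- Since d(dF) = 0, the deformation has no component of degree 2.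
  have hconst : ∀ t ∈ J, Ω t = Ω 0 := by
    intro t ht
    rw [← hS2 t ht, ← hS2 0 h0]
    funext x
    refine eqOn_of_hasDerivAt_zero (f := fun s ↦ S s 2 x) hJ hJ' (fun s hs ↦ ?_) ht h0
    have h1 := h.deformation s hs 2 x
    rwa [hdef, ofForm_ne (by simp)] at h1
  obtain ⟨u, hu, huΩ⟩ := exists_interior_eq (hΩ.isSmoothForm h0) hnd hF'.d.neg
  have hχΩ : ∀ t ∈ J, interior (χ t) (Ω 0) = -(constForm D (H t)).d := by
    intro t ht
    have h1 := h.invariant t ht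
    rw [hS t ht, equivDeriv_eq_zero_iff (hHt t ht) (hΩ.isSmoothForm ht), hconst t ht] at h1
    exact h1.1
  have hlie : ∀ t ∈ J, -lieDeriv u (S t) = equivDeriv (χ t) (ofForm 1 (dFun F)) := by
    intro t ht
    rw [hS t ht, lieDeriv_ofFun_add_ofForm u (hHt t ht) (hΩ.isSmoothForm ht) (hcl t ht)
      (α := -(constForm D F).d) (by rw [hconst t ht, huΩ]) (by rw [d_neg, hF'.d_d, neg_zero]),
      hdef, interior_d_antisymm huΩ (hχΩ t ht), ofForm_neg]
  have hderiv : ∀ t ∈ J, HasParamDerivAt S (-lieDeriv u (S t)) t := by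
    intro t ht
    rw [hlie t ht]
    exact h.deformation t ht
  refine ⟨u, hu, ?_, fun t ht ↦ ?_, hderiv, fun Φ hΦ t ht ↦ ?_⟩
  · rw [hS2 0 h0, equivDeriv_eq_zero_iff hF' (hΩ.isSmoothForm h0)]
    exact ⟨huΩ, hcl 0 h0⟩
  · rw [hS2 t ht, hS2 0 h0, hconst t ht]
  have hpull : (fun x ↦ (Ω 0 (Φ t x)).compContinuousLinearMap (tangentSelf (Φ t) x)) = Ω 0 :=
    funext fun x ↦ hΦ.pullback_eq (hΩ.isSmoothForm h0) (hcl 0 h0) hF' huΩ t x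
  -- Along the flow, the explicit derivative -dH_s(u) cancels the transport term dH_s(u).
  have hHconst : H t ∘ Φ t = H 0 := by
    funext x
    have h1 : ∀ s ∈ J, HasDerivAt (fun s ↦ H s (Φ s x)) 0 s := by
      intro s hs
      have h2 := (hderiv s hs 0 (Φ s x)).alternating_apply ![]
      rw [hlie s hs, hdef, interior_d_antisymm huΩ (hχΩ s hs), ofForm_same] at h2
      have h3 : HasDerivAt (fun r ↦ H r (Φ s x)) _ s := h2.congr_of_eventuallyEq (by
        filter_upwards [hJ.mem_nhds hs] with r hr
        rw [hS0 r hr, constForm_apply])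
      refine (hasDerivAt_family_along_curve hJ hH (hΦ.integral x) hs h3).congr_deriv ?_
      exact neg_add_cancel _
    have h4 := eqOn_of_hasDerivAt_zero hJ hJ' h1 ht h0
    simpa only [hΦ.zero, Function.comp_apply] using h4
  constructor
  · have h1 := pullback_ofFun_add_ofForm (Φ t) 0 (Ω 0)
    rw [show (0 : Γ → ℝ) ∘ Φ t = 0 from rfl, ofFun_zero, zero_add, zero_add, hpull] at h1
    rw [hS2 0 h0, h1]
  · rw [hS t ht, pullback_ofFun_add_ofForm, hconst t ht, hpull, hHconst, hS 0 h0]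

end Triples

/-! ### The Grassmann algebra -/

section GrassmannAlgebra

open ExteriorAlgebra

variable {D k : ℕ}

theorem toGrassmann_eq (η : (Model D) [⋀^Fin k]→L[ℝ] ℝ) :
    toGrassmann η = ((k ! : ℝ)⁻¹) • ∑ μ : Fin k → Fin (2 * D), η (fun i ↦ stdVec (μ i)) •
      ιMulti ℝ k (fun i ↦ (Pi.single (μ i) 1 : Fin (2 * D) → ℝ)) := rfl

/-- `toGrassmann` as a linear map. -/
def toGrassmannₗ (D k : ℕ) : ((Model D) [⋀^Fin k]→L[ℝ] ℝ) →ₗ[ℝ] Grassmann D where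
  toFun := toGrassmann
  map_add' η θ := by
    simp only [toGrassmann_eq, ContinuousAlternatingMap.add_apply, add_smul,
      Finset.sum_add_distrib, smul_add]
  map_smul' c η := by
    simp only [toGrassmann_eq, ContinuousAlternatingMap.smul_apply, smul_assoc, ← Finset.smul_sum,
      RingHom.id_apply]
    rw [smul_comm]

theorem toGrassmann_zero : toGrassmann (0 : (Model D) [⋀^Fin k]→L[ℝ] ℝ) = 0 :=
  (toGrassmannₗ D k).map_zero

theorem toGrassmann_mem (η : (Model D) [⋀^Fin k]→L[ℝ] ℝ) :
    toGrassmann η ∈ ⋀[ℝ]^k (Fin (2 * D) → ℝ) := by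
  rw [toGrassmann_eq]
  exact Submodule.smul_mem _ _ (Submodule.sum_mem _ fun μ _ ↦
    Submodule.smul_mem _ _ (ιMulti_range ℝ k ⟨_, rfl⟩))

theorem toGrassmann_degree_zero (η : (Model D) [⋀^Fin 0]→L[ℝ] ℝ) :
    toGrassmann η = algebraMap ℝ (Grassmann D) (η ![]) := by
  rw [toGrassmann_eq, Algebra.algebraMap_eq_smul_one]
  simp [Subsingleton.elim (fun i : Fin 0 ↦ _) ![]]

theorem toGrassmann_degree_one (η : (Model D) [⋀^Fin 1]→L[ℝ] ℝ) :
    toGrassmann η = ∑ μ, η ![stdVec μ] • gen μ := by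
  rw [toGrassmann_eq, Nat.factorial_one, Nat.cast_one, inv_one, one_smul]
  refine Fintype.sum_equiv (Equiv.funUnique (Fin 1) (Fin (2 * D))) _ _ fun μ ↦ ?_
  have h : (fun i ↦ stdVec (μ i)) = ![stdVec (D := D) (μ 0)] := by
    ext1 i; rw [Fin.fin_one_eq_zero i]; rfl
  rw [h]
  simp [ιMulti_apply, gen]

theorem toGrassmann_degree_one' (η : (Model D) [⋀^Fin 1]→L[ℝ] ℝ) :
    toGrassmann η = ExteriorAlgebra.ι ℝ (fun μ ↦ η ![stdVec μ]) := by
  rw [toGrassmann_degree_one]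
  conv_rhs => rw [pi_eq_sum_univ' (R := ℝ) (fun μ ↦ η ![stdVec μ]), map_sum]
  refine Finset.sum_congr rfl fun μ _ ↦ ?_
  rw [gen, map_smul]

theorem toGrassmann_degree_two (η : (Model D) [⋀^Fin 2]→L[ℝ] ℝ) :
    toGrassmann η = (2 : ℝ)⁻¹ • ∑ μ, ∑ ν, η ![stdVec μ, stdVec ν] • (gen μ * gen ν) := by
  rw [toGrassmann_eq, Nat.factorial_two, Nat.cast_two, ← Fintype.sum_prod_type']
  congr 1
  refine Fintype.sum_equiv (finTwoArrowEquiv (Fin (2 * D))) _ _ fun μ ↦ ?_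
  have h : (fun i ↦ stdVec (μ i)) = ![stdVec (D := D) (μ 0), stdVec (μ 1)] := by
    ext1 i; fin_cases i <;> rfl
  rw [h, ιMulti_succ_apply, ιMulti_succ_apply, ιMulti_zero_apply, mul_one]
  rfl

/-- The matrix of an endomorphism of the model space. -/
def modelMatrix (A : Model D →L[ℝ] Model D) : Matrix (Fin (2 * D)) (Fin (2 * D)) ℝ :=
  Matrix.of fun ν μ ↦ A (stdVec μ) ν

theorem det_modelMatrix (A : Model D →L[ℝ] Model D) : (modelMatrix A).det = A.det := by
  have h : modelMatrix A = LinearMap.toMatrix (EuclideanSpace.basisFun (Fin (2 * D)) ℝ).toBasis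
      (EuclideanSpace.basisFun (Fin (2 * D)) ℝ).toBasis (A : Model D →ₗ[ℝ] Model D) := by
    ext ν μ
    simp [modelMatrix, LinearMap.toMatrix_apply]
  rw [h, LinearMap.det_toMatrix]

/-- Pullback of forms is the linear substitution of generators ψ^ν ↦ Σ_μ A^ν_μ ψ^μ. Expanding by
multilinearity on either side gives the same double sum over index tuples. -/
theorem toGrassmann_comp (η : (Model D) [⋀^Fin k]→L[ℝ] ℝ) (A : Model D →L[ℝ] Model D) :
    toGrassmann (η.compContinuousLinearMap A) =
      ExteriorAlgebra.map (Matrix.vecMulLinear (modelMatrix A)) (toGrassmann η) := by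
  have hrow : ∀ ν, Matrix.vecMulLinear (modelMatrix A) (Pi.single ν 1) =
      ∑ μ, A (stdVec μ) ν • (Pi.single μ 1 : Fin (2 * D) → ℝ) := by
    intro ν
    ext μ
    simp [modelMatrix, Pi.single_apply]
  simp only [toGrassmann_eq, map_smul, map_sum]
  congr 1
  have hL : ∀ μ : Fin k → Fin (2 * D),
      (η.compContinuousLinearMap A) (fun i ↦ stdVec (μ i)) = ∑ ν : Fin k → Fin (2 * D),
        (∏ i, A (stdVec (μ i)) (ν i)) * η (fun i ↦ stdVec (ν i)) := by
    intro μ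
    rw [ContinuousAlternatingMap.compContinuousLinearMap_apply, alternating_apply_eq_sum]
    rfl
  simp only [hL, Finset.sum_smul]
  rw [Finset.sum_comm]
  refine Finset.sum_congr rfl fun ν _ ↦ ?_
  rw [ExteriorAlgebra.map_apply_ιMulti]
  have h1 : (Matrix.vecMulLinear (modelMatrix A) ∘
      fun i ↦ (Pi.single (ν i) 1 : Fin (2 * D) → ℝ)) =
      fun i ↦ ∑ μ, A (stdVec μ) (ν i) • (Pi.single μ 1 : Fin (2 * D) → ℝ) :=
    funext fun i ↦ hrow (ν i)
  rw [h1]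
  have h2 := (ιMulti ℝ k (M := Fin (2 * D) → ℝ)).toMultilinearMap.map_sum
    (fun i μ ↦ A (stdVec μ) (ν i) • (Pi.single μ 1 : Fin (2 * D) → ℝ))
  refine Eq.trans ?_ (congrArg (fun z ↦ η (fun i ↦ stdVec (ν i)) • z) h2.symm)
  rw [Finset.smul_sum]
  refine Finset.sum_congr rfl fun μ _ ↦ ?_
  have h3 := (ιMulti ℝ k (M := Fin (2 * D) → ℝ)).toMultilinearMap.map_smul_univ
    (fun i ↦ A (stdVec (μ i)) (ν i)) (fun i ↦ (Pi.single (μ i) 1 : Fin (2 * D) → ℝ))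
  refine Eq.trans ?_ (congrArg (fun z ↦ η (fun i ↦ stdVec (ν i)) • z) h3.symm)
  rw [smul_smul, mul_comm (η _)]
  rfl

theorem berezin_ιMulti (v : Fin (2 * D) → Fin (2 * D) → ℝ) :
    berezin D (ιMulti ℝ (2 * D) v) = Matrix.det (Matrix.of v) := by
  rw [berezin, liftAlternating_apply_ιMulti, Pi.single_eq_same]
  rfl

theorem berezin_ιMulti_ne {n : ℕ} (hn : n ≠ 2 * D) (v : Fin n → Fin (2 * D) → ℝ) :
    berezin D (ιMulti ℝ n v) = 0 := by
  rw [berezin, liftAlternating_apply_ιMulti, Pi.single_eq_of_ne hn]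
  rfl

/-- On the top exterior power a linear substitution acts by its determinant, and all other degrees
have Berezin integral 0. The determinant appears in the numerator, which is why the Berezin
coefficient transforms as a density up to sign. -/
theorem berezin_map (A : Matrix (Fin (2 * D)) (Fin (2 * D)) ℝ) (X : Grassmann D) :
    berezin D (ExteriorAlgebra.map (Matrix.vecMulLinear A) X) = A.det * berezin D X := by
  have h : (berezin D).comp (ExteriorAlgebra.map (Matrix.vecMulLinear A)).toLinearMap =
      A.det • berezin D := by
    refine ExteriorAlgebra.lhom_ext fun n ↦ ?_
    ext v
    change berezin D (ExteriorAlgebra.map (Matrix.vecMulLinear A) (ιMulti ℝ n v)) =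
      A.det * berezin D (ιMulti ℝ n v)
    rw [ExteriorAlgebra.map_apply_ιMulti]
    rcases eq_or_ne n (2 * D) with rfl | hn
    · rw [berezin_ιMulti, berezin_ιMulti, mul_comm A.det, ← Matrix.det_mul]
      congr 1
    · rw [berezin_ιMulti_ne hn, berezin_ιMulti_ne hn, mul_zero]
  exact LinearMap.congr_fun h X

theorem berezin_of_mem {n : ℕ} (hn : n ≠ 2 * D) {X : Grassmann D}
    (hX : X ∈ ⋀[ℝ]^n (Fin (2 * D) → ℝ)) : berezin D X = 0 := by
  rw [← ιMulti_span_fixedDegree] at hX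
  have h : Submodule.span ℝ (range (ιMulti ℝ n)) ≤ LinearMap.ker (berezin D) := by
    rw [Submodule.span_le]
    rintro _ ⟨v, rfl⟩
    exact berezin_ιMulti_ne hn v
  exact h hX

theorem ι_mem (v : Fin (2 * D) → ℝ) :
    ExteriorAlgebra.ι ℝ v ∈ ⋀[ℝ]^1 (Fin (2 * D) → ℝ) := by
  rw [exteriorPower, pow_one]
  exact LinearMap.mem_range_self _ _

theorem mul_mem_exteriorPower {m n : ℕ} {X Y : Grassmann D}
    (hX : X ∈ ⋀[ℝ]^m (Fin (2 * D) → ℝ)) (hY : Y ∈ ⋀[ℝ]^n (Fin (2 * D) → ℝ)) :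
    X * Y ∈ ⋀[ℝ]^(m + n) (Fin (2 * D) → ℝ) := by
  rw [exteriorPower, pow_add]
  exact Submodule.mul_mem_mul hX hY

theorem pow_mem_exteriorPower {m : ℕ} {X : Grassmann D}
    (hX : X ∈ ⋀[ℝ]^m (Fin (2 * D) → ℝ)) (n : ℕ) :
    X ^ n ∈ ⋀[ℝ]^(m * n) (Fin (2 * D) → ℝ) := by
  rw [exteriorPower, pow_mul]
  exact Submodule.pow_mem_pow _ hX n

/-- Contraction of an element of the Grassmann algebra. -/
def contr (d : Module.Dual ℝ (Fin (2 * D) → ℝ)) : Grassmann D →ₗ[ℝ] Grassmann D :=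
  CliffordAlgebra.contractLeft (Q := 0) d

theorem contr_ι_mul (d : Module.Dual ℝ (Fin (2 * D) → ℝ)) (v : Fin (2 * D) → ℝ)
    (X : Grassmann D) : contr d (ExteriorAlgebra.ι ℝ v * X) =
      d v • X - ExteriorAlgebra.ι ℝ v * contr d X :=
  CliffordAlgebra.contractLeft_ι_mul _ _ _

theorem contr_ι (d : Module.Dual ℝ (Fin (2 * D) → ℝ)) (v : Fin (2 * D) → ℝ) :
    contr d (ExteriorAlgebra.ι ℝ v) = algebraMap ℝ (Grassmann D) (d v) :=
  CliffordAlgebra.contractLeft_ι _ _ _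

theorem contr_one (d : Module.Dual ℝ (Fin (2 * D) → ℝ)) : contr d (1 : Grassmann D) = 0 :=
  CliffordAlgebra.contractLeft_one _ _

theorem contr_mem (d : Module.Dual ℝ (Fin (2 * D) → ℝ)) (n : ℕ) {X : Grassmann D}
    (hX : X ∈ ⋀[ℝ]^(n + 1) (Fin (2 * D) → ℝ)) :
    contr d X ∈ ⋀[ℝ]^n (Fin (2 * D) → ℝ) := by
  rw [← ιMulti_span_fixedDegree] at hX
  have key : ∀ (n : ℕ) (v : Fin (n + 1) → Fin (2 * D) → ℝ),
      contr d (ιMulti ℝ (n + 1) v : Grassmann D) ∈ ⋀[ℝ]^n (Fin (2 * D) → ℝ) := by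
    intro n
    induction n with
    | zero =>
      intro v
      rw [ιMulti_succ_apply, ιMulti_zero_apply, mul_one]
      rw [contr_ι, exteriorPower, pow_zero]
      exact Submodule.algebraMap_mem _
    | succ n ih =>
      intro v
      rw [ιMulti_succ_apply, contr_ι_mul]
      refine Submodule.sub_mem _ (Submodule.smul_mem _ _ (ιMulti_range ℝ _ ⟨_, rfl⟩)) ?_
      have h := mul_mem_exteriorPower (ι_mem (v 0)) (ih (Matrix.vecTail v))
      rwa [add_comm] at h
  have h : Submodule.span ℝ (range (ιMulti ℝ (n + 1))) ≤
      (⋀[ℝ]^n (Fin (2 * D) → ℝ)).comap (contr d) := by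
    rw [Submodule.span_le]
    rintro _ ⟨v, rfl⟩
    exact key n v
  exact h hX

/-- Contraction lowers the degree by one, so a top-degree result could come only from degree 2D + 1,
where 2D + 1 vectors in dimension 2D are dependent. This is the fermionic half of Stokes' theorem.
-/
theorem berezin_contr (d : Module.Dual ℝ (Fin (2 * D) → ℝ)) (X : Grassmann D) :
    berezin D (contr d X) = 0 := by
  have h : (berezin D).comp (contr d) = 0 := by
    refine ExteriorAlgebra.lhom_ext fun n ↦ ?_
    ext v
    change berezin D (contr d (ιMulti ℝ n v)) = 0
    rcases n with _ | n
    · rw [ιMulti_zero_apply]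
      rw [contr_one, map_zero]
    rcases eq_or_ne n (2 * D) with rfl | hn
    · have h0 : ιMulti ℝ (2 * D + 1) v = 0 := by
        refine AlternatingMap.map_linearDependent _ _ fun hv ↦ ?_
        have := hv.fintype_card_le_finrank
        simp at this
      rw [h0, map_zero, map_zero]
    · exact berezin_of_mem hn (contr_mem d n (ιMulti_range ℝ _ ⟨_, rfl⟩))
  exact LinearMap.congr_fun h X

/-- Forms of degree two are central. -/
theorem commute_of_mem_two {X : Grassmann D} (hX : X ∈ ⋀[ℝ]^2 (Fin (2 * D) → ℝ))
    (Y : Grassmann D) : Commute X Y := by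
  have swap : ∀ v w : Fin (2 * D) → ℝ, (ExteriorAlgebra.ι ℝ v * ExteriorAlgebra.ι ℝ w : Grassmann D)
      = -(ExteriorAlgebra.ι ℝ w * ExteriorAlgebra.ι ℝ v) := fun v w ↦
    eq_neg_of_add_eq_zero_left (ι_add_mul_swap v w)
  have key : ∀ (v w : Fin (2 * D) → ℝ) (Y : Grassmann D),
      Commute (ExteriorAlgebra.ι ℝ v * ExteriorAlgebra.ι ℝ w : Grassmann D) Y := by
    intro v w Y
    induction Y using ExteriorAlgebra.induction with
    | algebraMap r => exact (Algebra.commutes r _).symm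
    | ι z =>
      change _ * _ * _ = _ * (_ * _)
      rw [mul_assoc, swap w z, mul_neg, ← mul_assoc, swap v z, neg_mul, neg_neg, mul_assoc]
    | mul a b ha hb => exact ha.mul_right hb
    | add a b ha hb => exact ha.add_right hb
  rw [← ιMulti_span_fixedDegree] at hX
  induction hX using Submodule.span_induction with
  | mem x hx =>
    obtain ⟨v, rfl⟩ := hx
    rw [ιMulti_succ_apply, ιMulti_succ_apply, ιMulti_zero_apply, mul_one]
    exact key _ _ Y
  | zero => exact Commute.zero_left _
  | add x y _ _ hx hy => exact hx.add_left hy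
  | smul a x _ hx => exact hx.smul_left a

/-- Contraction with a vector acts as a derivation on the product with a form of degree two. -/
theorem contr_mul_of_mem_two (d : Module.Dual ℝ (Fin (2 * D) → ℝ)) {X : Grassmann D}
    (hX : X ∈ ⋀[ℝ]^2 (Fin (2 * D) → ℝ)) (Y : Grassmann D) :
    contr d (X * Y) = contr d X * Y + X * contr d Y := by
  rw [← ιMulti_span_fixedDegree] at hX
  induction hX using Submodule.span_induction with
  | mem x hx =>
    obtain ⟨v, rfl⟩ := hx
    rw [ιMulti_succ_apply, ιMulti_succ_apply, ιMulti_zero_apply, mul_one, mul_assoc]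
    simp only [contr_ι_mul, contr_ι, mul_sub, sub_mul, smul_mul_assoc, mul_smul_comm, mul_assoc,
      Algebra.algebraMap_eq_smul_one, mul_one]
    abel
  | zero => simp
  | add x y _ _ hx hy => rw [add_mul, map_add, hx, hy, map_add, add_mul, add_mul]; abel
  | smul a x _ hx => rw [smul_mul_assoc, map_smul, hx, map_smul, smul_add, smul_mul_assoc,
      smul_mul_assoc]

/-- Contraction acts as an unsigned derivation because X is even, and centrality of X collects the n
+ 1 equal terms. -/
theorem contr_pow_of_mem_two (d : Module.Dual ℝ (Fin (2 * D) → ℝ)) {X : Grassmann D}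
    (hX : X ∈ ⋀[ℝ]^2 (Fin (2 * D) → ℝ)) (n : ℕ) :
    contr d (X ^ (n + 1)) = ((n + 1 : ℕ) : ℝ) • (contr d X * X ^ n) := by
  induction n with
  | zero => simp
  | succ n ih =>
    rw [pow_succ', contr_mul_of_mem_two d hX, ih, mul_smul_comm, ← mul_assoc,
      (commute_of_mem_two hX (contr d X)).eq, mul_assoc, ← pow_succ']
    conv_rhs => rw [Nat.cast_succ, add_smul, one_smul, add_comm]

end GrassmannAlgebra

/-! ### Exterior derivative, contraction and nondegeneracy in Grassmann variables -/

section GrassmannForms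

open ExteriorAlgebra

variable {D k : ℕ}

/-- The exterior derivative becomes multiplication by the generators. -/
theorem toGrassmann_alternatizeUncurryFin (f : Model D →L[ℝ] (Model D) [⋀^Fin k]→L[ℝ] ℝ) :
    toGrassmann (ContinuousAlternatingMap.alternatizeUncurryFin f) =
      ∑ μ, gen μ * toGrassmann (f (stdVec μ)) := by
  -- Every term of the alternatization contributes the same: moving the `i`-th generator to the
  -- front costs (-1)^i, which cancels the sign of that term.
  have key : ∀ i : Fin (k + 1), ∑ μ : Fin (k + 1) → Fin (2 * D),
      ((-1 : ℝ) ^ (i : ℕ) * f (stdVec (μ i)) (i.removeNth fun j ↦ stdVec (μ j))) •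
        ιMulti ℝ (k + 1) (fun j ↦ (Pi.single (μ j) 1 : Fin (2 * D) → ℝ)) =
      ∑ μ : Fin (2 * D), ∑ ν : Fin k → Fin (2 * D), f (stdVec μ) (fun j ↦ stdVec (ν j)) •
        (gen μ * ιMulti ℝ k (fun j ↦ (Pi.single (ν j) 1 : Fin (2 * D) → ℝ))) := by
    intro i
    rw [← Fintype.sum_prod_type']
    symm
    refine Fintype.sum_equiv (Fin.insertNthEquiv (fun _ ↦ Fin (2 * D)) i) _ _ fun p ↦ ?_
    have h1 : (fun j ↦ (Pi.single (Fin.insertNthEquiv (fun _ ↦ Fin (2 * D)) i p j) 1 :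
        Fin (2 * D) → ℝ)) = i.insertNth (Pi.single p.1 1) (fun j ↦ Pi.single (p.2 j) 1) := by
      rw [Fin.eq_insertNth_iff]
      constructor
      · simp
      · ext1 j
        simp [Fin.removeNth]
    have h2 : (i.removeNth fun j ↦ stdVec (Fin.insertNthEquiv (fun _ ↦ Fin (2 * D)) i p j)) =
        fun j ↦ stdVec (D := D) (p.2 j) := by
      ext1 j
      simp [Fin.removeNth]
    have h3 : Fin.insertNthEquiv (fun _ ↦ Fin (2 * D)) i p i = p.1 := by simp
    rw [h1, h2, h3, AlternatingMap.map_insertNth, ιMulti_succ_apply]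
    have h4 : ((-1 : ℤ) ^ (i : ℕ) • (ExteriorAlgebra.ι ℝ (Matrix.vecCons
          (Pi.single p.1 1 : Fin (2 * D) → ℝ) (fun j ↦ Pi.single (p.2 j) 1) 0) *
          ιMulti ℝ k (Matrix.vecTail (Matrix.vecCons
            (Pi.single p.1 1 : Fin (2 * D) → ℝ) (fun j ↦ Pi.single (p.2 j) 1)))) : Grassmann D) =
        ((-1 : ℝ) ^ (i : ℕ)) • (gen p.1 *
          ιMulti ℝ k (fun j ↦ (Pi.single (p.2 j) 1 : Fin (2 * D) → ℝ))) := by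
      rcases neg_one_pow_eq_or ℤ (i : ℕ) with h | h
      · have h' : (-1 : ℝ) ^ (i : ℕ) = 1 := by exact_mod_cast congrArg (Int.cast (R := ℝ)) h
        rw [h, h', one_smul, one_smul]; rfl
      · have h' : (-1 : ℝ) ^ (i : ℕ) = -1 := by exact_mod_cast congrArg (Int.cast (R := ℝ)) h
        rw [h, h', neg_one_smul, neg_one_smul]; rfl
    have h6 : (-1 : ℝ) ^ (i : ℕ) * (-1) ^ (i : ℕ) = 1 := by
      rw [← mul_pow]; norm_num
    refine Eq.trans ?_ (congrArg (fun z ↦ ((-1 : ℝ) ^ (i : ℕ) *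
      f (stdVec p.1) (fun j ↦ stdVec (p.2 j))) • z) h4.symm)
    rw [smul_smul, mul_right_comm, h6, one_mul]
  -- The k + 1 equal contributions turn 1/(k+1)! into 1/k!.
  have hfac : (((k + 1)! : ℝ)⁻¹) * (k + 1) = (k ! : ℝ)⁻¹ := by
    rw [Nat.factorial_succ]
    push_cast
    field_simp
  rw [toGrassmann_eq]
  simp only [ContinuousAlternatingMap.alternatizeUncurryFin_apply, Finset.sum_smul]
  rw [Finset.sum_comm]
  have h5 : ∀ i : Fin (k + 1), ∑ μ : Fin (k + 1) → Fin (2 * D),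
      ((-1 : ℤ) ^ (i : ℕ) • f (stdVec (μ i)) (i.removeNth fun j ↦ stdVec (μ j))) •
        ιMulti ℝ (k + 1) (fun j ↦ (Pi.single (μ j) 1 : Fin (2 * D) → ℝ)) =
      ∑ μ : Fin (2 * D), ∑ ν : Fin k → Fin (2 * D), f (stdVec μ) (fun j ↦ stdVec (ν j)) •
        (gen μ * ιMulti ℝ k (fun j ↦ (Pi.single (ν j) 1 : Fin (2 * D) → ℝ))) := fun i ↦ by
    rw [← key i]
    simp
  simp only [h5, Finset.sum_const, Finset.card_univ, Fintype.card_fin]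
  rw [← Nat.cast_smul_eq_nsmul ℝ, smul_smul, Nat.cast_succ, hfac]
  simp only [toGrassmann_eq, mul_smul_comm, Finset.mul_sum, Finset.smul_sum]

/-- The linear form on the Grassmann generators given by a vector. -/
def vecDual (v : Model D) : Module.Dual ℝ (Fin (2 * D) → ℝ) := ∑ μ, v μ • LinearMap.proj μ

theorem vecDual_apply (v : Model D) (w : Fin (2 * D) → ℝ) : vecDual v w = ∑ μ, v μ * w μ := by
  simp [vecDual]

theorem vecDual_single (v : Model D) (μ : Fin (2 * D)) : vecDual v (Pi.single μ 1) = v μ := by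
  simp [vecDual_apply, Pi.single_apply]

theorem contr_gen_mul (v : Model D) (μ : Fin (2 * D)) (X : Grassmann D) :
    contr (vecDual v) (gen μ * X) = v μ • X - gen μ * contr (vecDual v) X := by
  rw [gen, contr_ι_mul, vecDual_single]

theorem contr_gen (v : Model D) (μ : Fin (2 * D)) :
    contr (vecDual v) (gen μ) = algebraMap ℝ (Grassmann D) (v μ) := by
  rw [gen, contr_ι, vecDual_single]

theorem twoForm_apply_left (η : (Model D) [⋀^Fin 2]→L[ℝ] ℝ) (v w : Model D) :
    η ![v, w] = ∑ μ, v μ * η ![stdVec μ, w] := by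
  have h : η.curryLeft v = ∑ μ, v μ • η.curryLeft (stdVec μ) := by
    conv_lhs => rw [← sum_smul_stdVec v]
    rw [map_sum]
    simp only [map_smul]
  have h1 := DFunLike.congr_fun h ![w]
  rw [ContinuousAlternatingMap.sum_apply] at h1
  exact h1

theorem contr_toGrassmann_one (η : (Model D) [⋀^Fin 1]→L[ℝ] ℝ) (v : Model D) :
    contr (vecDual v) (toGrassmann η) = toGrassmann (η.curryLeft v) := by
  rw [toGrassmann_degree_one, toGrassmann_degree_zero, map_sum]
  have h : η.curryLeft v ![] = ∑ μ, v μ * η ![stdVec μ] := by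
    have h1 : η.curryLeft v = ∑ μ, v μ • η.curryLeft (stdVec μ) := by
      conv_lhs => rw [← sum_smul_stdVec v]
      rw [map_sum]
      simp only [map_smul]
    rw [h1, ContinuousAlternatingMap.sum_apply]
    rfl
  rw [h, map_sum]
  refine Finset.sum_congr rfl fun μ _ ↦ ?_
  rw [map_smul, contr_gen, Algebra.smul_def, ← map_mul, mul_comm (v μ)]

/-- Contracting the second generator produces the same sum as contracting the first, once by the
sign of the contraction and once by antisymmetry of η; the doubling cancels the factor 1/2. -/
theorem contr_toGrassmann_two (η : (Model D) [⋀^Fin 2]→L[ℝ] ℝ) (v : Model D) :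
    contr (vecDual v) (toGrassmann η) = toGrassmann (η.curryLeft v) := by
  rw [toGrassmann_degree_one, toGrassmann_degree_two]
  simp only [map_smul, map_sum, contr_gen_mul, contr_gen, smul_sub, Finset.sum_sub_distrib]
  have h1 : ∑ μ, ∑ ν, η ![stdVec μ, stdVec ν] • v μ • gen ν =
      ∑ ν, η ![v, stdVec ν] • (gen ν : Grassmann D) := by
    rw [Finset.sum_comm]
    refine Finset.sum_congr rfl fun ν _ ↦ ?_
    rw [twoForm_apply_left η v, Finset.sum_smul]
    refine Finset.sum_congr rfl fun μ _ ↦ ?_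
    rw [smul_smul, mul_comm (v μ)]
  have h2 : ∑ μ, ∑ ν, η ![stdVec μ, stdVec ν] • (gen μ * algebraMap ℝ (Grassmann D) (v ν)) =
      -∑ ν, η ![v, stdVec ν] • (gen ν : Grassmann D) := by
    rw [← Finset.sum_neg_distrib]
    refine Finset.sum_congr rfl fun μ _ ↦ ?_
    rw [twoForm_apply_left η v, Finset.sum_smul, ← Finset.sum_neg_distrib]
    refine Finset.sum_congr rfl fun ν _ ↦ ?_
    rw [← Algebra.commutes, ← Algebra.smul_def, smul_smul, twoForm_swap η (stdVec ν), ← neg_smul]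
    congr 1
    ring
  rw [h1, h2, smul_neg, sub_neg_eq_add, ← two_smul ℝ, smul_smul, mul_inv_cancel₀ two_ne_zero,
    one_smul]
  rfl

/-! ### Nondegenerate forms and the volume form -/

/-- The top exterior power is a line: an alternating map in 2D vectors of a 2D-dimensional space is
the determinant times its value on a basis. -/
theorem eq_zero_of_berezin_eq_zero {X : Grassmann D} (hX : X ∈ ⋀[ℝ]^(2 * D) (Fin (2 * D) → ℝ))
    (h0 : berezin D X = 0) : X = 0 := by
  have key : ∀ v : Fin (2 * D) → Fin (2 * D) → ℝ, ιMulti ℝ (2 * D) v =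
      berezin D (ιMulti ℝ (2 * D) v) • ιMulti ℝ (2 * D) (Pi.basisFun ℝ (Fin (2 * D))) := by
    intro v
    have h : ιMulti ℝ (2 * D) (M := Fin (2 * D) → ℝ) = (LinearMap.toSpanSingleton ℝ (Grassmann D)
        (ιMulti ℝ (2 * D) (Pi.basisFun ℝ (Fin (2 * D))))).compAlternatingMap
          (Pi.basisFun ℝ (Fin (2 * D))).det := by
      refine Module.Basis.ext_alternating (Pi.basisFun ℝ (Fin (2 * D))) fun i hi ↦ ?_
      let σ : Equiv.Perm (Fin (2 * D)) :=
        Equiv.ofBijective i (Finite.injective_iff_bijective.1 hi)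
      change ιMulti ℝ (2 * D) (Pi.basisFun ℝ (Fin (2 * D)) ∘ σ) =
        LinearMap.toSpanSingleton ℝ (Grassmann D) (ιMulti ℝ (2 * D) (Pi.basisFun ℝ (Fin (2 * D))))
          ((Pi.basisFun ℝ (Fin (2 * D))).det (Pi.basisFun ℝ (Fin (2 * D)) ∘ σ))
      rw [AlternatingMap.map_perm, AlternatingMap.map_perm, Module.Basis.det_self,
        LinearMap.toSpanSingleton_apply]
      simp
    have h1 := AlternatingMap.congr_fun h v
    rw [LinearMap.compAlternatingMap_apply, LinearMap.toSpanSingleton_apply,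
      Pi.basisFun_det_apply] at h1
    rw [berezin_ιMulti]
    exact h1
  have h1 : X = berezin D X • ιMulti ℝ (2 * D) (Pi.basisFun ℝ (Fin (2 * D))) := by
    rw [← ιMulti_span_fixedDegree] at hX
    clear h0
    induction hX using Submodule.span_induction with
    | mem x hx => obtain ⟨v, rfl⟩ := hx; exact key v
    | zero => simp
    | add x y _ _ hx hy => rw [map_add, add_smul, ← hx, ← hy]
    | smul a x _ hx => rw [map_smul, smul_assoc, ← hx]
  rw [h1, h0, zero_smul]

/-- Euler's identity: Σ ψ^μ ∂/∂ψ^μ counts the degree. -/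
theorem sum_gen_mul_contr {n : ℕ} {X : Grassmann D} (hX : X ∈ ⋀[ℝ]^n (Fin (2 * D) → ℝ)) :
    ∑ μ, gen μ * contr (LinearMap.proj μ) X = (n : ℝ) • X := by
  have hv : ∀ v : Fin (2 * D) → ℝ, ∑ μ, v μ • gen μ = ExteriorAlgebra.ι ℝ v := by
    intro v
    conv_rhs => rw [pi_eq_sum_univ' (R := ℝ) v, map_sum]
    refine Finset.sum_congr rfl fun μ _ ↦ ?_
    rw [gen, map_smul]
  have key : ∀ (n : ℕ) (v : Fin n → Fin (2 * D) → ℝ), ∑ μ, gen μ * contr (LinearMap.proj μ)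
      (ιMulti ℝ n v) = (n : ℝ) • ιMulti ℝ n v := by
    intro n
    induction n with
    | zero => intro v; simp [contr_one]
    | succ n ih =>
      intro v
      rw [ιMulti_succ_apply]
      simp only [contr_ι_mul, mul_sub, Finset.sum_sub_distrib, LinearMap.proj_apply, mul_smul_comm]
      have h1 : ∀ μ : Fin (2 * D), gen μ * (ExteriorAlgebra.ι ℝ (v 0) *
          contr (LinearMap.proj μ) (ιMulti ℝ n (Matrix.vecTail v))) =
          -(ExteriorAlgebra.ι ℝ (v 0) * (gen μ *
            contr (LinearMap.proj μ) (ιMulti ℝ n (Matrix.vecTail v)))) := by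
        intro μ
        rw [← mul_assoc, ← mul_assoc, gen,
          eq_neg_of_add_eq_zero_left (ι_add_mul_swap (Pi.single μ 1) (v 0)), neg_mul]
      simp only [h1, Finset.sum_neg_distrib, sub_neg_eq_add, ← smul_mul_assoc, ← Finset.sum_mul,
        ← Finset.mul_sum, ih, hv, mul_smul_comm]
      rw [Nat.cast_succ, add_smul, one_smul, add_comm, ← add_mul]
  rw [← ιMulti_span_fixedDegree] at hX
  induction hX using Submodule.span_induction with
  | mem x hx => obtain ⟨v, rfl⟩ := hx; exact key n v
  | zero => simp
  | add x y _ _ hx hy => simp only [map_add, mul_add, Finset.sum_add_distrib, hx, hy, smul_add]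
  | smul a x _ hx =>
    simp only [map_smul, mul_smul_comm, ← Finset.smul_sum, hx]
    rw [smul_comm]

/-- The top power of a nondegenerate `2`-form does not vanish. -/
theorem berezin_pow_ne_zero {η : (Model D) [⋀^Fin 2]→L[ℝ] ℝ} (hη : Nondegenerate η) :
    berezin D (toGrassmann η ^ D) ≠ 0 := by
  intro h0
  have hm := toGrassmann_mem η
  have hD := eq_zero_of_berezin_eq_zero (pow_mem_exteriorPower hm D) h0
  -- Write η for its Grassmann element. Contracting η^(n+1) = 0 with v gives (i_v η) η^n = 0, and
  -- nondegeneracy makes i_v η an arbitrary one-form, so every ψ^μ kills η^n. Contracting ψ^μ η^n =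
  -- 0 with the dual vector gives ψ^μ ∂_μ η^n = η^n; summing over μ, Euler's identity yields 2n η^n
  -- = 2D η^n, hence η^n = 0. Descending from n = D ends at 1 = 0, with no need for a symplectic
  -- basis.
  have step : ∀ n, n < D → toGrassmann η ^ (n + 1) = 0 → toGrassmann η ^ n = 0 := by
    intro n hn h
    have h1 : ∀ w : Fin (2 * D) → ℝ, ExteriorAlgebra.ι ℝ w * toGrassmann η ^ n = 0 := by
      intro w
      obtain ⟨f, hf⟩ := hη.exists_equiv
      have h2 : ExteriorAlgebra.ι ℝ w =
          contr (vecDual (f.symm (WithLp.toLp 2 w))) (toGrassmann η) := by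
        rw [contr_toGrassmann_two, toGrassmann_degree_one']
        congr 1
        ext1 μ
        rw [← formVec_apply]
        change _ = formMap η (f.symm (WithLp.toLp 2 w)) μ
        rw [← hf]
        change _ = f (f.symm (WithLp.toLp 2 w)) μ
        rw [f.apply_symm_apply]
      have h3 := contr_pow_of_mem_two (vecDual (f.symm (WithLp.toLp 2 w))) hm n
      rw [h, map_zero, ← h2] at h3
      exact (smul_eq_zero.1 h3.symm).resolve_left (by positivity)
    have h4 := sum_gen_mul_contr (pow_mem_exteriorPower hm n)
    have h5 : ∀ μ : Fin (2 * D), gen μ * contr (LinearMap.proj μ) (toGrassmann η ^ n) =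
        toGrassmann η ^ n := by
      intro μ
      have h6 := contr_ι_mul (LinearMap.proj μ) (Pi.single μ 1) (toGrassmann η ^ n)
      rw [h1, map_zero, LinearMap.proj_apply, Pi.single_eq_same, one_smul] at h6
      exact (sub_eq_zero.1 h6.symm).symm
    simp only [h5, Finset.sum_const, Finset.card_univ, Fintype.card_fin] at h4
    rw [← Nat.cast_smul_eq_nsmul ℝ, ← sub_eq_zero, ← sub_smul] at h4
    refine (smul_eq_zero.1 h4).resolve_left ?_
    have : ((2 * n : ℕ) : ℝ) < (2 * D : ℕ) := by exact_mod_cast (by omega : 2 * n < 2 * D)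
    exact (sub_pos.2 this).ne'
  have hall : ∀ j, j ≤ D → toGrassmann η ^ (D - j) = 0 := by
    intro j
    induction j with
    | zero => intro _; simpa using hD
    | succ j ih =>
      intro hj
      refine step _ (by omega) ?_
      rw [show D - (j + 1) + 1 = D - j by omega]
      exact ih (by omega)
  have := hall D le_rfl
  rw [Nat.sub_self, pow_zero] at this
  exact one_ne_zero this

end GrassmannForms

/-! ### The exponential of a two-form -/

section GrassmannExponential

open ExteriorAlgebra

variable {D k : ℕ}

instance : Module.Finite ℝ (Grassmann D) :=
  Module.Finite.of_basis (Pi.basisFun ℝ (Fin (2 * D))).ExteriorAlgebra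

/-- A norm on the Grassmann algebra, by left multiplication matrices. -/
instance : NormedRing (Grassmann D) :=
  letI := Matrix.linftyOpNormedRing (n := Finset (Fin (2 * D))) (α := ℝ)
  NormedRing.induced (Grassmann D) (Matrix (Finset (Fin (2 * D))) (Finset (Fin (2 * D))) ℝ)
    (Algebra.leftMulMatrix (Pi.basisFun ℝ (Fin (2 * D))).ExteriorAlgebra)
    (Algebra.leftMulMatrix_injective _)

/-- The norm is auxiliary: it makes the product rule available for Grassmann-valued functions. -/
instance : NormedAlgebra ℝ (Grassmann D) :=
  letI := Matrix.linftyOpNormedRing (n := Finset (Fin (2 * D))) (α := ℝ)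
  letI := Matrix.linftyOpNormedAlgebra (n := Finset (Fin (2 * D))) (R := ℝ) (α := ℝ)
  NormedAlgebra.induced ℝ (Grassmann D) (Matrix (Finset (Fin (2 * D))) (Finset (Fin (2 * D))) ℝ)
    (Algebra.leftMulMatrix (Pi.basisFun ℝ (Fin (2 * D))).ExteriorAlgebra)

theorem eq_zero_of_mem {n : ℕ} (hn : 2 * D < n) {X : Grassmann D}
    (hX : X ∈ ⋀[ℝ]^n (Fin (2 * D) → ℝ)) : X = 0 := by
  rw [← ιMulti_span_fixedDegree] at hX
  have h : Submodule.span ℝ (range (ιMulti ℝ n)) ≤ (⊥ : Submodule ℝ (Grassmann D)) := by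
    rw [Submodule.span_le]
    rintro _ ⟨v, rfl⟩
    refine AlternatingMap.map_linearDependent _ _ fun hv ↦ ?_
    have := hv.fintype_card_le_finrank
    simp at this
    omega
  exact h hX

theorem algebraMapInv_of_mem {n : ℕ} {X : Grassmann D}
    (hX : X ∈ ⋀[ℝ]^(n + 1) (Fin (2 * D) → ℝ)) : algebraMapInv X = (0 : ℝ) := by
  rw [← ιMulti_span_fixedDegree] at hX
  have h : Submodule.span ℝ (range (ιMulti ℝ (n + 1))) ≤
      LinearMap.ker (algebraMapInv (R := ℝ) (M := Fin (2 * D) → ℝ)).toLinearMap := by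
    rw [Submodule.span_le]
    rintro _ ⟨v, rfl⟩
    change algebraMapInv (ιMulti ℝ (n + 1) v) = (0 : ℝ)
    rw [ιMulti_succ_apply, map_mul, algebraMapInv, lift_ι_apply]
    simp
  exact h hX

/-- The truncated exponential series. -/
def expSum (X : Grassmann D) : Grassmann D :=
  ∑ j ∈ Finset.range (2 * D + 1), ((j ! : ℝ)⁻¹) • X ^ j

theorem gexp_eq (r : ℝ) {X : Grassmann D} (hX : X ∈ ⋀[ℝ]^2 (Fin (2 * D) → ℝ)) :
    gexp (algebraMap ℝ (Grassmann D) r + X) = Real.exp r • expSum X := by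
  have h : algebraMapInv (algebraMap ℝ (Grassmann D) r + X) = r := by
    rw [map_add, algebraMapInv_of_mem hX, add_zero]
    exact algebraMap_leftInverse _ r
  rw [gexp, h, add_sub_cancel_left]
  rfl

/-- A substitution of generators preserves the body and is an algebra map, so it passes through the
finite series. This is what makes e^S tensorial. -/
theorem gexp_map (f : (Fin (2 * D) → ℝ) →ₗ[ℝ] (Fin (2 * D) → ℝ)) (X : Grassmann D) :
    gexp (ExteriorAlgebra.map f X) = ExteriorAlgebra.map f (gexp X) := by
  have h : algebraMapInv (ExteriorAlgebra.map f X) = algebraMapInv X := by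
    have : (algebraMapInv (R := ℝ)).comp (ExteriorAlgebra.map f) =
        algebraMapInv (R := ℝ) (M := Fin (2 * D) → ℝ) := by
      ext v
      simp [algebraMapInv]
    exact AlgHom.congr_fun this X
  simp only [gexp, h, map_smul, map_sum, map_pow, map_sub, AlgHom.commutes]

/-- The termwise derivation rule shifts the series by one. The leftover last term has degree 4D + 1,
which exceeds 2D even for D = 0, so truncation costs nothing. -/
theorem expSum_contr (d : Module.Dual ℝ (Fin (2 * D) → ℝ)) {X : Grassmann D}
    (hX : X ∈ ⋀[ℝ]^2 (Fin (2 * D) → ℝ)) :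
    contr d (expSum X) = contr d X * expSum X := by
  have h0 : contr d X * X ^ (2 * D) = 0 :=
    eq_zero_of_mem (by omega) (mul_mem_exteriorPower (contr_mem d 1 hX)
      (pow_mem_exteriorPower hX (2 * D)))
  rw [expSum, map_sum, Finset.sum_range_succ', Finset.mul_sum, Finset.sum_range_succ,
    mul_smul_comm, h0, smul_zero, add_zero, pow_zero, map_smul, contr_one, smul_zero, add_zero]
  refine Finset.sum_congr rfl fun j _ ↦ ?_
  rw [map_smul, contr_pow_of_mem_two d hX, smul_smul, mul_smul_comm, Nat.factorial_succ]
  congr 1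
  push_cast
  field_simp

/-- In a noncommutative algebra the derivative of a power takes this form because the value X(t),
being of degree 2, commutes with X'. -/
theorem hasDerivAt_pow_of_mem_two {X : ℝ → Grassmann D} {X' : Grassmann D} {t : ℝ}
    (hX : X t ∈ ⋀[ℝ]^2 (Fin (2 * D) → ℝ)) (h : HasDerivAt X X' t) (n : ℕ) :
    HasDerivAt (fun s ↦ X s ^ (n + 1)) (((n + 1 : ℕ) : ℝ) • (X' * X t ^ n)) t := by
  induction n with
  | zero => simpa using h
  | succ n ih =>
    have h1 := ih.fun_mul h
    simp only [← pow_succ] at h1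
    refine h1.congr_deriv ?_
    rw [smul_mul_assoc, mul_assoc, ← pow_succ,
      ((commute_of_mem_two hX X').pow_left (n + 1)).eq, Nat.cast_succ (n + 1), add_smul, one_smul]

theorem hasDerivAt_expSum {X : ℝ → Grassmann D} {X' : Grassmann D} {t : ℝ}
    (hX : X t ∈ ⋀[ℝ]^2 (Fin (2 * D) → ℝ)) (hX' : X' ∈ ⋀[ℝ]^2 (Fin (2 * D) → ℝ))
    (h : HasDerivAt X X' t) :
    HasDerivAt (fun s ↦ expSum (X s)) (X' * expSum (X t)) t := by
  have h0 : X' * X t ^ (2 * D) = 0 :=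
    eq_zero_of_mem (by omega) (mul_mem_exteriorPower hX' (pow_mem_exteriorPower hX (2 * D)))
  have h1 : HasDerivAt (fun s ↦ ∑ j ∈ Finset.range (2 * D), (((j + 1)! : ℝ)⁻¹) • X s ^ (j + 1))
      (∑ j ∈ Finset.range (2 * D),
        (((j + 1)! : ℝ)⁻¹) • (((j + 1 : ℕ) : ℝ) • (X' * X t ^ j))) t :=
    HasDerivAt.fun_sum fun j _ ↦ (hasDerivAt_pow_of_mem_two hX h j).fun_const_smul _
  have h2 := h1.add_const (((0 ! : ℝ)⁻¹) • (1 : Grassmann D))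
  simp only [expSum]
  rw [Finset.mul_sum, Finset.sum_range_succ, mul_smul_comm, h0, smul_zero, add_zero]
  simp only [Finset.sum_range_succ' _ (2 * D), pow_zero]
  refine h2.congr_deriv (Finset.sum_congr rfl fun j _ ↦ ?_)
  rw [smul_smul, mul_smul_comm, Nat.factorial_succ]
  congr 1
  push_cast
  field_simp

/-- The weight `e^{H + Ω}`. -/
def weight (r : ℝ) (X : Grassmann D) : Grassmann D := Real.exp r • expSum X

theorem hasDerivAt_weight {r : ℝ → ℝ} {r' : ℝ} {X : ℝ → Grassmann D} {X' : Grassmann D} {t : ℝ}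
    (hr : HasDerivAt r r' t) (hX : X t ∈ ⋀[ℝ]^2 (Fin (2 * D) → ℝ))
    (hX' : X' ∈ ⋀[ℝ]^2 (Fin (2 * D) → ℝ)) (h : HasDerivAt X X' t) :
    HasDerivAt (fun s ↦ weight (r s) (X s))
      ((algebraMap ℝ (Grassmann D) r' + X') * weight (r t) (X t)) t := by
  refine (hr.exp.fun_smul (hasDerivAt_expSum hX hX' h)).congr_deriv ?_
  rw [weight, add_mul, ← Algebra.smul_def, smul_smul, mul_smul_comm, mul_comm r', add_comm]

theorem contr_weight (d : Module.Dual ℝ (Fin (2 * D) → ℝ)) (r : ℝ) {X : Grassmann D}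
    (hX : X ∈ ⋀[ℝ]^2 (Fin (2 * D) → ℝ)) :
    contr d (weight r X) = contr d X * weight r X := by
  rw [weight, map_smul, expSum_contr d hX, mul_smul_comm]

theorem _root_.ContDiffOn.weight {E : Type*} [NormedAddCommGroup E] [NormedSpace ℝ E]
    {s : Set E} {r : E → ℝ} {X : E → Grassmann D}
    (hr : ContDiffOn ℝ ∞ r s) (hX : ContDiffOn ℝ ∞ X s) :
    ContDiffOn ℝ ∞ (fun p ↦ LocalizationPrinciple.weight (r p) (X p)) s := by
  refine hr.exp.smul ?_
  unfold expSum
  exact ContDiffOn.sum fun j _ ↦ (hX.pow j).const_smul _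

theorem _root_.ContDiffOn.toGrassmann {E : Type*} [NormedAddCommGroup E] [NormedSpace ℝ E]
    {s : Set E} {η : E → (Model D) [⋀^Fin k]→L[ℝ] ℝ} (hη : ContDiffOn ℝ ∞ η s) :
    ContDiffOn ℝ ∞ (fun p ↦ LocalizationPrinciple.toGrassmann (η p)) s :=
  (LinearMap.toContinuousLinearMap (toGrassmannₗ D k)).contDiff.comp_contDiffOn hη

theorem _root_.ContDiffOn.berezin {E : Type*} [NormedAddCommGroup E] [NormedSpace ℝ E]
    {s : Set E} {X : E → Grassmann D} (hX : ContDiffOn ℝ ∞ X s) :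
    ContDiffOn ℝ ∞ (fun p ↦ LocalizationPrinciple.berezin D (X p)) s :=
  (LinearMap.toContinuousLinearMap (LocalizationPrinciple.berezin D)).contDiff.comp_contDiffOn hX

end GrassmannExponential

/-! ### The divergence identity -/

section Divergence

variable {D k : ℕ} {y : Model D}

theorem toGrassmann_extDeriv (α : Model D → (Model D) [⋀^Fin k]→L[ℝ] ℝ) (y : Model D) :
    toGrassmann (extDeriv α y) = ∑ μ, gen μ * toGrassmann (fderiv ℝ α y (stdVec μ)) :=
  toGrassmann_alternatizeUncurryFin _

theorem gen_mul_toGrassmann_one (μ : Fin (2 * D)) (η : (Model D) [⋀^Fin 1]→L[ℝ] ℝ) :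
    gen μ * toGrassmann η = -(toGrassmann η * gen μ) := by
  rw [toGrassmann_degree_one', gen]
  exact eq_neg_of_add_eq_zero_left (ExteriorAlgebra.ι_add_mul_swap _ _)

/-- The component `∫dψ ψ^μ p e^{h+Ω}` of the current, for a one-form `p`. -/
def current (h : Model D → ℝ) (α : Model D → (Model D) [⋀^Fin 2]→L[ℝ] ℝ)
    (p : Model D → (Model D) [⋀^Fin 1]→L[ℝ] ℝ) (μ : Fin (2 * D)) (y : Model D) : ℝ :=
  berezin D (gen μ * (toGrassmann (p y) * weight (h y) (toGrassmann (α y))))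

variable {h : Model D → ℝ} {α : Model D → (Model D) [⋀^Fin 2]→L[ℝ] ℝ}
    {p : Model D → (Model D) [⋀^Fin 1]→L[ℝ] ℝ}

theorem contDiffOn_current {s : Set (Model D)} (hh : ContDiffOn ℝ ∞ h s)
    (hα : ContDiffOn ℝ ∞ α s) (hp : ContDiffOn ℝ ∞ p s) (μ : Fin (2 * D)) :
    ContDiffOn ℝ ∞ (current h α p μ) s :=
  (contDiffOn_const.mul (hp.toGrassmann.mul (hh.weight hα.toGrassmann))).berezin

theorem hasDerivAt_line {E : Type*} [NormedAddCommGroup E] [NormedSpace ℝ E]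
    {f : Model D → E} (hf : DifferentiableAt ℝ f y) (v : Model D) :
    HasDerivAt (fun s : ℝ ↦ f (y + s • v)) (fderiv ℝ f y v) 0 :=
  hf.hasFDerivAt.hasLineDerivAt v

theorem hasDerivAt_current (hh : DifferentiableAt ℝ h y) (hα : DifferentiableAt ℝ α y)
    (hp : DifferentiableAt ℝ p y) (μ : Fin (2 * D)) (v : Model D) :
    HasDerivAt (fun s : ℝ ↦ current h α p μ (y + s • v))
      (berezin D (gen μ * (toGrassmann (fderiv ℝ p y v) * weight (h y) (toGrassmann (α y)) +
        toGrassmann (p y) * ((algebraMap ℝ (Grassmann D) (fderiv ℝ h y v) +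
          toGrassmann (fderiv ℝ α y v)) * weight (h y) (toGrassmann (α y)))))) 0 := by
  have h1 : HasDerivAt (fun s : ℝ ↦ toGrassmann (p (y + s • v)))
      (toGrassmann (fderiv ℝ p y v)) 0 :=
    (LinearMap.toContinuousLinearMap (toGrassmannₗ D 1)).hasFDerivAt.comp_hasDerivAt 0
      (hasDerivAt_line hp v)
  have h2 : HasDerivAt (fun s : ℝ ↦ toGrassmann (α (y + s • v)))
      (toGrassmann (fderiv ℝ α y v)) 0 :=
    (LinearMap.toContinuousLinearMap (toGrassmannₗ D 2)).hasFDerivAt.comp_hasDerivAt 0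
      (hasDerivAt_line hα v)
  have h3 := hasDerivAt_weight (hasDerivAt_line hh v) (toGrassmann_mem _) (toGrassmann_mem _) h2
  have h4 := (h1.fun_mul h3).const_mul (gen μ)
  have h5 := (LinearMap.toContinuousLinearMap (berezin D)).hasFDerivAt.comp_hasDerivAt 0 h4
  simp only [zero_smul, add_zero] at h5
  exact h5

/-- The divergence of the current is `∫dψ (d_χ p) e^{h+Ω}` if `d_χ (h + Ω) = 0`. -/
theorem sum_fderiv_current (hh : DifferentiableAt ℝ h y) (hα : DifferentiableAt ℝ α y)
    (hp : DifferentiableAt ℝ p y) (hc : ∀ μ, DifferentiableAt ℝ (current h α p μ) y)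
    (hd : extDeriv α y = 0) {v : Model D}
    (hv : ∀ w, α y ![v, w] = -fderiv ℝ h y w) :
    ∑ μ, fderiv ℝ (current h α p μ) y (stdVec μ) =
      berezin D ((algebraMap ℝ (Grassmann D) (p y ![v]) + toGrassmann (extDeriv p y)) *
        weight (h y) (toGrassmann (α y))) := by
  set W := weight (h y) (toGrassmann (α y))
  set P := toGrassmann (p y)
  -- The product rule gives three terms, from p, h and α. The minus signs come from moving ψ^μ past
  -- the odd element P.
  have h1 : ∀ μ, fderiv ℝ (current h α p μ) y (stdVec μ) =
      berezin D (gen μ * toGrassmann (fderiv ℝ p y (stdVec μ)) * W) -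
        berezin D (P * (fderiv ℝ h y (stdVec μ) • gen μ) * W) -
        berezin D (P * (gen μ * toGrassmann (fderiv ℝ α y (stdVec μ))) * W) := by
    intro μ
    rw [(hasDerivAt_line (hc μ) (stdVec μ)).unique (hasDerivAt_current hh hα hp μ (stdVec μ)),
      ← map_sub, ← map_sub]
    congr 1
    change gen μ * (_ * W + P * (_ * W)) = _
    rw [mul_add, ← mul_assoc, ← mul_assoc (gen μ) P, gen_mul_toGrassmann_one μ (p y),
      add_mul, ← Algebra.smul_def]
    change _ + -(P * gen μ) * _ = _
    simp only [neg_mul, mul_add, mul_assoc, smul_mul_assoc, mul_smul_comm, smul_neg]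
    abel
  simp only [h1, Finset.sum_sub_distrib, ← map_sum, ← Finset.sum_mul, ← Finset.mul_sum]
  -- The sums Σ ψ^μ ∂_μ assemble into dp and dα, and dα = 0.
  rw [← toGrassmann_extDeriv, ← toGrassmann_extDeriv, hd, toGrassmann_zero, mul_zero, zero_mul,
    map_zero, sub_zero]
  have h2 : contr (vecDual v) (toGrassmann (α y)) =
      -∑ μ, fderiv ℝ h y (stdVec μ) • gen μ := by
    rw [contr_toGrassmann_two, toGrassmann_degree_one, ← Finset.sum_neg_distrib]
    refine Finset.sum_congr rfl fun μ _ ↦ ?_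
    rw [← neg_smul, ← hv]
    rfl
  -- Since i_v α = -dh, contracting the weight reproduces dh. The vanishing Berezin integral of this
  -- contraction exchanges the remaining dh term of the divergence for p(v).
  have h3 : contr (vecDual v) (P * W) = algebraMap ℝ (Grassmann D) (p y ![v]) * W +
      P * (∑ μ, fderiv ℝ h y (stdVec μ) • gen μ) * W := by
    have h4 : vecDual v (fun μ ↦ p y ![stdVec μ]) = p y ![v] := by
      have h5 : algebraMap ℝ (Grassmann D) (vecDual v (fun μ ↦ p y ![stdVec μ])) =
          algebraMap ℝ (Grassmann D) (p y ![v]) := by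
        rw [← contr_ι, ← toGrassmann_degree_one', contr_toGrassmann_one, toGrassmann_degree_zero]
        rfl
      simpa using h5
    simp only [P]
    rw [toGrassmann_degree_one', contr_ι_mul, h4, contr_weight _ _ (toGrassmann_mem _), h2,
      Algebra.smul_def, neg_mul, mul_neg, sub_neg_eq_add, mul_assoc]
  have h6 := berezin_contr (vecDual v) (P * W)
  rw [h3, map_add] at h6
  rw [add_mul, map_add, eq_neg_of_add_eq_zero_left h6]
  ring

end Divergence

/-! ### The Liouville measure -/

section Liouville

variable {D k : ℕ} {Γ : Type*} [TopologicalSpace Γ] [ChartedSpace (Model D) Γ]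
  {e e' : OpenPartialHomeomorph Γ (Model D)} {y : Model D}

/-- The substitution of Grassmann variables at `y` given by the chart `e`. -/
def chartSubst (e : OpenPartialHomeomorph Γ (Model D)) (y : Model D) :
    Grassmann D →ₐ[ℝ] Grassmann D :=
  ExteriorAlgebra.map (Matrix.vecMulLinear (modelMatrix (tangentSymm e y)))

theorem toGrassmann_inChart (α : Form D Γ k) (e : OpenPartialHomeomorph Γ (Model D))
    (y : Model D) : toGrassmann (α.inChart e y) = chartSubst e y (toGrassmann (α (e.symm y))) :=
  toGrassmann_comp _ _

theorem berezin_chartSubst (e : OpenPartialHomeomorph Γ (Model D)) (y : Model D)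
    (X : Grassmann D) : berezin D (chartSubst e y X) = (tangentSymm e y).det * berezin D X := by
  rw [chartSubst, berezin_map, det_modelMatrix]

/-- The truncation at degree 2D loses nothing, because the Grassmann element of a form of higher
degree is zero. -/
theorem super_ofForm (α : Form D Γ k) (e : OpenPartialHomeomorph Γ (Model D)) (y : Model D) :
    (ofForm k α).super e y = toGrassmann (α.inChart e y) := by
  rw [PolyForm.super]
  by_cases hk : k ∈ Finset.range (2 * D + 1)
  · rw [Finset.sum_eq_single_of_mem k hk, ofForm_same]
    intro j _ hj
    rw [ofForm_ne hj, inChart_zero, Pi.zero_apply, toGrassmann_zero]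
  · rw [eq_zero_of_mem (by simpa using hk) (toGrassmann_mem (α.inChart e y))]
    refine Finset.sum_eq_zero fun j hj ↦ ?_
    have hjk : j ≠ k := fun h ↦ hk (h ▸ hj)
    rw [ofForm_ne hjk, inChart_zero, Pi.zero_apply, toGrassmann_zero]

theorem super_add (P Q : PolyForm D Γ) (e : OpenPartialHomeomorph Γ (Model D)) (y : Model D) :
    (P + Q).super e y = P.super e y + Q.super e y := by
  rw [PolyForm.super, PolyForm.super, PolyForm.super, ← Finset.sum_add_distrib]
  refine Finset.sum_congr rfl fun j _ ↦ ?_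
  rw [Pi.add_apply, inChart_add, Pi.add_apply]
  exact (toGrassmannₗ D j).map_add _ _

/-- The coefficient of the volume form `Ω^D` in a chart. -/
def volCoeff (Ω : Form D Γ 2) (e : OpenPartialHomeomorph Γ (Model D)) (y : Model D) : ℝ :=
  berezin D (toGrassmann (Ω.inChart e y) ^ D)

/-- The coefficient of the volume form `Ω^D` in the tangent space. -/
def volAt (Ω : Form D Γ 2) (x : Γ) : ℝ := berezin D (toGrassmann (Ω x) ^ D)

theorem volCoeff_eq (Ω : Form D Γ 2) (e : OpenPartialHomeomorph Γ (Model D)) (y : Model D) :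
    volCoeff Ω e y = (tangentSymm e y).det * volAt Ω (e.symm y) := by
  rw [volCoeff, toGrassmann_inChart, ← map_pow, berezin_chartSubst, volAt]

theorem volAt_ne_zero {Ω : Form D Γ 2} (h : IsNondegenerate Ω) (x : Γ) : volAt Ω x ≠ 0 :=
  berezin_pow_ne_zero (h x)

theorem volCoeff_ne_zero {Ω : Form D Γ 2} (h : IsNondegenerate Ω)
    (he : e ∈ IsManifold.maximalAtlas 𝓘(ℝ, Model D) ∞ Γ) (hy : y ∈ e.target) :
    volCoeff Ω e y ≠ 0 :=
  berezin_pow_ne_zero (h.inChart he hy)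

theorem volCoeff_transition (Ω : Form D Γ 2)
    (he : e ∈ IsManifold.maximalAtlas 𝓘(ℝ, Model D) ∞ Γ)
    (he' : e' ∈ IsManifold.maximalAtlas 𝓘(ℝ, Model D) ∞ Γ) (hy : y ∈ transitionDomain e e') :
    volCoeff Ω e y =
      (fderiv ℝ (transition e e') y).det * volCoeff Ω e' (transition e e' y) := by
  rw [volCoeff, inChart_transition Ω he he' hy, toGrassmann_comp, ← map_pow, berezin_map,
    det_modelMatrix, volCoeff]

theorem continuousOn_volCoeff [IsManifold 𝓘(ℝ, Model D) ∞ Γ] {Ω : Form D Γ 2}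
    (hΩ : IsSmoothForm Ω) (he : e ∈ IsManifold.maximalAtlas 𝓘(ℝ, Model D) ∞ Γ) :
    ContinuousOn (volCoeff Ω e) e.target :=
  ((hΩ.contDiffOn he).toGrassmann.pow D).berezin.continuousOn

/-- The density of the superspace function `G` with respect to the Liouville measure. -/
def liouvilleDensity (Ω : Form D Γ 2) (G : Γ → Grassmann D) (x : Γ) : ℝ :=
  berezin D (G x) / volAt Ω x

/-- A superspace function which transforms under changes of coordinates as it should. -/
def IsTensorial (F : OpenPartialHomeomorph Γ (Model D) → Model D → Grassmann D)
    (G : Γ → Grassmann D) : Prop := ∀ e y, F e y = chartSubst e y (G (e.symm y))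

variable {F : OpenPartialHomeomorph Γ (Model D) → Model D → Grassmann D} {G : Γ → Grassmann D}

/-- The numerator and the denominator of the Liouville density are multiplied by the same
determinant. Nondegeneracy is needed only to cancel `volAt`; even a vanishing chart determinant is
harmless. -/
theorem IsTensorial.volCoeff_mul (hF : IsTensorial F G) {Ω : Form D Γ 2} (hΩ : IsNondegenerate Ω)
    (e : OpenPartialHomeomorph Γ (Model D)) (y : Model D) :
    volCoeff Ω e y * liouvilleDensity Ω G (e.symm y) = berezin D (F e y) := by
  have h1 := volAt_ne_zero hΩ (e.symm y)
  rw [volCoeff_eq, liouvilleDensity, hF e y, berezin_chartSubst]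
  field_simp

/-- The orientation sign turns the volume coefficient into its absolute value: an oriented integral
becomes an integral against a positive measure. -/
theorem IsTensorial.superDensity_eq (hF : IsTensorial F G) {Ω : Form D Γ 2}
    (hΩ : IsNondegenerate Ω) (e : OpenPartialHomeomorph Γ (Model D)) (y : Model D) :
    superDensity Ω F e y = |volCoeff Ω e y| * liouvilleDensity Ω G (e.symm y) := by
  rw [superDensity, orientationSign, super_ofForm, ← hF.volCoeff_mul hΩ, ← mul_assoc]
  congr 1
  change Real.sign (volCoeff Ω e y) * volCoeff Ω e y = _
  rcases lt_trichotomy (volCoeff Ω e y) 0 with h | h | h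
  · rw [Real.sign_of_neg h, abs_of_neg h, neg_one_mul]
  · rw [h, abs_zero, mul_zero]
  · rw [Real.sign_of_pos h, abs_of_pos h, one_mul]

theorem IsTensorial.continuous_liouvilleDensity [IsManifold 𝓘(ℝ, Model D) ∞ Γ]
    (hF : IsTensorial F G) {Ω : Form D Γ 2}
    (hΩ : IsNondegenerate Ω) (hs : IsSmoothForm Ω)
    (hc : ∀ x : Γ, ContinuousOn (fun y ↦ berezin D (F (chartAt (Model D) x) y))
      (chartAt (Model D) x).target) : Continuous (liouvilleDensity Ω G) := by
  rw [continuous_iff_continuousAt]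
  intro x
  set e := chartAt (Model D) x
  have he := chartAt_mem_maximalAtlas (D := D) x
  have h1 : ContinuousOn (fun y ↦ berezin D (F e y) / volCoeff Ω e y) e.target :=
    (hc x).div (continuousOn_volCoeff hs he) fun y hy ↦ volCoeff_ne_zero hΩ he hy
  have h2 := h1.comp e.continuousOn e.mapsTo
  have h3 : ContinuousOn (liouvilleDensity Ω G) e.source := by
    refine h2.congr fun z hz ↦ ?_
    change _ = berezin D (F e (e z)) / volCoeff Ω e (e z)
    rw [← hF.volCoeff_mul hΩ, e.left_inv hz,
      mul_div_cancel_left₀ _ (volCoeff_ne_zero hΩ he (e.map_source hz))]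
  exact h3.continuousAt (e.open_source.mem_nhds (mem_chart_source _ x))

variable [MeasurableSpace Γ] [BorelSpace Γ]

/-- The Liouville measure on the domain of a chart. -/
def chartMeasure (Ω : Form D Γ 2) (e : OpenPartialHomeomorph Γ (Model D)) : Measure Γ :=
  ((volume.restrict e.target).withDensity fun y ↦ ENNReal.ofReal |volCoeff Ω e y|).map e.symm

theorem measurableSet_preimage_symm {s : Set Γ} (hs : MeasurableSet s) :
    MeasurableSet (e.target ∩ e.symm ⁻¹' s) := by
  have h1 : MeasurableSet (e.target.domRestrict e.symm ⁻¹' s) :=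
    (continuousOn_iff_continuous_domRestrict.1 e.continuousOn_symm).measurable hs
  have h2 := e.open_target.measurableSet.subtype_image h1
  convert h2 using 1
  ext y
  simp [and_comm, Set.domRestrict_apply]

theorem aemeasurable_symm (ν : Measure (Model D)) (hν : ν ≪ volume.restrict e.target) :
    AEMeasurable e.symm ν :=
  (e.continuousOn_symm.aemeasurable e.open_target.measurableSet).mono_ac hν

theorem chartMeasure_apply (Ω : Form D Γ 2) {s : Set Γ} (hs : MeasurableSet s) :
    chartMeasure Ω e s =
      ∫⁻ y in e.target ∩ e.symm ⁻¹' s, ENNReal.ofReal |volCoeff Ω e y| := by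
  rw [chartMeasure, Measure.map_apply_of_aemeasurable
    (aemeasurable_symm _ (withDensity_absolutelyContinuous _ _)) hs, withDensity_apply',
    Measure.restrict_restrict' e.open_target.measurableSet, inter_comm]

theorem chartMeasure_restrict (Ω : Form D Γ 2) {s : Set Γ} (hs : MeasurableSet s) :
    (chartMeasure Ω e).restrict s = ((volume.restrict (e.target ∩ e.symm ⁻¹' s)).withDensity
      fun y ↦ ENNReal.ofReal |volCoeff Ω e y|).map e.symm := by
  rw [chartMeasure, Measure.restrict_map_of_aemeasurable
    (aemeasurable_symm _ (withDensity_absolutelyContinuous _ _)) hs, restrict_withDensity',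
    Measure.restrict_restrict' e.open_target.measurableSet, inter_comm]

/-- The change of variables formula: the Jacobian of the transition map is the ratio of the two
volume coefficients. -/
theorem chartMeasure_eq_of_subset (Ω : Form D Γ 2)
    (he : e ∈ IsManifold.maximalAtlas 𝓘(ℝ, Model D) ∞ Γ)
    (he' : e' ∈ IsManifold.maximalAtlas 𝓘(ℝ, Model D) ∞ Γ) {s : Set Γ} (hs : MeasurableSet s)
    (h : s ⊆ e.source) (h' : s ⊆ e'.source) : chartMeasure Ω e s = chartMeasure Ω e' s := by
  have hA : e.target ∩ e.symm ⁻¹' s ⊆ transitionDomain e e' := fun y hy ↦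
    mem_transitionDomain.2 ⟨hy.1, h' hy.2⟩
  have himage : e'.target ∩ e'.symm ⁻¹' s = transition e e' '' (e.target ∩ e.symm ⁻¹' s) := by
    ext z
    constructor
    · rintro ⟨hz, hzs⟩
      refine ⟨e (e'.symm z), ⟨e.map_source (h hzs), ?_⟩, ?_⟩
      · rw [mem_preimage, e.left_inv (h hzs)]; exact hzs
      · simp only [transition, Function.comp_apply, e.left_inv (h hzs), e'.right_inv hz]
    · rintro ⟨y, hy, rfl⟩
      refine ⟨transition_mem_target (hA hy), ?_⟩
      rw [mem_preimage, symm_transition (hA hy)]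
      exact hy.2
  have hinj : InjOn (transition e e') (e.target ∩ e.symm ⁻¹' s) := by
    intro y hy z hz hyz
    have := congrArg e'.symm hyz
    rw [symm_transition (hA hy), symm_transition (hA hz)] at this
    exact e.symm.injOn hy.1 hz.1 this
  rw [chartMeasure_apply Ω hs, chartMeasure_apply Ω hs, himage,
    lintegral_image_eq_lintegral_abs_det_fderiv_mul volume (measurableSet_preimage_symm hs)
      (f' := fderiv ℝ (transition e e')) (fun y hy ↦ ((contDiffAt_transition he he'
        (hA hy)).differentiableAt (by simp)).hasFDerivAt.hasFDerivWithinAt) hinj]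
  refine setLIntegral_congr_fun (measurableSet_preimage_symm hs) fun y hy ↦ ?_
  rw [volCoeff_transition Ω he he' (hA hy), abs_mul, ENNReal.ofReal_mul (abs_nonneg _)]

theorem chartMeasure_inter_source (Ω : Form D Γ 2) {s : Set Γ} (hs : MeasurableSet s) :
    chartMeasure Ω e (s ∩ e.source) = chartMeasure Ω e s := by
  rw [chartMeasure_apply Ω hs, chartMeasure_apply Ω (hs.inter e.open_source.measurableSet)]
  congr 2
  ext y
  simp only [mem_inter_iff, mem_preimage]
  exact ⟨fun h ↦ ⟨h.1, h.2.1⟩, fun h ↦ ⟨h.1, h.2, e.map_target h.1⟩⟩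

theorem chartMeasure_restrict_source (Ω : Form D Γ 2)
    (he : e ∈ IsManifold.maximalAtlas 𝓘(ℝ, Model D) ∞ Γ)
    (he' : e' ∈ IsManifold.maximalAtlas 𝓘(ℝ, Model D) ∞ Γ) :
    (chartMeasure Ω e).restrict e'.source = (chartMeasure Ω e').restrict e.source := by
  ext s hs
  have h1 := e.open_source.measurableSet
  have h2 := e'.open_source.measurableSet
  rw [Measure.restrict_apply hs, Measure.restrict_apply hs,
    ← chartMeasure_inter_source Ω (hs.inter h2), ← chartMeasure_inter_source Ω (hs.inter h1),
    inter_right_comm]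
  exact chartMeasure_eq_of_subset Ω he he' ((hs.inter h1).inter h2) (fun _ h ↦ h.1.2)
    fun _ h ↦ h.2

/-- The `i`-th cell of a chart cover, as a subset of the manifold. -/
def ChartCover.piece (c : ChartCover D Γ) (i : ℕ) : Set Γ :=
  {x ∈ (c.chart i).source | ∀ j < i, x ∉ (c.chart j).source}

theorem ChartCover.measurableSet_piece (c : ChartCover D Γ) (i : ℕ) :
    MeasurableSet (c.piece i) := by
  have h : c.piece i = (c.chart i).source ∩ ⋂ j, ⋂ (_ : j < i), ((c.chart j).source)ᶜ := by
    ext x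
    simp [ChartCover.piece]
  rw [h]
  exact (c.chart i).open_source.measurableSet.inter (MeasurableSet.iInter fun j ↦
    MeasurableSet.iInter fun _ ↦ (c.chart j).open_source.measurableSet.compl)

theorem ChartCover.disjoint_piece (c : ChartCover D Γ) :
    Pairwise (Function.onFun Disjoint c.piece) := by
  have key : ∀ i j, i < j → Disjoint (c.piece i) (c.piece j) := fun i j hij ↦
    Set.disjoint_left.2 fun x hi hj ↦ hj.2 i hij hi.1
  intro i j hij
  rcases lt_or_gt_of_ne hij with h | h
  · exact key i j h
  · exact (key j i h).symm

theorem ChartCover.iUnion_piece (c : ChartCover D Γ) : ⋃ i, c.piece i = univ := by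
  classical
  refine eq_univ_of_forall fun x ↦ mem_iUnion.2 ⟨Nat.find (c.cover x), Nat.find_spec (c.cover x),
    fun j hj ↦ Nat.find_min (c.cover x) hj⟩

theorem ChartCover.sum_restrict_piece (c : ChartCover D Γ) (ν : Measure Γ) :
    Measure.sum (fun i ↦ ν.restrict (c.piece i)) = ν := by
  rw [← Measure.restrict_iUnion c.disjoint_piece c.measurableSet_piece, c.iUnion_piece,
    Measure.restrict_univ]

theorem ChartCover.cell_eq (c : ChartCover D Γ) (i : ℕ) :
    c.cell i = (c.chart i).target ∩ (c.chart i).symm ⁻¹' c.piece i := by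
  ext y
  constructor
  · exact fun h ↦ ⟨h.1, (c.chart i).map_target h.1, h.2⟩
  · exact fun h ↦ ⟨h.1, h.2.2⟩

/-- The Liouville measure, computed with a chart cover. -/
def liouville (Ω : Form D Γ 2) (c : ChartCover D Γ) : Measure Γ :=
  Measure.sum fun i ↦ (chartMeasure Ω (c.chart i)).restrict (c.piece i)

/-- On overlaps the chart measures agree, so each piece of the cover may be measured in the chart
`e` instead. This determines the measure locally without reference to the cover. -/
theorem liouville_restrict_source (Ω : Form D Γ 2) (c : ChartCover D Γ)
    (he : e ∈ IsManifold.maximalAtlas 𝓘(ℝ, Model D) ∞ Γ) :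
    (liouville Ω c).restrict e.source = chartMeasure Ω e := by
  conv_rhs => rw [← c.sum_restrict_piece (chartMeasure Ω e)]
  rw [liouville, Measure.restrict_sum _ e.open_source.measurableSet]
  congr 1
  ext1 i
  have h : ∀ ν : Measure Γ, (ν.restrict (c.chart i).source).restrict (c.piece i) =
      ν.restrict (c.piece i) := fun ν ↦
    Measure.restrict_restrict_of_subset fun x hx ↦ hx.1
  rw [Measure.restrict_comm e.open_source.measurableSet,
    chartMeasure_restrict_source Ω (c.mem_maximalAtlas i) he, h]

theorem liouville_eq (Ω : Form D Γ 2) (c c' : ChartCover D Γ) : liouville Ω c = liouville Ω c' := by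
  rw [← c'.sum_restrict_piece (liouville Ω c)]
  conv_rhs => rw [liouville]
  congr 1
  ext1 i
  have h : ((liouville Ω c).restrict (c'.chart i).source).restrict (c'.piece i) =
      (liouville Ω c).restrict (c'.piece i) :=
    Measure.restrict_restrict_of_subset fun x hx ↦ hx.1
  rw [← h, liouville_restrict_source Ω c (c'.mem_maximalAtlas i)]

variable [IsManifold 𝓘(ℝ, Model D) ∞ Γ]

theorem aemeasurable_volCoeff {Ω : Form D Γ 2} (hΩ : IsSmoothForm Ω)
    (he : e ∈ IsManifold.maximalAtlas 𝓘(ℝ, Model D) ∞ Γ) (s : Set (Model D)) (hs : s ⊆ e.target) :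
    AEMeasurable (fun y ↦ ENNReal.ofReal |volCoeff Ω e y|) (volume.restrict s) := by
  have h1 : AEMeasurable (fun y ↦ |volCoeff Ω e y|) (volume.restrict e.target) :=
    (continuousOn_volCoeff hΩ he).abs.aemeasurable e.open_target.measurableSet
  exact (h1.mono_measure (Measure.restrict_mono hs le_rfl)).ennreal_ofReal

theorem setIntegral_chartMeasure {Ω : Form D Γ 2} (hΩ : IsSmoothForm Ω)
    (he : e ∈ IsManifold.maximalAtlas 𝓘(ℝ, Model D) ∞ Γ) {s : Set Γ} (hs : MeasurableSet s)
    {f : Γ → ℝ} (hf : StronglyMeasurable f) :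
    ∫ x in s, f x ∂chartMeasure Ω e =
      ∫ y in e.target ∩ e.symm ⁻¹' s, |volCoeff Ω e y| * f (e.symm y) := by
  have hac : (volume.restrict (e.target ∩ e.symm ⁻¹' s)).withDensity
      (fun y ↦ ENNReal.ofReal |volCoeff Ω e y|) ≪ volume.restrict e.target :=
    (withDensity_absolutelyContinuous _ _).trans
      (Measure.restrict_mono inter_subset_left le_rfl).absolutelyContinuous
  rw [chartMeasure_restrict Ω hs, integral_map (aemeasurable_symm _ hac) hf.aestronglyMeasurable,
    integral_withDensity_eq_integral_toReal_smul₀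
      (aemeasurable_volCoeff hΩ he _ inter_subset_left) (by simp)]
  simp only [ENNReal.toReal_ofReal (abs_nonneg _), smul_eq_mul]

theorem integrableOn_chartMeasure {Ω : Form D Γ 2} (hΩ : IsSmoothForm Ω)
    (he : e ∈ IsManifold.maximalAtlas 𝓘(ℝ, Model D) ∞ Γ) {s : Set Γ} (hs : MeasurableSet s)
    {f : Γ → ℝ} (hf : StronglyMeasurable f) :
    IntegrableOn f s (chartMeasure Ω e) ↔
      IntegrableOn (fun y ↦ |volCoeff Ω e y| * f (e.symm y)) (e.target ∩ e.symm ⁻¹' s) := by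
  have hac : (volume.restrict (e.target ∩ e.symm ⁻¹' s)).withDensity
      (fun y ↦ ENNReal.ofReal |volCoeff Ω e y|) ≪ volume.restrict e.target :=
    (withDensity_absolutelyContinuous _ _).trans
      (Measure.restrict_mono inter_subset_left le_rfl).absolutelyContinuous
  rw [IntegrableOn, chartMeasure_restrict Ω hs,
    integrable_map_measure hf.aestronglyMeasurable (aemeasurable_symm _ hac),
    integrable_withDensity_iff_integrable_smul₀'
      (aemeasurable_volCoeff hΩ he _ inter_subset_left) (by simp), IntegrableOn]
  simp only [ENNReal.toReal_ofReal (abs_nonneg _), smul_eq_mul, Function.comp_apply]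

/-- In the coordinates of its chart, each piece of the cover is the corresponding cell.
Integrability against the sum of the restricted measures is integrability on every piece together
with summable integrals of the absolute value, which is the definition of absolute convergence. -/
theorem IsTensorial.superIntegrable_iff (hF : IsTensorial F G) {Ω : Form D Γ 2}
    (hΩ : IsNondegenerate Ω) (hs : IsSmoothForm Ω) (c : ChartCover D Γ)
    (hc : StronglyMeasurable (liouvilleDensity Ω G)) :
    SuperIntegrable Ω c F ↔ Integrable (liouvilleDensity Ω G) (liouville Ω c) := by
  have h1 : ∀ i, superDensity Ω F (c.chart i) = fun y ↦
      |volCoeff Ω (c.chart i) y| * liouvilleDensity Ω G ((c.chart i).symm y) := fun i ↦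
    funext fun y ↦ hF.superDensity_eq hΩ _ y
  rw [SuperIntegrable, liouville, integrable_sum_measure_iff]
  refine and_congr (forall_congr' fun i ↦ ?_) ?_
  · rw [c.cell_eq, h1]
    exact (integrableOn_chartMeasure hs (c.mem_maximalAtlas i) (c.measurableSet_piece i) hc).symm
  · have h2 : ∀ i, ∫ x in c.piece i, ‖liouvilleDensity Ω G x‖ ∂chartMeasure Ω (c.chart i) =
        ∫ y in c.cell i, |superDensity Ω F (c.chart i) y| := by
      intro i
      rw [setIntegral_chartMeasure hs (c.mem_maximalAtlas i) (c.measurableSet_piece i) hc.norm,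
        ← c.cell_eq]
      simp only [h1, abs_mul, abs_abs, Real.norm_eq_abs]
    simp only [h2]

theorem IsTensorial.superIntegral_eq (hF : IsTensorial F G) {Ω : Form D Γ 2}
    (hΩ : IsNondegenerate Ω) (hs : IsSmoothForm Ω) (c : ChartCover D Γ)
    (hc : StronglyMeasurable (liouvilleDensity Ω G))
    (hi : Integrable (liouvilleDensity Ω G) (liouville Ω c)) :
    superIntegral Ω c F = ∫ x, liouvilleDensity Ω G x ∂liouville Ω c := by
  have h1 : ∀ i, superDensity Ω F (c.chart i) = fun y ↦
      |volCoeff Ω (c.chart i) y| * liouvilleDensity Ω G ((c.chart i).symm y) := fun i ↦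
    funext fun y ↦ hF.superDensity_eq hΩ _ y
  conv_rhs => rw [liouville]
  rw [superIntegral, integral_sum_measure hi]
  congr 1
  ext1 i
  rw [setIntegral_chartMeasure hs (c.mem_maximalAtlas i) (c.measurableSet_piece i) hc, ← c.cell_eq,
    h1]

/-- The volume coefficient is continuous, hence integrable over a compact coordinate neighbourhood.
This makes compactly supported continuous densities integrable. -/
theorem isLocallyFiniteMeasure_liouville {Ω : Form D Γ 2} (hs : IsSmoothForm Ω)
    (c : ChartCover D Γ) : IsLocallyFiniteMeasure (liouville Ω c) := by
  refine ⟨fun x ↦ ?_⟩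
  set e := chartAt (Model D) x
  have he := chartAt_mem_maximalAtlas (D := D) x
  have hx := mem_chart_source (Model D) x
  obtain ⟨K, hK, hxK, hKt⟩ := exists_compact_subset e.open_target (e.map_source hx)
  refine ⟨e.source ∩ e ⁻¹' (_root_.interior K), ?_, ?_⟩
  · exact (e.isOpen_inter_preimage isOpen_interior).mem_nhds ⟨hx, hxK⟩
  · have hm : MeasurableSet (e.source ∩ e ⁻¹' (_root_.interior K)) :=
      (e.isOpen_inter_preimage isOpen_interior).measurableSet
    have h1 : liouville Ω c (e.source ∩ e ⁻¹' (_root_.interior K)) =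
        chartMeasure Ω e (e.source ∩ e ⁻¹' (_root_.interior K)) := by
      rw [← liouville_restrict_source Ω c he, Measure.restrict_apply hm,
        inter_eq_left.2 inter_subset_left]
    rw [h1, chartMeasure_apply Ω hm]
    have hsub : e.target ∩ e.symm ⁻¹' (e.source ∩ e ⁻¹' (_root_.interior K)) ⊆ K := by
      rintro y ⟨hy, _, hy2⟩
      rw [mem_preimage, e.right_inv hy] at hy2
      exact interior_subset hy2
    refine (lintegral_mono_set hsub).trans_lt ?_
    have h2 : IntegrableOn (fun y ↦ |volCoeff Ω e y|) K :=
      ((continuousOn_volCoeff hs he).abs.mono hKt).integrableOn_compact hK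
    exact h2.lintegral_lt_top

end Liouville

/-! ### Integrals over an open subset of the model space -/

section Euclidean

variable {D : ℕ} {U : Set (Model D)} {R : Model D → ℝ}

theorem contDiff_mul_of_tsupport_subset (hU : IsOpen U) (hR : ContDiff ℝ ∞ R)
    (hRU : tsupport R ⊆ U) {f : Model D → ℝ} (hf : ContDiffOn ℝ ∞ f U) :
    ContDiff ℝ ∞ (fun y ↦ R y * f y) := by
  rw [contDiff_iff_contDiffAt]
  intro y
  by_cases hy : y ∈ tsupport R
  · exact hR.contDiffAt.mul (hf.contDiffAt (hU.mem_nhds (hRU hy)))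
  · refine contDiffAt_const (c := (0 : ℝ)).congr_of_eventuallyEq ?_
    filter_upwards [(isClosed_tsupport R).isOpen_compl.mem_nhds hy] with z hz
    rw [image_eq_zero_of_notMem_tsupport hz, zero_mul]

/-- Integration by parts. -/
theorem integral_mul_sum_fderiv (hU : IsOpen U) (hR : ContDiff ℝ ∞ R)
    (hRc : HasCompactSupport R) (hRU : tsupport R ⊆ U) {V : Fin (2 * D) → Model D → ℝ}
    (hV : ∀ μ, ContDiffOn ℝ ∞ (V μ) U) :
    ∫ y, R y * ∑ μ, fderiv ℝ (V μ) y (stdVec μ) =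
      -∫ y, ∑ μ, fderiv ℝ R y (stdVec μ) * V μ y := by
  have hInt : ∀ μ, Integrable fun y ↦ R y * fderiv ℝ (V μ) y (stdVec μ) := by
    intro μ
    have hV' : ContDiffOn ℝ ∞ (fun y ↦ fderiv ℝ (V μ) y (stdVec μ)) U :=
      ((hV μ).fderiv_of_isOpen hU (by simp)).clm_apply contDiffOn_const
    exact (contDiff_mul_of_tsupport_subset hU hR hRU
      hV').continuous.integrable_of_hasCompactSupport hRc.mul_right
  have hInt' : ∀ μ, Integrable fun y ↦ fderiv ℝ R y (stdVec μ) * V μ y := by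
    intro μ
    have hR' : ContDiff ℝ ∞ fun y ↦ fderiv ℝ R y (stdVec μ) :=
      (hR.fderiv_right (m := ∞) (by simp)).clm_apply contDiff_const
    refine Continuous.integrable_of_hasCompactSupport (contDiff_mul_of_tsupport_subset hU hR'
      ((tsupport_fderiv_apply_subset ℝ _).trans hRU) (hV μ)).continuous ?_
    exact (hRc.fderiv_apply (𝕜 := ℝ) (stdVec μ)).mul_right
  simp only [Finset.mul_sum]
  rw [integral_finsetSum _ fun μ _ ↦ hInt μ, integral_finsetSum _ fun μ _ ↦ hInt' μ,
    ← Finset.sum_neg_distrib]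
  refine Finset.sum_congr rfl fun μ _ ↦ integral_mul_fderiv_eq_neg_fderiv_mul_of_integrable
    (hInt' μ) (hInt μ) ?_ (fun y _ ↦ hR.differentiable (by simp) y) fun y hy ↦
      ((hV μ).contDiffAt (hU.mem_nhds (hRU hy))).differentiableAt (by simp)
  exact (contDiff_mul_of_tsupport_subset hU hR hRU
    (hV μ)).continuous.integrable_of_hasCompactSupport hRc.mul_right

/-- Differentiation under the integral sign. -/
theorem hasDerivAt_integral_mul (hU : IsOpen U) {J : Set ℝ} (hJ : IsOpen J)
    (hR : ContDiff ℝ ∞ R) (hRc : HasCompactSupport R) (hRU : tsupport R ⊆ U)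
    {b b' : ℝ → Model D → ℝ}
    (hb : ContDiffOn ℝ ∞ (fun q : ℝ × Model D ↦ b q.1 q.2) (J ×ˢ U))
    (hb' : ∀ t ∈ J, ∀ y ∈ U, HasDerivAt (fun s ↦ b s y) (b' t y) t) {t : ℝ} (ht : t ∈ J) :
    HasDerivAt (fun s ↦ ∫ y, R y * b s y) (∫ y, R y * b' t y) t := by
  obtain ⟨ε, hε, hball⟩ := Metric.nhds_basis_closedBall.mem_iff.1 (hJ.mem_nhds ht)
  have hslice : ∀ s ∈ J, ContDiffOn ℝ ∞ (b s) U := fun s hs ↦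
    hb.comp (contDiff_const.prodMk contDiff_id).contDiffOn fun y hy ↦ ⟨hs, hy⟩
  -- The time derivative `b'` is the total derivative of `b` in the direction (1, 0), so joint
  -- smoothness makes it jointly continuous.
  have hcont : ContinuousOn (fun q : ℝ × Model D ↦ b' q.1 q.2) (J ×ˢ U) := by
    have h1 : ContinuousOn (fun q : ℝ × Model D ↦
        fderiv ℝ (fun q : ℝ × Model D ↦ b q.1 q.2) q ((1 : ℝ), (0 : Model D))) (J ×ˢ U) :=
      (hb.continuousOn_fderiv_of_isOpen (hJ.prod hU) (by simp)).clm_apply continuousOn_const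
    refine h1.congr fun q hq ↦ ?_
    have h2 : HasFDerivAt (fun q : ℝ × Model D ↦ b q.1 q.2)
        (fderiv ℝ (fun q : ℝ × Model D ↦ b q.1 q.2) q) (q.1, q.2) :=
      ((hb.contDiffAt ((hJ.prod hU).mem_nhds hq)).differentiableAt (by simp)).hasFDerivAt
    have h3 := h2.comp_hasDerivAt q.1 ((hasDerivAt_id q.1).prodMk (hasDerivAt_const q.1 q.2))
    exact (hb' q.1 hq.1 q.2 hq.2).unique h3
  have hslice' : Continuous fun y ↦ R y * b' t y := by
    rw [continuous_iff_continuousAt]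
    intro y
    by_cases hy : y ∈ tsupport R
    · have h1 : ContinuousOn (b' t) U :=
        hcont.comp (continuous_const.prodMk continuous_id).continuousOn fun y hy ↦ ⟨ht, hy⟩
      exact hR.continuous.continuousAt.mul (h1.continuousAt (hU.mem_nhds (hRU hy)))
    · refine continuousAt_const (y := (0 : ℝ)).congr ?_
      filter_upwards [(isClosed_tsupport R).isOpen_compl.mem_nhds hy] with z hz
      rw [image_eq_zero_of_notMem_tsupport hz, zero_mul]
  -- The product of a closed time interval and the support of `R` is compact, so C |R| dominates the
  -- derivative.
  obtain ⟨C, hC⟩ := ((isCompact_closedBall t ε).prod hRc).exists_bound_of_continuousOn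
    (hcont.mono (prod_mono hball hRU))
  refine (hasDerivAt_integral_of_dominated_loc_of_deriv_le (bound := fun y ↦ |R y| * C)
    (F := fun s y ↦ R y * b s y) (F' := fun s y ↦ R y * b' s y)
    (Metric.closedBall_mem_nhds t hε) ?_ ?_ hslice'.aestronglyMeasurable ?_ ?_ ?_).2
  · filter_upwards [hJ.mem_nhds ht] with s hs
    exact (contDiff_mul_of_tsupport_subset hU hR hRU (hslice s hs)).continuous.aestronglyMeasurable
  · exact (contDiff_mul_of_tsupport_subset hU hR hRU
      (hslice t ht)).continuous.integrable_of_hasCompactSupport hRc.mul_right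
  · refine ae_of_all _ fun y s hs ↦ ?_
    rw [norm_mul, Real.norm_eq_abs]
    by_cases hy : y ∈ tsupport R
    · exact mul_le_mul_of_nonneg_left (hC (s, y) ⟨hs, hy⟩) (abs_nonneg _)
    · rw [image_eq_zero_of_notMem_tsupport hy]
      simp
  · exact (hR.continuous.abs.integrable_of_hasCompactSupport hRc.norm).mul_const C
  · refine ae_of_all _ fun y s hs ↦ ?_
    by_cases hy : y ∈ tsupport R
    · exact (hb' s (hball hs) y (hRU hy)).const_mul (R y)
    · rw [image_eq_zero_of_notMem_tsupport hy]
      simpa using hasDerivAt_const s (0 : ℝ)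

end Euclidean

/-! ### The action and the flux as densities -/

section Densities

variable {D k : ℕ} {Γ : Type*} [TopologicalSpace Γ] [ChartedSpace (Model D) Γ]
  {e : OpenPartialHomeomorph Γ (Model D)} {y : Model D} {x : Γ}

/-- An inhomogeneous form as an element of the Grassmann algebra of the tangent space. -/
def PolyForm.superAt (P : PolyForm D Γ) (x : Γ) : Grassmann D :=
  ∑ k ∈ Finset.range (2 * D + 1), toGrassmann (P k x)

theorem isTensorial_super (P : PolyForm D Γ) : IsTensorial P.super P.superAt := fun e y ↦ by
  rw [PolyForm.super, PolyForm.superAt, map_sum]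
  exact Finset.sum_congr rfl fun k _ ↦ toGrassmann_inChart (P k) e y

theorem isTensorial_expAction (P : PolyForm D Γ) :
    IsTensorial (expAction P) fun x ↦ gexp (P.superAt x) := fun e y ↦ by
  rw [expAction, isTensorial_super P e y]
  exact gexp_map _ _

variable {F F' : OpenPartialHomeomorph Γ (Model D) → Model D → Grassmann D}
  {G G' : Γ → Grassmann D}

theorem IsTensorial.mul (h : IsTensorial F G) (h' : IsTensorial F' G') :
    IsTensorial (fun e y ↦ F e y * F' e y) fun x ↦ G x * G' x := fun e y ↦ by
  simp only [h e y, h' e y, map_mul]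

theorem IsTensorial.smul (h : IsTensorial F G) (ρ : Γ → ℝ) :
    IsTensorial (fun e y ↦ ρ (e.symm y) • F e y) fun x ↦ ρ x • G x := fun e y ↦ by
  simp only [h e y, map_smul]

/-- The integrand of the flux through the cutoff `ρ`. -/
def fluxAction (ρ : Γ → ℝ) (ψ : Form D Γ 1) (P : PolyForm D Γ)
    (e : OpenPartialHomeomorph Γ (Model D)) (y : Model D) : Grassmann D :=
  (ofFun ρ : PolyForm D Γ).d.super e y * (ofForm 1 ψ).super e y * expAction P e y

/-- The density of `e^S` with respect to the Liouville measure. -/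
def actionDensity (Ω : Form D Γ 2) (P : PolyForm D Γ) : Γ → ℝ :=
  liouvilleDensity Ω fun x ↦ gexp (P.superAt x)

/-- The density of the flux with respect to the Liouville measure. -/
def fluxDensity (Ω : Form D Γ 2) (ρ : Γ → ℝ) (ψ : Form D Γ 1) (P : PolyForm D Γ) : Γ → ℝ :=
  liouvilleDensity Ω fun x ↦
    (ofFun ρ : PolyForm D Γ).d.superAt x * (ofForm 1 ψ).superAt x * gexp (P.superAt x)

theorem isTensorial_fluxAction (ρ : Γ → ℝ) (ψ : Form D Γ 1) (P : PolyForm D Γ) :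
    IsTensorial (fluxAction ρ ψ P) fun x ↦
      (ofFun ρ : PolyForm D Γ).d.superAt x * (ofForm 1 ψ).superAt x * gexp (P.superAt x) :=
  ((isTensorial_super _).mul (isTensorial_super _)).mul (isTensorial_expAction P)

theorem expAction_eq (H : Γ → ℝ) (Ω : Form D Γ 2) (e : OpenPartialHomeomorph Γ (Model D))
    (y : Model D) : expAction (ofFun H + ofForm 2 Ω) e y =
      weight (H (e.symm y)) (toGrassmann (Ω.inChart e y)) := by
  rw [expAction, super_add, ofFun_eq, super_ofForm, super_ofForm, toGrassmann_degree_zero]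
  exact gexp_eq _ (toGrassmann_mem _)

variable [IsManifold 𝓘(ℝ, Model D) ∞ Γ]

theorem contDiffOn_comp_symm {ρ : Γ → ℝ} (hρ : ContMDiff 𝓘(ℝ, Model D) 𝓘(ℝ, ℝ) ∞ ρ)
    (he : e ∈ IsManifold.maximalAtlas 𝓘(ℝ, Model D) ∞ Γ) : ContDiffOn ℝ ∞ (ρ ∘ e.symm) e.target := by
  rw [← contMDiffOn_iff_contDiffOn]
  exact hρ.comp_contMDiffOn (contMDiffOn_symm_of_mem_maximalAtlas he)

theorem contDiffOn_expAction {H : Γ → ℝ} {Ω : Form D Γ 2}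
    (hH : ContMDiff 𝓘(ℝ, Model D) 𝓘(ℝ, ℝ) ∞ H) (hΩ : IsSmoothForm Ω)
    (he : e ∈ IsManifold.maximalAtlas 𝓘(ℝ, Model D) ∞ Γ) :
    ContDiffOn ℝ ∞ (expAction (ofFun H + ofForm 2 Ω) e) e.target :=
  ((contDiffOn_comp_symm hH he).weight (hΩ.contDiffOn he).toGrassmann).congr fun y _ ↦
    expAction_eq H Ω e y

theorem super_d_ofFun (ρ : Γ → ℝ) (e : OpenPartialHomeomorph Γ (Model D)) (y : Model D) :
    (ofFun ρ : PolyForm D Γ).d.super e y = toGrassmann ((constForm D ρ).d.inChart e y) := by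
  rw [ofFun_eq, polyForm_d_ofForm, super_ofForm]

theorem contDiffOn_fluxAction {ρ H : Γ → ℝ} {ψ : Form D Γ 1} {Ω : Form D Γ 2}
    (hρ : ContMDiff 𝓘(ℝ, Model D) 𝓘(ℝ, ℝ) ∞ ρ) (hψ : IsSmoothForm ψ)
    (hH : ContMDiff 𝓘(ℝ, Model D) 𝓘(ℝ, ℝ) ∞ H) (hΩ : IsSmoothForm Ω)
    (he : e ∈ IsManifold.maximalAtlas 𝓘(ℝ, Model D) ∞ Γ) :
    ContDiffOn ℝ ∞ (fluxAction ρ ψ (ofFun H + ofForm 2 Ω) e) e.target := by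
  refine (((((contMDiff_iff_isSmoothForm.1 hρ).d.contDiffOn he).toGrassmann).mul
    (hψ.contDiffOn he).toGrassmann).mul (contDiffOn_expAction hH hΩ he)).congr fun y _ ↦ ?_
  rw [fluxAction, super_d_ofFun, super_ofForm]

/-- The flux in a chart, in terms of the current. -/
theorem berezin_fluxAction {ρ H : Γ → ℝ} {ψ : Form D Γ 1} {Ω : Form D Γ 2}
    (hρ : ContMDiff 𝓘(ℝ, Model D) 𝓘(ℝ, ℝ) ∞ ρ)
    (he : e ∈ IsManifold.maximalAtlas 𝓘(ℝ, Model D) ∞ Γ) (hy : y ∈ e.target) :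
    berezin D (fluxAction ρ ψ (ofFun H + ofForm 2 Ω) e y) =
      ∑ μ, fderiv ℝ (ρ ∘ e.symm) y (stdVec μ) *
        current (H ∘ e.symm) (Ω.inChart e) (ψ.inChart e) μ y := by
  rw [fluxAction, super_d_ofFun, super_ofForm, expAction_eq, toGrassmann_degree_one, mul_assoc,
    Finset.sum_mul, map_sum]
  refine Finset.sum_congr rfl fun μ _ ↦ ?_
  rw [inChart_d_constForm (contMDiff_iff_isSmoothForm.1 hρ) he hy, smul_mul_assoc, map_smul,
    smul_eq_mul]
  rfl

theorem continuous_actionDensity {Ω₀ : Form D Γ 2} (h₀ : IsNondegenerate Ω₀)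
    (hs : IsSmoothForm Ω₀) {H : Γ → ℝ} {Ω : Form D Γ 2}
    (hH : ContMDiff 𝓘(ℝ, Model D) 𝓘(ℝ, ℝ) ∞ H) (hΩ : IsSmoothForm Ω) :
    Continuous (actionDensity Ω₀ (ofFun H + ofForm 2 Ω)) :=
  (isTensorial_expAction _).continuous_liouvilleDensity h₀ hs fun x ↦
    (contDiffOn_expAction hH hΩ (chartAt_mem_maximalAtlas x)).berezin.continuousOn

theorem continuous_fluxDensity {Ω₀ : Form D Γ 2} (h₀ : IsNondegenerate Ω₀)
    (hs : IsSmoothForm Ω₀) {ρ H : Γ → ℝ} {ψ : Form D Γ 1} {Ω : Form D Γ 2}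
    (hρ : ContMDiff 𝓘(ℝ, Model D) 𝓘(ℝ, ℝ) ∞ ρ) (hψ : IsSmoothForm ψ)
    (hH : ContMDiff 𝓘(ℝ, Model D) 𝓘(ℝ, ℝ) ∞ H) (hΩ : IsSmoothForm Ω) :
    Continuous (fluxDensity Ω₀ ρ ψ (ofFun H + ofForm 2 Ω)) :=
  (isTensorial_fluxAction _ _ _).continuous_liouvilleDensity h₀ hs fun x ↦
    (contDiffOn_fluxAction hρ hψ hH hΩ (chartAt_mem_maximalAtlas x)).berezin.continuousOn

theorem superAt_d_add {ρ₁ ρ₂ : Γ → ℝ} (h₁ : ContMDiff 𝓘(ℝ, Model D) 𝓘(ℝ, ℝ) ∞ ρ₁)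
    (h₂ : ContMDiff 𝓘(ℝ, Model D) 𝓘(ℝ, ℝ) ∞ ρ₂) (x : Γ) :
    (ofFun (ρ₁ + ρ₂) : PolyForm D Γ).d.superAt x =
      (ofFun ρ₁ : PolyForm D Γ).d.superAt x + (ofFun ρ₂ : PolyForm D Γ).d.superAt x := by
  have h3 : (ofFun (ρ₁ + ρ₂) : PolyForm D Γ) = ofFun ρ₁ + ofFun ρ₂ := by
    rw [ofFun_eq, ofFun_eq, ofFun_eq, ← ofForm_add]
    rfl
  rw [h3, ofFun_eq, ofFun_eq, polyForm_d_add (contMDiff_iff_isSmoothForm.1 h₁).ofForm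
    (contMDiff_iff_isSmoothForm.1 h₂).ofForm, PolyForm.superAt, PolyForm.superAt, PolyForm.superAt,
    ← Finset.sum_add_distrib]
  exact Finset.sum_congr rfl fun k _ ↦ (toGrassmannₗ D k).map_add _ _

theorem superAt_d_eq_zero {ρ : Γ → ℝ} (h : ContMDiff 𝓘(ℝ, Model D) 𝓘(ℝ, ℝ) ∞ ρ) {c : ℝ}
    (hx : ρ =ᶠ[𝓝 x] fun _ ↦ c) : (ofFun ρ : PolyForm D Γ).d.superAt x = 0 := by
  have h1 : (constForm D ρ).d x = 0 := by
    ext v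
    have hv : v = ![v 0] := by
      ext1 i
      rw [Fin.fin_one_eq_zero i]
      rfl
    rw [hv, d_constForm_apply (contMDiff_iff_isSmoothForm.1 h), hx.mfderiv_eq, mfderiv_const]
    rfl
  refine Finset.sum_eq_zero fun k _ ↦ ?_
  rw [ofFun_eq, polyForm_d_ofForm]
  rcases eq_or_ne k 1 with rfl | hk
  · rw [ofForm_same, h1, toGrassmann_zero]
  · rw [ofForm_ne hk, Pi.zero_apply, toGrassmann_zero]

/-- The flux involves the cutoff only through its differential, so it vanishes wherever the cutoff
is locally constant, in particular off its support. -/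
theorem fluxDensity_eq_zero {Ω : Form D Γ 2} {ρ : Γ → ℝ} {ψ : Form D Γ 1} {P : PolyForm D Γ}
    (h : ContMDiff 𝓘(ℝ, Model D) 𝓘(ℝ, ℝ) ∞ ρ) {c : ℝ}
    (hx : ρ =ᶠ[𝓝 x] fun _ ↦ c) : fluxDensity Ω ρ ψ P x = 0 := by
  rw [fluxDensity, liouvilleDensity, superAt_d_eq_zero h hx, zero_mul, zero_mul, map_zero, zero_div]

theorem fluxDensity_eq_zero_of_notMem {Ω : Form D Γ 2} {ρ : Γ → ℝ} {ψ : Form D Γ 1}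
    {P : PolyForm D Γ} (h : ContMDiff 𝓘(ℝ, Model D) 𝓘(ℝ, ℝ) ∞ ρ) (hx : x ∉ tsupport ρ) :
    fluxDensity Ω ρ ψ P x = 0 := by
  refine fluxDensity_eq_zero h (c := 0) ?_
  filter_upwards [(isClosed_tsupport ρ).isOpen_compl.mem_nhds hx] with z hz
  exact image_eq_zero_of_notMem_tsupport hz

theorem fluxDensity_add {Ω : Form D Γ 2} {ρ₁ ρ₂ : Γ → ℝ} {ψ : Form D Γ 1} {P : PolyForm D Γ}
    (h₁ : ContMDiff 𝓘(ℝ, Model D) 𝓘(ℝ, ℝ) ∞ ρ₁) (h₂ : ContMDiff 𝓘(ℝ, Model D) 𝓘(ℝ, ℝ) ∞ ρ₂) :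
    fluxDensity Ω (ρ₁ + ρ₂) ψ P = fluxDensity Ω ρ₁ ψ P + fluxDensity Ω ρ₂ ψ P := by
  funext x
  rw [Pi.add_apply, fluxDensity, fluxDensity, fluxDensity, liouvilleDensity, liouvilleDensity,
    liouvilleDensity, superAt_d_add h₁ h₂, add_mul, add_mul, map_add, add_div]

variable [MeasurableSpace Γ] [BorelSpace Γ]

/-- A density that vanishes outside of a chart is integrated in that chart. -/
theorem IsTensorial.integral_liouville (hF : IsTensorial F G) {Ω : Form D Γ 2}
    (hΩ : IsNondegenerate Ω) (hs : IsSmoothForm Ω) (c : ChartCover D Γ)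
    (hm : StronglyMeasurable (liouvilleDensity Ω G))
    (he : e ∈ IsManifold.maximalAtlas 𝓘(ℝ, Model D) ∞ Γ)
    (h0 : ∀ x ∉ e.source, liouvilleDensity Ω G x = 0) :
    ∫ x, liouvilleDensity Ω G x ∂liouville Ω c =
      ∫ y in e.target, Real.sign (volCoeff Ω e y) * berezin D (F e y) := by
  rw [← setIntegral_eq_integral_of_forall_compl_eq_zero h0, liouville_restrict_source Ω c he,
    ← Measure.restrict_univ (μ := chartMeasure Ω e), setIntegral_chartMeasure hs he
      MeasurableSet.univ hm, preimage_univ, inter_univ]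
  refine setIntegral_congr_fun e.open_target.measurableSet fun y _ ↦ ?_
  have h1 := hF.superDensity_eq hΩ e y
  rw [superDensity, orientationSign, super_ofForm] at h1
  exact h1.symm

end Densities

/-! ### The derivative of the partition function -/

section Variation

variable {D : ℕ} {Γ : Type*} [TopologicalSpace Γ] [ChartedSpace (Model D) Γ]
  [IsManifold 𝓘(ℝ, Model D) ∞ Γ]
  {e : OpenPartialHomeomorph Γ (Model D)} {y : Model D} {J : Set ℝ}

/-- A continuous nowhere vanishing coefficient has locally constant sign. Hence multiplying a cutoff
by the orientation sign keeps it smooth, and the sign passes through derivatives. -/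
theorem eventually_sign_volCoeff {Ω : Form D Γ 2} (hΩ : IsNondegenerate Ω) (hs : IsSmoothForm Ω)
    (he : e ∈ IsManifold.maximalAtlas 𝓘(ℝ, Model D) ∞ Γ) (hy : y ∈ e.target) :
    ∀ᶠ z in 𝓝 y, Real.sign (volCoeff Ω e z) = Real.sign (volCoeff Ω e y) := by
  have hc : ContinuousAt (volCoeff Ω e) y :=
    (continuousOn_volCoeff hs he).continuousAt (e.open_target.mem_nhds hy)
  rcases (volCoeff_ne_zero hΩ he hy).lt_or_gt with h | h
  · filter_upwards [hc.eventually_lt_const h] with z hz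
    rw [Real.sign_of_neg h, Real.sign_of_neg hz]
  · filter_upwards [hc.eventually_const_lt h] with z hz
    rw [Real.sign_of_pos h, Real.sign_of_pos hz]

/-- The coordinate expression of a cutoff, with the orientation of the coordinates. -/
def orientedCutoff (Ω : Form D Γ 2) (ρ : Γ → ℝ) (e : OpenPartialHomeomorph Γ (Model D)) :
    Model D → ℝ :=
  e.target.indicator fun y ↦ Real.sign (volCoeff Ω e y) * ρ (e.symm y)

section Cutoff

variable {Ω : Form D Γ 2} {ρ : Γ → ℝ}

theorem orientedCutoff_eq_zero (hy : y ∉ e '' tsupport ρ) : orientedCutoff Ω ρ e y = 0 := by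
  by_cases h : y ∈ e.target
  · rw [orientedCutoff, indicator_of_mem h, image_eq_zero_of_notMem_tsupport (f := ρ)
      fun h1 ↦ hy ⟨_, h1, e.right_inv h⟩, mul_zero]
  · rw [orientedCutoff, indicator_of_notMem h]

theorem isCompact_image_tsupport (hρ : HasCompactSupport ρ) (hsub : tsupport ρ ⊆ e.source) :
    IsCompact (e '' tsupport ρ) :=
  IsCompact.image_of_continuousOn hρ (e.continuousOn.mono hsub)

theorem hasCompactSupport_orientedCutoff (hρ : HasCompactSupport ρ)
    (hsub : tsupport ρ ⊆ e.source) : HasCompactSupport (orientedCutoff Ω ρ e) :=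
  HasCompactSupport.intro (isCompact_image_tsupport hρ hsub) fun _ ↦ orientedCutoff_eq_zero

theorem tsupport_orientedCutoff (hρ : HasCompactSupport ρ) (hsub : tsupport ρ ⊆ e.source) :
    tsupport (orientedCutoff Ω ρ e) ⊆ e.target := by
  refine (closure_minimal (fun y hy ↦ ?_) (isCompact_image_tsupport hρ hsub).isClosed).trans ?_
  · by_contra h
    exact hy (orientedCutoff_eq_zero h)
  · rintro _ ⟨x, hx, rfl⟩
    exact e.map_source (hsub hx)

theorem orientedCutoff_eventuallyEq (hΩ : IsNondegenerate Ω) (hs : IsSmoothForm Ω)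
    (he : e ∈ IsManifold.maximalAtlas 𝓘(ℝ, Model D) ∞ Γ) (hy : y ∈ e.target) :
    orientedCutoff Ω ρ e =ᶠ[𝓝 y] fun z ↦ Real.sign (volCoeff Ω e y) * (ρ ∘ e.symm) z := by
  filter_upwards [eventually_sign_volCoeff hΩ hs he hy, e.open_target.mem_nhds hy] with z hz hz'
  rw [orientedCutoff, indicator_of_mem hz', hz]
  rfl

theorem contDiff_orientedCutoff (hΩ : IsNondegenerate Ω) (hs : IsSmoothForm Ω)
    (he : e ∈ IsManifold.maximalAtlas 𝓘(ℝ, Model D) ∞ Γ)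
    (hρ : ContMDiff 𝓘(ℝ, Model D) 𝓘(ℝ, ℝ) ∞ ρ) (hρc : HasCompactSupport ρ)
    (hsub : tsupport ρ ⊆ e.source) : ContDiff ℝ ∞ (orientedCutoff Ω ρ e) := by
  rw [contDiff_iff_contDiffAt]
  intro y
  by_cases hy : y ∈ e.target
  · refine ContDiffAt.congr_of_eventuallyEq ?_ (orientedCutoff_eventuallyEq hΩ hs he hy)
    exact contDiffAt_const.mul
      ((contDiffOn_comp_symm hρ he).contDiffAt (e.open_target.mem_nhds hy))
  · refine contDiffAt_const (c := (0 : ℝ)).congr_of_eventuallyEq ?_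
    have hK : y ∉ e '' tsupport ρ := by
      rintro ⟨x, hx, rfl⟩
      exact hy (e.map_source (hsub hx))
    filter_upwards [(isCompact_image_tsupport hρc hsub).isClosed.isOpen_compl.mem_nhds hK]
      with z hz
    exact orientedCutoff_eq_zero hz

theorem fderiv_orientedCutoff (hΩ : IsNondegenerate Ω) (hs : IsSmoothForm Ω)
    (he : e ∈ IsManifold.maximalAtlas 𝓘(ℝ, Model D) ∞ Γ)
    (hρ : ContMDiff 𝓘(ℝ, Model D) 𝓘(ℝ, ℝ) ∞ ρ) (hy : y ∈ e.target) (v : Model D) :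
    fderiv ℝ (orientedCutoff Ω ρ e) y v =
      Real.sign (volCoeff Ω e y) * fderiv ℝ (ρ ∘ e.symm) y v := by
  rw [(orientedCutoff_eventuallyEq hΩ hs he hy).fderiv_eq, fderiv_const_mul]
  · rfl
  · exact ((contDiffOn_comp_symm hρ he).contDiffAt
      (e.open_target.mem_nhds hy)).differentiableAt (by simp)

end Cutoff

variable {S : ℝ → PolyForm D Γ} {χ : ℝ → VField D Γ} {ψ : Form D Γ 1}
  {H : ℝ → Γ → ℝ} {Ω : ℝ → Form D Γ 2}

/-- The derivative of the Berezin integral of `e^S` along a deformation. -/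
theorem IsTriple.hasDerivAt_berezin (h : IsTriple J S χ ψ) (hJ : IsOpen J)
    (hS : ∀ t ∈ J, S t = ofFun (H t) + ofForm 2 (Ω t))
    (he : e ∈ IsManifold.maximalAtlas 𝓘(ℝ, Model D) ∞ Γ) (hy : y ∈ e.target) {t : ℝ}
    (ht : t ∈ J) :
    HasDerivAt (fun s ↦ berezin D (expAction (ofFun (H s) + ofForm 2 (Ω s)) e y))
      (berezin D ((algebraMap ℝ (Grassmann D) (ψ.inChart e y ![(χ t).inChart e y]) +
        toGrassmann (extDeriv (ψ.inChart e) y)) *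
          weight (H t (e.symm y)) (toGrassmann ((Ω t).inChart e y)))) t := by
  have hev := hJ.mem_nhds ht
  have h0 : HasDerivAt (fun s ↦ H s (e.symm y)) (ψ.inChart e y ![(χ t).inChart e y]) t := by
    have h1 := (h.deformation t ht 0 (e.symm y)).alternating_apply ![]
    rw [equivDeriv_ofForm_one, Pi.add_apply, ofForm_same, ofForm_ne (by simp), add_zero] at h1
    have h2 : interior (χ t) ψ (e.symm y) ![] = ψ.inChart e y ![(χ t).inChart e y] := by
      have h3 := DFunLike.congr_fun (inChart_interior (χ t) ψ he hy) ![]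
      rw [inChart_apply] at h3
      refine Eq.trans ?_ (h3.trans rfl)
      congr 1
      exact Subsingleton.elim _ _
    rw [h2] at h1
    refine h1.congr_of_eventuallyEq ?_
    filter_upwards [hev] with s hs
    rw [hS s hs, ofFun_eq, Pi.add_apply, ofForm_same, ofForm_ne (by simp), add_zero,
      constForm_apply]
  have h4 : HasDerivAt (fun s ↦ toGrassmann ((Ω s).inChart e y))
      (toGrassmann (extDeriv (ψ.inChart e) y)) t := by
    have h5 : HasDerivAt (fun s ↦ (Ω s).inChart e y) (ψ.d.inChart e y) t := by
      refine hasDerivAt_alternating fun w ↦ ?_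
      have h1 := (h.deformation t ht 2 (e.symm y)).alternating_apply
        (fun i ↦ tangentSymm e y (w i))
      rw [equivDeriv_ofForm_one, Pi.add_apply, ofForm_same, ofForm_ne (by simp), zero_add] at h1
      refine h1.congr_of_eventuallyEq ?_
      filter_upwards [hev] with s hs
      rw [hS s hs, ofFun_eq, Pi.add_apply, ofForm_same, ofForm_ne (by simp), zero_add,
        inChart_apply]
    rw [h.smooth_form.inChart_d he hy] at h5
    exact (LinearMap.toContinuousLinearMap (toGrassmannₗ D 2)).hasFDerivAt.comp_hasDerivAt t h5
  simp only [expAction_eq]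
  exact (LinearMap.toContinuousLinearMap (berezin D)).hasFDerivAt.comp_hasDerivAt t
    (hasDerivAt_weight h0 (toGrassmann_mem _) (toGrassmann_mem _) h4)

variable [MeasurableSpace Γ] [BorelSpace Γ] [SecondCountableTopology Γ]

/-- With the support in one chart, everything becomes an integral over the model space against the
oriented cutoff. Differentiation under the integral produces d_χψ, which is the divergence of the
current, and integration by parts moves the derivative to the cutoff. -/
theorem IsTriple.hasDerivAt_integral_of_subset (h : IsTriple J S χ ψ) (hJ : IsOpen J)
    (hS : ∀ t ∈ J, S t = ofFun (H t) + ofForm 2 (Ω t))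
    (hH : ContMDiffOn (𝓘(ℝ, ℝ).prod 𝓘(ℝ, Model D)) 𝓘(ℝ, ℝ) ∞ (fun p : ℝ × Γ ↦ H p.1 p.2)
      (J ×ˢ univ)) (hΩ : IsSmoothFormFamily J Ω) (hcl : ∀ t ∈ J, (Ω t).d = 0)
    {Ω₀ : Form D Γ 2} (h₀ : IsNondegenerate Ω₀) (hs₀ : IsSmoothForm Ω₀) (c : ChartCover D Γ)
    (he : e ∈ atlas (Model D) Γ) {ρ : Γ → ℝ} (hρ : ContMDiff 𝓘(ℝ, Model D) 𝓘(ℝ, ℝ) ∞ ρ)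
    (hρc : HasCompactSupport ρ) (hsub : tsupport ρ ⊆ e.source) {t : ℝ} (ht : t ∈ J) :
    HasDerivAt (fun s ↦ ∫ x, ρ x * actionDensity Ω₀ (S s) x ∂liouville Ω₀ c)
      (-∫ x, fluxDensity Ω₀ ρ ψ (S t) x ∂liouville Ω₀ c) t := by
  have he' := IsManifold.subset_maximalAtlas (I := 𝓘(ℝ, Model D)) (n := ∞) he
  have hHt : ∀ t ∈ J, ContMDiff 𝓘(ℝ, Model D) 𝓘(ℝ, ℝ) ∞ (H t) := fun t ht ↦
    (contMDiff_iff_isSmoothForm (D := D)).2 (isSmoothForm_of_family hH ht)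
  have hΩt := fun t ht ↦ hΩ.isSmoothForm (t := t) ht
  set R := orientedCutoff Ω₀ ρ e
  have hR := contDiff_orientedCutoff h₀ hs₀ he' hρ hρc hsub
  have hRc := hasCompactSupport_orientedCutoff (Ω := Ω₀) hρc hsub
  have hRU := tsupport_orientedCutoff (Ω := Ω₀) hρc hsub
  have hb : ContDiffOn ℝ ∞ (fun q : ℝ × Model D ↦
      berezin D (expAction (ofFun (H q.1) + ofForm 2 (Ω q.1)) e q.2)) (J ×ˢ e.target) := by
    simp only [expAction_eq]
    exact ((contDiffOn_family hH he').weight (hΩ e he).toGrassmann).berezin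
  have hderiv := hasDerivAt_integral_mul e.open_target hJ hR hRc hRU hb
    (fun s hs y hy ↦ h.hasDerivAt_berezin hJ hS he' hy hs) ht
  have hleft : ∀ s ∈ J, ∫ x, ρ x * actionDensity Ω₀ (S s) x ∂liouville Ω₀ c =
      ∫ y, R y * berezin D (expAction (ofFun (H s) + ofForm 2 (Ω s)) e y) := by
    intro s hs
    rw [hS s hs]
    have hd : liouvilleDensity Ω₀ (fun x ↦ ρ x • gexp ((ofFun (H s) + ofForm 2 (Ω s)).superAt x)) =
        fun x ↦ ρ x * actionDensity Ω₀ (ofFun (H s) + ofForm 2 (Ω s)) x := by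
      funext x
      rw [liouvilleDensity, map_smul, smul_eq_mul, mul_div_assoc]
      rfl
    have h1 := ((isTensorial_expAction (ofFun (H s) + ofForm 2 (Ω s))).smul ρ).integral_liouville
      h₀ hs₀ c (by
        rw [hd]
        exact (hρ.continuous.mul (continuous_actionDensity h₀ hs₀ (hHt s hs)
          (hΩt s hs))).stronglyMeasurable) he' (by
        intro x hx
        rw [hd]
        simp only
        rw [image_eq_zero_of_notMem_tsupport fun hx' ↦ hx (hsub hx'), zero_mul])
    rw [hd] at h1
    rw [h1, ← integral_indicator e.open_target.measurableSet]
    refine integral_congr_ae (ae_of_all _ fun y ↦ ?_)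
    by_cases hy : y ∈ e.target
    · simp only [R, orientedCutoff, indicator_of_mem hy, map_smul, smul_eq_mul]
      ring
    · simp only [R, orientedCutoff, indicator_of_notMem hy, zero_mul]
  have hcur : ∀ μ, ContDiffOn ℝ ∞ (current (H t ∘ e.symm) ((Ω t).inChart e) (ψ.inChart e) μ)
      e.target := fun μ ↦
    contDiffOn_current (contDiffOn_comp_symm (hHt t ht) he') ((hΩt t ht).contDiffOn he')
      (h.smooth_form.contDiffOn he') μ
  -- Read from the flux side: contracting the current with dR gives the flux density, and
  -- integration by parts turns it into the divergence of the current weighted by R.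
  have hright : ∫ y, R y * berezin D ((algebraMap ℝ (Grassmann D)
        (ψ.inChart e y ![(χ t).inChart e y]) + toGrassmann (extDeriv (ψ.inChart e) y)) *
          weight (H t (e.symm y)) (toGrassmann ((Ω t).inChart e y))) =
      -∫ x, fluxDensity Ω₀ ρ ψ (S t) x ∂liouville Ω₀ c := by
    rw [hS t ht]
    have h1 := (isTensorial_fluxAction ρ ψ (ofFun (H t) + ofForm 2 (Ω t))).integral_liouville
      h₀ hs₀ c (continuous_fluxDensity h₀ hs₀ hρ h.smooth_form (hHt t ht)
        (hΩt t ht)).stronglyMeasurable he' fun x hx ↦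
          fluxDensity_eq_zero_of_notMem hρ fun hx' ↦ hx (hsub hx')
    change ∫ x, fluxDensity Ω₀ ρ ψ (ofFun (H t) + ofForm 2 (Ω t)) x ∂liouville Ω₀ c = _ at h1
    have h2 : ∫ y in e.target, Real.sign (volCoeff Ω₀ e y) *
          berezin D (fluxAction ρ ψ (ofFun (H t) + ofForm 2 (Ω t)) e y) =
        ∫ y, ∑ μ, fderiv ℝ R y (stdVec μ) *
          current (H t ∘ e.symm) ((Ω t).inChart e) (ψ.inChart e) μ y := by
      rw [← integral_indicator e.open_target.measurableSet]
      refine integral_congr_ae (ae_of_all _ fun y ↦ ?_)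
      by_cases hy : y ∈ e.target
      · simp only [indicator_of_mem hy]
        rw [berezin_fluxAction hρ he' hy, Finset.mul_sum]
        refine Finset.sum_congr rfl fun μ _ ↦ ?_
        rw [fderiv_orientedCutoff h₀ hs₀ he' hρ hy, mul_assoc]
      · simp only [indicator_of_notMem hy]
        refine (Finset.sum_eq_zero fun μ _ ↦ ?_).symm
        have h3 : fderiv ℝ R y = 0 := by
          by_contra hne
          exact hy (hRU (support_fderiv_subset ℝ hne))
        rw [h3, zero_apply, zero_mul]
    rw [h1, h2, ← integral_mul_sum_fderiv e.open_target hR hRc hRU hcur]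
    refine integral_congr_ae (ae_of_all _ fun y ↦ ?_)
    by_cases hy : y ∈ e.target
    · have hH' : DifferentiableAt ℝ (H t ∘ e.symm) y :=
        ((contDiffOn_comp_symm (hHt t ht) he').contDiffAt
          (e.open_target.mem_nhds hy)).differentiableAt (by simp)
      have hext : extDeriv ((Ω t).inChart e) y = 0 := by
        rw [← (hΩt t ht).inChart_d he' hy, hcl t ht, inChart_zero, Pi.zero_apply]
      have hv : ∀ w, (Ω t).inChart e y ![(χ t).inChart e y, w] =
          -fderiv ℝ (H t ∘ e.symm) y w := by
        intro w
        have hinv := h.invariant t ht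
        rw [hS t ht] at hinv
        have h3 := ((equivDeriv_eq_zero_iff (isSmoothForm_of_family hH ht) (hΩt t ht)).1 hinv).1
        have h4 := DFunLike.congr_fun (inChart_interior (χ t) (Ω t) he' hy) ![w]
        rw [h3, inChart_neg, Pi.neg_apply, ContinuousAlternatingMap.neg_apply,
          inChart_d_constForm (isSmoothForm_of_family hH ht) he' hy] at h4
        exact h4.symm
      simp only
      rw [sum_fderiv_current hH' ((hΩt t ht).differentiableAt he' hy)
        (h.smooth_form.differentiableAt he' hy) (fun μ ↦ ((hcur μ).contDiffAt
          (e.open_target.mem_nhds hy)).differentiableAt (by simp)) hext hv]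
      rfl
    · have h3 : orientedCutoff Ω₀ ρ e y = 0 := indicator_of_notMem hy _
      simp only [R, h3, zero_mul]
  rw [hright] at hderiv
  refine hderiv.congr_of_eventuallyEq ?_
  filter_upwards [hJ.mem_nhds ht] with s hs
  exact hleft s hs

end Variation

/-! ### The localization principle -/

section Localization

variable {D : ℕ} {Γ : Type*} [TopologicalSpace Γ] [ChartedSpace (Model D) Γ]
  [IsManifold 𝓘(ℝ, Model D) ∞ Γ] [SecondCountableTopology Γ] [T2Space Γ]
  {J : Set ℝ} {S : ℝ → PolyForm D Γ} {χ : ℝ → VField D Γ} {ψ : Form D Γ 1}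

/-- A partition of unity subordinate to the charts, multiplied by ρ; local finiteness leaves
finitely many terms on the compact support. -/
theorem exists_smooth_decomposition {ρ : Γ → ℝ} (hρ : ContMDiff 𝓘(ℝ, Model D) 𝓘(ℝ, ℝ) ∞ ρ)
    (hρc : HasCompactSupport ρ) :
    ∃ (s : Finset Γ) (f : Γ → Γ → ℝ), ρ = ∑ x ∈ s, f x ∧ ∀ x ∈ s,
      ContMDiff 𝓘(ℝ, Model D) 𝓘(ℝ, ℝ) ∞ (f x) ∧ HasCompactSupport (f x) ∧
        tsupport (f x) ⊆ (chartAt (Model D) x).source := by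
  classical
  have : LocallyCompactSpace Γ := ChartedSpace.locallyCompactSpace (Model D) Γ
  obtain ⟨θ, hθ⟩ := SmoothPartitionOfUnity.exists_isSubordinate_chartAt_source
    𝓘(ℝ, Model D) Γ
  have hfin := θ.locallyFinite.finite_nonempty_inter_compact hρc
  refine ⟨hfin.toFinset, fun x z ↦ θ x z * ρ z, ?_, fun x _ ↦ ⟨(θ x).contMDiff.mul hρ,
    hρc.mul_left, (tsupport_mul_subset_left).trans (hθ x)⟩⟩
  funext z
  rw [Finset.sum_apply]
  by_cases hz : z ∈ tsupport ρ
  · have h1 : Function.support (fun x ↦ θ x z) ⊆ hfin.toFinset := by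
      intro x hx
      rw [Finite.coe_toFinset]
      exact ⟨z, hx, hz⟩
    have h2 := θ.sum_eq_one (mem_univ z)
    rw [finsum_eq_sum_of_support_subset _ h1] at h2
    rw [← Finset.sum_mul, h2, one_mul]
  · simp only [image_eq_zero_of_notMem_tsupport hz, mul_zero, Finset.sum_const_zero]

/-! ### Derivatives of cut-off integrals against the Liouville measure -/

section Measure

variable [MeasurableSpace Γ] [BorelSpace Γ]

theorem integrable_of_tsupport {Ω₀ : Form D Γ 2} (hs₀ : IsSmoothForm Ω₀) (c : ChartCover D Γ)
    {ρ f : Γ → ℝ} (hρc : HasCompactSupport ρ) (hf : Continuous f)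
    (h0 : ∀ x ∉ tsupport ρ, f x = 0) : Integrable f (liouville Ω₀ c) := by
  have := isLocallyFiniteMeasure_liouville hs₀ c
  exact hf.integrable_of_hasCompactSupport (HasCompactSupport.intro hρc h0)

/-- The derivative of the partition function with a cutoff is minus the flux. -/
theorem IsTriple.hasDerivAt_integral (h : IsTriple J S χ ψ) (hJ : IsOpen J)
    {Ω₀ : Form D Γ 2} (h₀ : IsNondegenerate Ω₀) (hs₀ : IsSmoothForm Ω₀) (c : ChartCover D Γ)
    {ρ : Γ → ℝ} (hρ : ContMDiff 𝓘(ℝ, Model D) 𝓘(ℝ, ℝ) ∞ ρ)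
    (hρc : HasCompactSupport ρ) {t : ℝ} (ht : t ∈ J) :
    HasDerivAt (fun s ↦ ∫ x, ρ x * actionDensity Ω₀ (S s) x ∂liouville Ω₀ c)
      (-∫ x, fluxDensity Ω₀ ρ ψ (S t) x ∂liouville Ω₀ c) t := by
  obtain ⟨H, Ω, hS, hH, hΩ, hcl, -⟩ := h.hamiltonian
  have hHt : ∀ t ∈ J, ContMDiff 𝓘(ℝ, Model D) 𝓘(ℝ, ℝ) ∞ (H t) := fun t ht ↦
    (contMDiff_iff_isSmoothForm (D := D)).2 (isSmoothForm_of_family hH ht)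
  have hΩt := fun t ht ↦ hΩ.isSmoothForm (t := t) ht
  have hact : ∀ s ∈ J, ∀ {ρ : Γ → ℝ}, ContMDiff 𝓘(ℝ, Model D) 𝓘(ℝ, ℝ) ∞ ρ →
      HasCompactSupport ρ →
      Integrable (fun x ↦ ρ x * actionDensity Ω₀ (S s) x) (liouville Ω₀ c) := by
    intro s hs ρ hρ hρc
    rw [hS s hs]
    refine integrable_of_tsupport hs₀ c hρc (hρ.continuous.mul (continuous_actionDensity h₀ hs₀
      (hHt s hs) (hΩt s hs))) fun x hx ↦ ?_
    rw [image_eq_zero_of_notMem_tsupport hx, zero_mul]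
  have hflux : ∀ {ρ : Γ → ℝ}, ContMDiff 𝓘(ℝ, Model D) 𝓘(ℝ, ℝ) ∞ ρ → HasCompactSupport ρ →
      Integrable (fluxDensity Ω₀ ρ ψ (S t)) (liouville Ω₀ c) := by
    intro ρ hρ hρc
    rw [hS t ht]
    exact integrable_of_tsupport hs₀ c hρc (continuous_fluxDensity h₀ hs₀ hρ h.smooth_form
      (hHt t ht) (hΩt t ht)) fun x hx ↦ fluxDensity_eq_zero_of_notMem hρ hx
  obtain ⟨s, f, hρf, hf⟩ := exists_smooth_decomposition hρ hρc
  -- Both sides are additive in the cutoff. Smoothness and compact support are carried through the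
  -- induction because they supply the integrability that additivity needs.
  have key := Finset.sum_induction f (fun ρ ↦ ContMDiff 𝓘(ℝ, Model D) 𝓘(ℝ, ℝ) ∞ ρ ∧
    HasCompactSupport ρ ∧
    HasDerivAt (fun s ↦ ∫ x, ρ x * actionDensity Ω₀ (S s) x ∂liouville Ω₀ c)
      (-∫ x, fluxDensity Ω₀ ρ ψ (S t) x ∂liouville Ω₀ c) t) ?_ ?_ (s := s) ?_
  · rw [hρf]
    exact key.2.2
  · rintro ρ₁ ρ₂ ⟨h1, hc1, hd1⟩ ⟨h2, hc2, hd2⟩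
    refine ⟨h1.add h2, hc1.add hc2, ?_⟩
    have h3 := hd1.add hd2
    rw [fluxDensity_add h1 h2]
    simp only [Pi.add_apply]
    rw [integral_add (hflux h1 hc1) (hflux h2 hc2), neg_add]
    refine h3.congr_of_eventuallyEq ?_
    filter_upwards [hJ.mem_nhds ht] with s hs
    simp only [Pi.add_apply, add_mul]
    exact integral_add (hact s hs h1 hc1) (hact s hs h2 hc2)
  · have h0 : ContMDiff 𝓘(ℝ, Model D) 𝓘(ℝ, ℝ) ∞ (0 : Γ → ℝ) := contMDiff_const
    refine ⟨h0, HasCompactSupport.zero, ?_⟩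
    have h1 : fluxDensity Ω₀ 0 ψ (S t) = 0 := funext fun x ↦
      fluxDensity_eq_zero (c := 0) h0 (Eventually.of_forall fun _ ↦ rfl)
    rw [h1]
    simpa using hasDerivAt_const t (0 : ℝ)
  · exact fun x hx ↦ ⟨(hf x hx).1, (hf x hx).2.1, h.hasDerivAt_integral_of_subset hJ hS hH hΩ hcl
      h₀ hs₀ c (chart_mem_atlas _ x) (hf x hx).1 (hf x hx).2.1 (hf x hx).2.2 ht⟩

end Measure

/-- The partition function is independent of the parameter and of the charts if there are no
boundary terms. -/
theorem IsTriple.partitionFunction_eq (hJ : IsOpen J) (hJ' : J.OrdConnected) (hJ0 : (0 : ℝ) ∈ J)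
    (h : IsTriple J S χ ψ) (c c' : ChartCover D Γ) (hZ : ∀ t ∈ J, HasPartitionFunction c S t)
    (hB : NoBoundaryTerms c J S ψ) {t : ℝ} (ht : t ∈ J) :
    partitionFunction c S t = partitionFunction c' S 0 := by
  -- The partition function refers only to Lebesgue measure in charts; the Borel structure is needed
  -- for the Liouville measure.
  let _ : MeasurableSpace Γ := borel Γ
  have : BorelSpace Γ := ⟨rfl⟩
  obtain ⟨H, Ω, hS, hH, hΩ, hcl, hnd⟩ := h.hamiltonian
  have hS2 : S 0 2 = Ω 0 := by
    rw [hS 0 hJ0, ofFun_eq, Pi.add_apply, ofForm_same, ofForm_ne (by simp), zero_add]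
  rw [← hS2] at hnd
  have hs₀ : IsSmoothForm (S 0 2) := hS2 ▸ hΩ.isSmoothForm hJ0
  have hcont : ∀ s ∈ J, Continuous (actionDensity (S 0 2) (S s)) := by
    intro s hs
    rw [hS s hs]
    exact continuous_actionDensity hnd hs₀
      ((contMDiff_iff_isSmoothForm (D := D)).2 (isSmoothForm_of_family hH hs))
      (hΩ.isSmoothForm hs)
  have hcontF : ∀ s ∈ J, ∀ {ρ : Γ → ℝ}, ContMDiff 𝓘(ℝ, Model D) 𝓘(ℝ, ℝ) ∞ ρ →
      Continuous (fluxDensity (S 0 2) ρ ψ (S s)) := by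
    intro s hs ρ hρ
    rw [hS s hs]
    exact continuous_fluxDensity hnd hs₀ hρ h.smooth_form
      ((contMDiff_iff_isSmoothForm (D := D)).2 (isSmoothForm_of_family hH hs))
      (hΩ.isSmoothForm hs)
  have hInt : ∀ s ∈ J, Integrable (actionDensity (S 0 2) (S s)) (liouville (S 0 2) c) :=
    fun s hs ↦ ((isTensorial_expAction (S s)).superIntegrable_iff hnd hs₀ c
      (hcont s hs).stronglyMeasurable).1 (hZ s hs)
  -- Independence of the charts: any cover computes the same integral, since the Liouville measures
  -- coincide. Convergence with `c` therefore suffices.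
  have hpart : ∀ s ∈ J, ∀ c₁ : ChartCover D Γ, partitionFunction c₁ S s =
      ∫ x, actionDensity (S 0 2) (S s) x ∂liouville (S 0 2) c := by
    intro s hs c₁
    rw [liouville_eq (S 0 2) c c₁]
    exact (isTensorial_expAction (S s)).superIntegral_eq hnd hs₀ c₁
      (hcont s hs).stronglyMeasurable (liouville_eq (S 0 2) c c₁ ▸ hInt s hs)
  obtain ⟨ρ, hρ, hρc, hρI, hρ1, hlim⟩ := hB
  have hflux : ∀ n, ∀ s ∈ J, superIntegral (S 0 2) c (fluxAction (ρ n) ψ (S s)) =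
      ∫ x, fluxDensity (S 0 2) (ρ n) ψ (S s) x ∂liouville (S 0 2) c := fun n s hs ↦
    (isTensorial_fluxAction (ρ n) ψ (S s)).superIntegral_eq hnd hs₀ c
      (hcontF s hs (hρ n)).stronglyMeasurable (integrable_of_tsupport hs₀ c (hρc n)
        (hcontF s hs (hρ n)) fun x hx ↦ fluxDensity_eq_zero_of_notMem (hρ n) hx)
  -- Because 0 ≤ ρ_n ≤ 1, the absolute value of the full density dominates.
  have hconv : ∀ s ∈ J, Tendsto (fun n ↦ ∫ x, ρ n x * actionDensity (S 0 2) (S s) x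
      ∂liouville (S 0 2) c) atTop
      (𝓝 (∫ x, actionDensity (S 0 2) (S s) x ∂liouville (S 0 2) c)) := by
    intro s hs
    refine tendsto_integral_of_dominated_convergence
      (fun x ↦ ‖actionDensity (S 0 2) (S s) x‖)
      (fun n ↦ ((hρ n).continuous.mul (hcont s hs)).aestronglyMeasurable) (hInt s hs).norm
      (fun n ↦ ae_of_all _ fun x ↦ ?_) (ae_of_all _ fun x ↦ ?_)
    · rw [norm_mul]
      refine mul_le_of_le_one_left (norm_nonneg _) ?_
      rw [Real.norm_eq_abs, abs_of_nonneg (hρI n x).1]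
      exact (hρI n x).2
    · simpa using (hρ1 x).mul_const (actionDensity (S 0 2) (S s) x)
  rw [hpart t ht c, hpart 0 hJ0 c']
  have hseg : uIcc 0 t ⊆ J := hJ'.uIcc_subset hJ0 ht
  have hunif : TendstoUniformlyOn (fun n s ↦ superIntegral (S 0 2) c (fluxAction (ρ n) ψ (S s)))
      (fun _ ↦ 0) atTop (uIcc 0 t) :=
    (tendstoLocallyUniformlyOn_iff_tendstoUniformlyOn_of_compact isCompact_uIcc).1
      (hlim.mono hseg)
  have hdiff := (hconv t ht).sub (hconv 0 hJ0)
  have hzero : Tendsto (fun n ↦ ∫ x, ρ n x * actionDensity (S 0 2) (S t) x ∂liouville (S 0 2) c -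
      ∫ x, ρ n x * actionDensity (S 0 2) (S 0) x ∂liouville (S 0 2) c) atTop (𝓝 0) := by
    rw [Metric.tendsto_atTop]
    intro ε hε
    -- A flux bound ε/(|t|+1) on the segment changes the cut-off integral by at most ε|t|/(|t|+1) <
    -- ε, by the mean value inequality; the added 1 also covers t = 0.
    obtain ⟨N, hN⟩ := eventually_atTop.1
      (Metric.tendstoUniformlyOn_iff.1 hunif (ε / (|t| + 1)) (by positivity))
    refine ⟨N, fun n hn ↦ ?_⟩
    have h1 := (convex_uIcc (0 : ℝ) t).norm_image_sub_le_of_norm_hasDerivWithin_le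
      (fun s hs ↦ (h.hasDerivAt_integral hJ hnd hs₀ c (hρ n) (hρc n)
        (hseg hs)).hasDerivWithinAt) (C := ε / (|t| + 1)) (fun s hs ↦ by
          have h2 := hN n hn s hs
          rw [dist_zero_left, hflux n s (hseg hs)] at h2
          rw [norm_neg]
          exact h2.le) left_mem_uIcc right_mem_uIcc
    rw [dist_zero_right]
    refine h1.trans_lt ?_
    rw [sub_zero, Real.norm_eq_abs, div_mul_eq_mul_div, div_lt_iff₀ (by positivity)]
    nlinarith [abs_nonneg t]
  exact sub_eq_zero.1 (tendsto_nhds_unique hdiff hzero)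

/-- On a compact phase space the partition function converges. -/
theorem IsTriple.hasPartitionFunction [CompactSpace Γ] (hJ0 : (0 : ℝ) ∈ J)
    (h : IsTriple J S χ ψ) (c : ChartCover D Γ) {t : ℝ} (ht : t ∈ J) :
    HasPartitionFunction c S t := by
  let _ : MeasurableSpace Γ := borel Γ
  have : BorelSpace Γ := ⟨rfl⟩
  obtain ⟨H, Ω, hS, hH, hΩ, hcl, hnd⟩ := h.hamiltonian
  have hS2 : S 0 2 = Ω 0 := by
    rw [hS 0 hJ0, ofFun_eq, Pi.add_apply, ofForm_same, ofForm_ne (by simp), zero_add]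
  rw [← hS2] at hnd
  have hs₀ : IsSmoothForm (S 0 2) := hS2 ▸ hΩ.isSmoothForm hJ0
  have hcont : Continuous (actionDensity (S 0 2) (S t)) := by
    rw [hS t ht]
    exact continuous_actionDensity hnd hs₀
      ((contMDiff_iff_isSmoothForm (D := D)).2 (isSmoothForm_of_family hH ht))
      (hΩ.isSmoothForm ht)
  refine ((isTensorial_expAction (S t)).superIntegrable_iff hnd hs₀ c
    hcont.stronglyMeasurable).2 ?_
  have := isLocallyFiniteMeasure_liouville hs₀ c
  exact hcont.integrable_of_hasCompactSupport (HasCompactSupport.of_compactSpace _)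

/-- On a compact phase space there are no boundary terms. -/
theorem noBoundaryTerms_of_compactSpace [CompactSpace Γ] (c : ChartCover D Γ) (J : Set ℝ)
    (S : ℝ → PolyForm D Γ) (ψ : Form D Γ 1) : NoBoundaryTerms c J S ψ := by
  have hρ : ContMDiff 𝓘(ℝ, Model D) 𝓘(ℝ, ℝ) ∞ (fun _ : Γ ↦ (1 : ℝ)) := contMDiff_const
  refine ⟨fun _ _ ↦ 1, fun _ ↦ hρ, fun _ ↦ HasCompactSupport.of_compactSpace _,
    fun _ _ ↦ by simp, fun _ ↦ tendsto_const_nhds, ?_⟩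
  have h0 : ∀ e y, (ofFun (fun _ : Γ ↦ (1 : ℝ)) : PolyForm D Γ).d.super e y = 0 := by
    intro e y
    rw [isTensorial_super _ e y, superAt_d_eq_zero hρ (Eventually.of_forall fun _ ↦ rfl), map_zero]
  have h1 : ∀ t, superIntegral (S 0 2) c (fun e y ↦
      (ofFun (fun _ : Γ ↦ (1 : ℝ)) : PolyForm D Γ).d.super e y * (ofForm 1 ψ).super e y *
        expAction (S t) e y) = 0 := by
    intro t
    simp [superIntegral, superDensity, h0]
  simp only [h1]
  exact fun u hu s _ ↦ ⟨univ, univ_mem, Eventually.of_forall fun _ _ _ ↦ refl_mem_uniformity hu⟩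

end Localization

end LocalizationPrinciple

end

/-! ### The localization principle with its two classes of examples -/

open LocalizationPrinciple in
theorem theorem1 {D : ℕ} {Γ : Type*} [TopologicalSpace Γ] [T2Space Γ] [SecondCountableTopology Γ]
    [ChartedSpace (Model D) Γ] [IsManifold 𝓘(ℝ, Model D) ∞ Γ]
    (J : Set ℝ) (hJ_open : IsOpen J) (hJ_interval : J.OrdConnected) (hJ_zero : (0 : ℝ) ∈ J) :
    -- the localization principle
    (∀ (S : ℝ → PolyForm D Γ) (χ : ℝ → VField D Γ) (ψ : Form D Γ 1), IsTriple J S χ ψ →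
      (CompactSpace Γ → ∀ c c' : ChartCover D Γ, ∀ t ∈ J,
        HasPartitionFunction c S t ∧ partitionFunction c S t = partitionFunction c' S 0) ∧
      (∀ c c' : ChartCover D Γ, (∀ t ∈ J, HasPartitionFunction c S t) →
        NoBoundaryTerms c J S ψ →
        ∀ t ∈ J, partitionFunction c S t = partitionFunction c' S 0)) ∧
    -- BRST localization data form a triple
    (∀ (H : Γ → ℝ) (Ω : Form D Γ 2) (χ : VField D Γ) (ψ : Form D Γ 1) (β : ℝ),
      ContMDiff 𝓘(ℝ, Model D) 𝓘(ℝ, ℝ) ∞ H → IsSymplectic Ω → IsSmoothVField χ →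
      equivDeriv χ (ofFun H + ofForm 2 Ω) = 0 →
      IsSmoothForm ψ → lieDeriv χ (ofForm 1 ψ) = 0 → β ≠ 0 →
      IsTriple J (fun t ↦ (-β) • (ofFun H + ofForm 2 Ω) + t • equivDeriv χ (ofForm 1 ψ))
        (fun _ ↦ χ) ψ) ∧
    -- a triple with constant vector field is of the BRST kind
    (∀ (S : ℝ → PolyForm D Γ) (χ : VField D Γ) (ψ : Form D Γ 1), IsTriple J S (fun _ ↦ χ) ψ →
      lieDeriv χ (ofForm 1 ψ) = 0 ∧
      ∀ t ∈ J, S t = S 0 + t • equivDeriv χ (ofForm 1 ψ)) ∧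
    -- a canonical transformation generated by a function gives a triple with exact one-form
    (∀ (H F : Γ → ℝ) (Ω : Form D Γ 2) (u : VField D Γ) (Φ : ℝ → Γ → Γ),
      ContMDiff 𝓘(ℝ, Model D) 𝓘(ℝ, ℝ) ∞ H → ContMDiff 𝓘(ℝ, Model D) 𝓘(ℝ, ℝ) ∞ F →
      IsSymplectic Ω → IsSmoothVField u → equivDeriv u (ofFun F + ofForm 2 Ω) = 0 →
      IsSmoothFlow u Φ →
      ∃ χ : ℝ → VField D Γ,
        IsTriple J (fun t ↦ pullback (Φ (-t)) (ofFun H + ofForm 2 Ω)) χ (dFun F)) ∧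
    -- a triple with exact one-form is a canonical transformation
    (∀ (S : ℝ → PolyForm D Γ) (χ : ℝ → VField D Γ) (F : Γ → ℝ),
      ContMDiff 𝓘(ℝ, Model D) 𝓘(ℝ, ℝ) ∞ F → IsTriple J S χ (dFun F) →
      ∃ u : VField D Γ, IsSmoothVField u ∧
        equivDeriv u (ofFun F + ofForm 2 (S 0 2)) = 0 ∧
        (∀ t ∈ J, S t 2 = S 0 2) ∧
        (∀ t ∈ J, HasParamDerivAt S (-lieDeriv u (S t)) t) ∧
        ∀ Φ : ℝ → Γ → Γ, IsSmoothFlow u Φ → ∀ t ∈ J,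
          pullback (Φ t) (ofForm 2 (S 0 2)) = ofForm 2 (S 0 2) ∧
          pullback (Φ t) (S t) = S 0) := by
  refine ⟨fun S χ ψ h ↦ ⟨fun _ c c' t ht ↦ ⟨h.hasPartitionFunction hJ_zero c ht,
      h.partitionFunction_eq hJ_open hJ_interval hJ_zero c c'
        (fun s hs ↦ h.hasPartitionFunction hJ_zero c hs)
        (noBoundaryTerms_of_compactSpace c J S ψ) ht⟩,
      fun c c' hZ hB t ht ↦
        h.partitionFunction_eq hJ_open hJ_interval hJ_zero c c' hZ hB ht⟩,
    fun H Ω χ ψ β hH hΩ hχ hinv hψ hL hβ ↦ isTriple_brst hH hΩ hχ hinv hψ hL hβ,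
    fun S χ ψ h ↦ ⟨h.lieDeriv_eq_zero hJ_open hJ_interval hJ_zero,
      fun t ht ↦ h.eq_affine hJ_open hJ_interval hJ_zero ht⟩,
    fun H F Ω u Φ hH hF hΩ hu hinv hΦ ↦ exists_isTriple_flow hH hF hΩ hu hinv hΦ,
    fun S χ F hF h ↦ h.exists_canonical hJ_open hJ_interval hJ_zero hF⟩
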